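/- **Security of the hidden-subspace mini-scheme.** For $n\in\mathbb N$ let $\mathcal G$ be a uniformly random function that maps each $r\in\{0,1\}^n$ to a list $\langle A_r\rangle$ of $\lfloor n/2\rfloor$ linearly independent vectors of $\mathbb F_2^n$ and a serial number $s_r\in\{0,1\}^{3n}$, subject to the $s_r$ being distinct. Let $A_r$ be the span of $\langle A_r\rangle$, $A_r^\perp=\{x : a\cdot x=0\ \forall a\in A_r\}$, and $|A_r\rangle=|A_r|^{-1/2}\sum_{x\in A_r}|x\rangle$. All parties have quantum (phase) access to the classical oracle $U$ with four components: * the banknote generator $\mathcal G$, through $|r\rangle|y\rangle\mapsto(-1)^{y\cdot\mathcal G(r)}|r\rangle|y\rangle$; * the serial number checker $\mathcal H(s)$, which is $1$ iff $s=s_r$ for some $r$; * the primal subspace tester, which maps $|s\rangle|x\rangle$ to $-|s\rangle|x\rangle$ if $s=s_r$ for some $r$ and $x\in A_r$, and fixes it otherwise; * the dual subspace tester, the same with $A_r^\perp$ instead of $A_r$. The mini-scheme is as follows. $\mathsf{Bank}(0^n)$ picks $r\in\{0,1\}^n$ uniformly and outputs the banknote $|s_r\rangle|A_r\rangle$. $\mathsf{Ver}$,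 on an alleged banknote $(s,\rho)$, checks with $\mathcal H$ that $s$ is valid, then uses the testers to apply $V_{A_r}=H_2^{\otimes n}\mathbb P_{A_r^\perp}H_2^{\otimes n}\mathbb P_{A_r}$ to $\rho$, where $\mathbb P_B$ is the projective measurement that accepts $|x\rangle$ iff $x\in B$; it accepts iff all these tests accept. A counterfeiter $C$ is a quantum circuit with access to $U$ that maps a banknote $|s_r\rangle|A_r\rangle$ (and ancillas $|0\cdots0\rangle$) to two possibly entangled $n$-qubit states $\sigma_1,\sigma_2$; it succeeds if $\mathsf{Ver}(s_r,\sigma_1)$ and $\mathsf{Ver}(s_r,\sigma_2)$ both accept. Its size is the number of its gates, each of which is an oracle query or a unitary on any number of qubits. Then: 1. (Efficiency) $\mathsf{Bank}$ (exactly) and $\mathsf{Ver}$ are realised by oracle circuits of size polynomial in $n$ over a fixed finite set of gates on at most three qubits, together with oracle queries. 2. (Perfect completeness) For every $n$, every possible $\mathcal G$ and every $r$, $\mathsf{Ver}$ accepts $|s_r\rangle|A_r\rangle$ with probability $1$. 3. (Soundness error $1/\exp(n)$) There is a constant $c>0$ such that for every polynomial $p$ and all sufficiently large $n$, every counterfeiter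 of size at most $p(n)$ succeeds with probability at most $2^{-cn}$, over the choice of $\mathcal G$ and $r$ and the measurements. -/

import Mathlib

namespace HiddenSubspace

/-- Assignments of bits to a set `W` of wires: the computational basis of a register of qubits. -/
abbrev Bits (W : Type) : Type := W → ZMod 2

/-- Vectors of amplitudes of the qubits `W`. -/
abbrev State (W : Type) : Type := Bits W → ℂ

/-! ### The classical oracle -/

/-- A banknote generator `𝒢`. On a seed `r ∈ {0,1}ⁿ` it returns a list `(𝒢 r).1` of `⌊n/2⌋` linearly
independent vectors of `𝔽₂ⁿ` and a serial number `(𝒢 r).2 ∈ {0,1}³ⁿ`; the serial numbers of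
distinct seeds are distinct. All four components of the oracle are functions of `𝒢`. -/
abbrev Oracle (n : ℕ) : Type :=
  {G : Bits (Fin n) → (Fin (n / 2) → Bits (Fin n)) × Bits (Fin (3 * n)) //
    (∀ r, LinearIndependent (ZMod 2) (G r).1) ∧ Function.Injective fun r => (G r).2}

noncomputable instance (n : ℕ) : Fintype (Oracle n) := Fintype.ofFinite _

namespace Oracle

variable {n : ℕ}

/-- The generators of the subspace of seed `r`. -/
def gens (O : Oracle n) (r : Bits (Fin n)) : Fin (n / 2) → Bits (Fin n) := (O.1 r).1

/-- The serial number `s_r`. -/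
def serial (O : Oracle n) (r : Bits (Fin n)) : Bits (Fin (3 * n)) := (O.1 r).2

/-- The hidden subspace `A_r ≤ 𝔽₂ⁿ`. -/
def subspace (O : Oracle n) (r : Bits (Fin n)) : Submodule (ZMod 2) (Bits (Fin n)) :=
  Submodule.span (ZMod 2) (Set.range (O.gens r))

/-- The inner product `y · 𝒢(r) ∈ 𝔽₂` of the bits of `𝒢(r)` with a bit string `y`, which is given in
two parts. The phase `(-1)^(y · 𝒢(r))` is the function oracle `|r⟩|y⟩ ↦ |r⟩|y + 𝒢(r)⟩` up to
Hadamard gates on `y`; taking for `y` a unit vector gives the individual bits of `𝒢(r)`. -/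
def generatorBit (O : Oracle n) (r : Bits (Fin n)) (yg : Fin (n / 2) → Bits (Fin n))
    (ys : Bits (Fin (3 * n))) : ZMod 2 :=
  (∑ i, ∑ j, yg i j * O.gens r i j) + ∑ l, ys l * O.serial r l

/-- The serial number checker `ℋ`. -/
def Valid (O : Oracle n) (s : Bits (Fin (3 * n))) : Prop := ∃ r, O.serial r = s

/-- The predicate of the primal tester: `s = s_r` is valid and `x ∈ A_r`. -/
def Primal (O : Oracle n) (s : Bits (Fin (3 * n))) (x : Bits (Fin n)) : Prop :=
  ∃ r, O.serial r = s ∧ x ∈ O.subspace r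

/-- The predicate of the dual tester: `s = s_r` is valid and `x ∈ A_r^⊥`. -/
def Dual (O : Oracle n) (s : Bits (Fin (3 * n))) (x : Bits (Fin n)) : Prop :=
  ∃ r, O.serial r = s ∧ ∀ a ∈ O.subspace r, a ⬝ᵥ x = 0

end Oracle

/-- There is a banknote generator for every `n`, so that averages over all of them are genuine. -/
instance (n : ℕ) : Nonempty (Oracle n) := by
  refine ⟨⟨fun r => (fun i => Pi.single ⟨i, by omega⟩ 1,
    fun l => if h : (l : ℕ) < n then r ⟨l, h⟩ else 0), fun r => ?_, ?_⟩⟩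
  · have h := (Pi.basisFun (ZMod 2) (Fin n)).linearIndependent.comp
      (fun i : Fin (n / 2) => (⟨i, by omega⟩ : Fin n)) (fun a b hab => by
        simpa [Fin.ext_iff] using hab)
    convert h using 1
    funext i
    simp
  · intro r r' h
    funext j
    have := congrFun h ⟨j, by omega⟩
    simpa using this

/-! ### Quantum circuits with oracle gates -/

/-- Gates on the qubits `W`: a unitary on `k` distinct qubits, or a query to one of the four
components of the oracle, controlled by the qubit `c`, with arguments read from the given qubits.
(Queries are diagonal in the computational basis.) -/
inductive Gate (n : ℕ) (W : Type) : Type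
  | unitary (k : ℕ) (w : Fin k ↪ W) (u : Matrix.unitaryGroup (Bits (Fin k)) ℂ)
  | generator (c : W) (r : Fin n → W) (yg : Fin (n / 2) → Fin n → W) (ys : Fin (3 * n) → W)
  | serialChecker (c : W) (s : Fin (3 * n) → W)
  | primalTester (c : W) (s : Fin (3 * n) → W) (x : Fin n → W)
  | dualTester (c : W) (s : Fin (3 * n) → W) (x : Fin n → W)

namespace Gate

variable {n : ℕ} {W W' : Type}

open Classical in
/-- The action of a gate on amplitudes. A unitary `u` on the qubits `w` replaces the bits on `w`;
a query multiplies a basis state by `-1` if its control bit and the queried bit are both `1`. -/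
noncomputable def apply (O : Oracle n) : Gate n W → State W → State W
  | unitary _ w u, ψ => fun b => ∑ c, u.1 (b ∘ w) c * ψ (Function.extend w c b)
  | generator c r yg ys, ψ => fun b =>
      (if b c = 1 ∧ O.generatorBit (b ∘ r) (fun i => b ∘ yg i) (b ∘ ys) = 1 then -1 else 1) * ψ b
  | serialChecker c s, ψ => fun b => (if b c = 1 ∧ O.Valid (b ∘ s) then -1 else 1) * ψ b
  | primalTester c s x, ψ => fun b =>
      (if b c = 1 ∧ O.Primal (b ∘ s) (b ∘ x) then -1 else 1) * ψ b
  | dualTester c s x, ψ => fun b =>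
      (if b c = 1 ∧ O.Dual (b ∘ s) (b ∘ x) then -1 else 1) * ψ b

/-- The same gate on renamed qubits. -/
def map (e : W ↪ W') : Gate n W → Gate n W'
  | unitary k w u => unitary k (w.trans e) u
  | generator c r yg ys => generator (e c) (e ∘ r) (fun i => e ∘ yg i) (e ∘ ys)
  | serialChecker c s => serialChecker (e c) (e ∘ s)
  | primalTester c s x => primalTester (e c) (e ∘ s) (e ∘ x)
  | dualTester c s x => dualTester (e c) (e ∘ s) (e ∘ x)

/-- The gates of honest parties: queries, and the finite set of unitaries on at most three qubits with
entries `0`, `1` and `±1/√2` (among them Hadamard, NOT, CNOT and Toffoli gates). -/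
def IsElementary : Gate n W → Prop
  | unitary k _ u => k ≤ 3 ∧
      ∀ x y, u.1 x y ∈ ({0, 1, ((√2 : ℝ) : ℂ)⁻¹, -((√2 : ℝ) : ℂ)⁻¹} : Set ℂ)
  | _ => True

end Gate

/-- A circuit is a list of gates, the first of which is applied first; its length is its size. -/
abbrev Circuit (n : ℕ) (W : Type) : Type := List (Gate n W)

/-- Run a circuit on a state. -/
noncomputable def Circuit.run {n : ℕ} {W : Type} (O : Oracle n) (C : Circuit n W)
    (ψ : State W) : State W :=
  C.foldl (fun φ g => g.apply O φ) ψ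

/-- Adjoin qubits `Z` in the state `|0…0⟩`. -/
noncomputable def withZeros {W Z : Type} (ψ : State W) : State (W ⊕ Z) :=
  open Classical in fun b => if b ∘ Sum.inr = 0 then ψ (b ∘ Sum.inl) else 0

/-- The Hadamard matrix `(1/√2) (1 1; 1 -1)`. -/
noncomputable def hadamardMatrix : Matrix (Bits (Fin 1)) (Bits (Fin 1)) ℂ :=
  Matrix.of fun x y => if x 0 = 1 ∧ y 0 = 1 then -((√2 : ℝ) : ℂ)⁻¹ else ((√2 : ℝ) : ℂ)⁻¹

theorem hadamardMatrix_mem : hadamardMatrix ∈ Matrix.unitaryGroup (Bits (Fin 1)) ℂ := by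
  have h2 : (((√2 : ℝ) : ℂ)⁻¹) * (((√2 : ℝ) : ℂ)⁻¹) = 1 / 2 := by
    rw [← mul_inv, ← Complex.ofReal_mul, Real.mul_self_sqrt (by norm_num)]
    norm_num
  rw [Matrix.mem_unitaryGroup_iff]
  ext x y
  have key : ∀ f : Bits (Fin 1) → ℂ, ∑ z, f z = f (fun _ => 0) + f (fun _ => 1) := by
    intro f
    rw [← (Equiv.funUnique (Fin 1) (ZMod 2)).symm.sum_comp f]
    exact Fin.sum_univ_two _
  have hx : x = (fun _ => x 0) := by funext i; rw [Subsingleton.elim i 0]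
  have hy : y = (fun _ => y 0) := by funext i; rw [Subsingleton.elim i 0]
  have h01 : ∀ a : ZMod 2, a = 0 ∨ a = 1 := by decide
  have hne : ((fun _ => 0 : Bits (Fin 1)) = fun _ => 1) ↔ False := by simp [funext_iff]
  have hne' : ((fun _ => 1 : Bits (Fin 1)) = fun _ => 0) ↔ False := by simp [funext_iff]
  rw [hx, hy, Matrix.mul_apply, key]
  rcases h01 (x 0) with h | h <;> rcases h01 (y 0) with h' | h' <;> rw [h, h'] <;>
    simp [hadamardMatrix, Matrix.star_apply, hne, hne', h2] <;> norm_num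

/-- The Hadamard gate on the qubit `i`. -/
noncomputable def hadamard {n : ℕ} {W : Type} (i : W) : Gate n W :=
  .unitary 1 ⟨fun _ => i, fun _ _ _ => Subsingleton.elim _ _⟩ ⟨hadamardMatrix, hadamardMatrix_mem⟩

/-! ### The mini-scheme -/

/-- The qubits of a banknote: serial number and money state. -/
abbrev Note (n : ℕ) : Type := Fin (3 * n) ⊕ Fin n

/-- The money state `|A⟩`, the uniform superposition over `A`. -/
noncomputable def subspaceState {n : ℕ} (A : Submodule (ZMod 2) (Bits (Fin n))) : State (Fin n) :=
  open Classical in fun x => if x ∈ A then ((√(Nat.card A : ℝ) : ℝ) : ℂ)⁻¹ else 0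

/-- The banknote `|s_r⟩|A_r⟩`. -/
noncomputable def banknote {n : ℕ} (O : Oracle n) (r : Bits (Fin n)) : State (Note n) :=
  open Classical in fun b =>
    if b ∘ Sum.inl = O.serial r then subspaceState (O.subspace r) (b ∘ Sum.inr) else 0

/-- The density matrix of the output of `Bank(0ⁿ)`: the banknote of a uniformly random seed. -/
noncomputable def bankOutput {n : ℕ} (O : Oracle n) : Matrix (Bits (Note n)) (Bits (Note n)) ℂ :=
  Matrix.of fun x y =>
    ((2 : ℂ) ^ n)⁻¹ * ∑ r, banknote O r x * (starRingEnd ℂ) (banknote O r y)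

/-- The verifier, on a banknote and three further qubits that are initially `0`. Each of these is put
into the state `|+⟩`, controls one query, and is measured in the basis `|+⟩, |-⟩`; the outcome
`|-⟩`, recorded as `1`, says that the queried predicate holds. The first one checks the serial
number, the second one performs the projection onto `A`, and the third one the projection onto
`A^⊥`, before and after which all `n` qubits of the money state undergo a Hadamard gate. -/
noncomputable def verCircuit (n : ℕ) : Circuit n (Note n ⊕ Fin 3) :=
  let s : Fin (3 * n) → Note n ⊕ Fin 3 := fun l => .inl (.inl l)
  let x : Fin n → Note n ⊕ Fin 3 := fun j => .inl (.inr j)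
  [hadamard (.inr 0), .serialChecker (.inr 0) s, hadamard (.inr 0)] ++
  [hadamard (.inr 1), .primalTester (.inr 1) s x, hadamard (.inr 1)] ++
  (List.finRange n).map (fun j => hadamard (x j)) ++
  [hadamard (.inr 2), .dualTester (.inr 2) s x, hadamard (.inr 2)] ++
  (List.finRange n).map (fun j => hadamard (x j))

/-- The probability that the verifier accepts the alleged banknote `ψ`, that is, that its three
measurements all give `1`. -/
noncomputable def verProb {n : ℕ} (O : Oracle n) (ψ : State (Note n)) : ℝ :=
  ∑ b : Bits (Note n ⊕ Fin 3), if ∀ a, b (.inr a) = 1 then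
    ‖(verCircuit n).run O (withZeros ψ) b‖ ^ 2 else 0

/-- Every valid banknote is accepted with certainty, whatever the oracle. -/
def PerfectCompleteness : Prop :=
  ∀ (n : ℕ) (O : Oracle n) (r : Bits (Fin n)), verProb O (banknote O r) = 1

/-- The verifier is a family of circuits of polynomial size. -/
def VerifierPolynomialSize : Prop :=
  ∃ p : Polynomial ℕ, ∀ n, (verCircuit n).length ≤ p.eval n ∧ ∀ g ∈ verCircuit n, g.IsElementary

/-- The bank is realised by a family of circuits of polynomial size: started on `|0…0⟩`, the circuit
leaves exactly the mixed state `bankOutput O` on the first `4n` qubits. -/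
def BankPolynomialSize : Prop :=
  ∃ p : Polynomial ℕ, ∀ n, ∃ m ≤ p.eval n, ∃ B : Circuit n (Note n ⊕ Fin m),
    B.length ≤ p.eval n ∧ (∀ g ∈ B, g.IsElementary) ∧
    ∀ (O : Oracle n) (x y : Bits (Note n)),
      (∑ z : Bits (Fin m), B.run O (Pi.single 0 1) (Sum.elim x z) *
        (starRingEnd ℂ) (B.run O (Pi.single 0 1) (Sum.elim y z))) = bankOutput O x y

/-! ### Counterfeiters -/

/-- A counterfeiter: a circuit on a banknote and `m` ancilla qubits, and the positions of the two
`n`-qubit registers that it outputs. Its unitary gates may act on any number of qubits, which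
includes the circuits over every gate set. -/
structure Counterfeiter (n : ℕ) where
  m : ℕ
  circuit : Circuit n (Note n ⊕ Fin m)
  out : Fin 2 × Fin n ↪ Note n ⊕ Fin m

namespace Counterfeiter

variable {n : ℕ}

/-- The qubits of a counterfeiting attempt: those of the counterfeiter, and those of the double
verifier, namely the serial number and three work qubits for each of the two verifications. -/
abbrev Wires (C : Counterfeiter n) : Type := (Note n ⊕ Fin C.m) ⊕ (Fin (3 * n) ⊕ Fin 2 × Fin 3)

/-- The qubits on which the `i`-th verification is run: the serial number, the `i`-th output of the
counterfeiter, and the `i`-th triple of work qubits. -/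
def verWires (C : Counterfeiter n) (i : Fin 2) : Note n ⊕ Fin 3 ↪ C.Wires where
  toFun := Sum.elim
    (Sum.elim (fun l => .inr (.inl l)) (fun j => .inl (C.out (i, j))))
    (fun a => .inr (.inr (i, a)))
  inj' := by
    rintro ((a | a) | a) ((b | b) | b) h <;> simp_all

/-- The counterfeiter, followed by both verifications. -/
noncomputable def attempt (C : Counterfeiter n) : Circuit n C.Wires :=
  C.circuit.map (Gate.map Function.Embedding.inl) ++
  (verCircuit n).map (Gate.map (C.verWires 0)) ++
  (verCircuit n).map (Gate.map (C.verWires 1))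

/-- The initial state: the counterfeiter holds the banknote of seed `r` and zeros, the double verifier
holds the serial number and zeros. -/
noncomputable def initial (C : Counterfeiter n) (O : Oracle n) (r : Bits (Fin n)) :
    State C.Wires :=
  open Classical in fun b =>
    if b ∘ Sum.inr ∘ Sum.inl = O.serial r ∧ b ∘ Sum.inr ∘ Sum.inr = 0 then
      withZeros (banknote O r) (b ∘ Sum.inl) else 0

/-- The probability that both verifications accept, for a given oracle and seed. -/
noncomputable def successProbAt (C : Counterfeiter n) (O : Oracle n) (r : Bits (Fin n)) : ℝ :=
  ∑ b : Bits C.Wires, if ∀ a, b (.inr (.inr a)) = 1 then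
    ‖C.attempt.run O (C.initial O r) b‖ ^ 2 else 0

/-- The probability that both verifications accept, for a uniformly random oracle and seed. -/
noncomputable def successProb (C : Counterfeiter n) : ℝ :=
  (∑ O : Oracle n, ∑ r : Bits (Fin n), C.successProbAt O r) /
    ((Fintype.card (Oracle n) : ℝ) * (2 : ℝ) ^ n)

end Counterfeiter

/-- Soundness error `δ`: counterfeiters of polynomial size succeed with probability at most `δ n`, for
all sufficiently large `n`. -/
def HasSoundnessError (δ : ℕ → ℝ) : Prop :=
  ∀ p : Polynomial ℕ, ∀ᶠ n in Filter.atTop, ∀ C : Counterfeiter n,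
    C.circuit.length ≤ p.eval n → C.successProb ≤ δ n

end HiddenSubspace

/-!
# The hidden-subspace mini-scheme

*The verifier.* On a valid serial number the two subspace tests, with Hadamard transforms around the
second one, compose to the projection onto `|A_r⟩`, because the Fourier transform of the indicator
function of `A^⊥` is that of `A` up to a factor (`runIn_verCircuit_serial`). This gives perfect
completeness, and shows that the success probability of a counterfeiter is the squared norm of the
projection of its final state onto `|A_r⟩|A_r⟩` (`Counterfeiter.successProbAt_eq_overlap`).

*Soundness.* Let `T` be the number of gates. All replacements of oracles below are controlled by the
hybrid argument (`Circuit.sum_nrm_runIn_sub_runIn`): if the worlds `w' i` differ from `w` in pairwise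
disjoint sets of basis states, then the squared distances of the final states sum to at most `4T²`.

* Concealing the seed. An oracle with one additional entry, which no seed reaches, is exchanged with
  the entry of a random seed (`ExtOracle.sum_nrm_exchange_le`). As different seeds affect disjoint sets
  of queries, it costs `O(T² / 2ⁿ)` to assume that the counterfeited note is the additional one. Its
  subspace `A` may then be moved by a random linear automorphism, independently of everything else
  (`ExtOracle.sum_transform`).
* Blurring the testers. Let `K` be the field with `2^⌊n/4⌋` elements, and place `A` in a flag
  `B ≤ A ≤ D` with `A/B ≅ K` and `D/A ≅ K`. The primal tester is replaced by that of `D` and the dual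
  one by that of `B^⊥`. Multiplications by elements of `K` define `|K|` shears that fix `A`, and
  whose flags have outer spaces that pairwise intersect in `A`, and inner ones that pairwise span `A`.
  So the replacement costs `O(T² / |K|)` on average over the shears (`sum_nrm_outerShear_le`).
* No cloning. Now only the note depends on the position of `A` between `B` and `D`. This position is
  varied over the graphs of the linearized polynomials `ax + bx² + cx⁴` over `K`, any two of which agree
  in at most four points. The notes are superpositions of `|K|` states out of `|K|²` common ones, and
  their squares `|A⟩|A⟩` are almost orthogonal. The Bessel type inequality `sum_norm_sq_sum_le`, for
  the two kinds of overlaps together, bounds the average probability to clone them by `65 / |K|`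
  (`sum_overlap_innerShear_le`). The cube of the number of agreements enters, once for the note and
  twice for the two copies, so three coefficients are needed to balance the diagonal terms.

The sum is `O(T² / 2^(n/4))`, which for polynomial `T` is below `2^(-n/8)` eventually.

*The bank.* Hadamard gates prepare a uniform superposition of seeds `r` and coefficients
`t ∈ 𝔽₂^⌊n/2⌋`; queries between Hadamard gates write `𝒢(r)`; and a reversible program adds
`∑ tᵢ aᵢ` to the money register. The coefficients have to be erased, since otherwise they would be
entangled with the money state. The program does this by elimination: it maintains a matrix whose
kernel is the span of the generators treated so far, finds a functional that is `1` on the next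
generator and `0` on the previous ones, and uses it to read the coefficient off the money register
(`Bank.Invariant.succ`). What remains in the work qubits depends on `r` only, and determines it, so
discarding these qubits leaves the uniform mixture of the banknotes (`Bank.sum_run_circuit`).
-/

namespace HiddenSubspace

/-! ### Overwriting bits -/

section Extend

variable {J W : Type}

theorem extend_comp_self {w : J → W} (hw : w.Injective) (b : Bits W) :
    Function.extend w (b ∘ w) b = b := by
  funext x
  by_cases h : ∃ j, w j = x
  · obtain ⟨j, rfl⟩ := h
    simp [hw.extend_apply]
  · rw [Function.extend_apply' _ _ _ h]

theorem extend_extend {w : J → W} (hw : w.Injective) (c d : Bits J) (b : Bits W) :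
    Function.extend w d (Function.extend w c b) = Function.extend w d b := by
  funext x
  by_cases h : ∃ j, w j = x
  · obtain ⟨j, rfl⟩ := h
    simp [hw.extend_apply]
  · simp [Function.extend_apply' _ _ _ h]

theorem extend_comp' {w : J → W} (hw : w.Injective) (c : Bits J) (b : Bits W) :
    Function.extend w c b ∘ w = c := Function.extend_comp hw c b

theorem extend_eq {f : J → W} (hf : f.Injective) {x : Bits J} {b d : Bits W}
    (h : ∀ j, d (f j) = x j) (h' : ∀ w, (∀ j, f j ≠ w) → d w = b w) :
    Function.extend f x b = d := by
  funext w
  by_cases hw : ∃ j, f j = w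
  · obtain ⟨j, rfl⟩ := hw
    rw [hf.extend_apply, h]
  · rw [Function.extend_apply' _ _ _ hw, h' w fun j hj => hw ⟨j, hj⟩]

/-- Overwriting the bits on `w` by all possible strings visits every assignment equally often. -/
theorem sum_sum_extend [Fintype J] [DecidableEq J] [Fintype W] [DecidableEq W] {M : Type*}
    [AddCommMonoid M] {w : J → W} (hw : w.Injective) (F : Bits W → Bits J → M) :
    ∑ b : Bits W, ∑ d : Bits J, F (Function.extend w d b) (b ∘ w) =
      ∑ b : Bits W, ∑ d : Bits J, F b d := by
  rw [← Fintype.sum_prod_type', ← Fintype.sum_prod_type']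
  let f : Bits W × Bits J → Bits W × Bits J := fun p => (Function.extend w p.2 p.1, p.1 ∘ w)
  have hf : Function.Involutive f := fun p => by
    simp [f, extend_extend hw, extend_comp_self hw, extend_comp' hw]
  exact Fintype.sum_equiv hf.toPerm _ _ (fun p => rfl)

theorem sum_extend [Fintype J] [DecidableEq J] [Fintype W] [DecidableEq W]
    {w : J → W} (hw : w.Injective) (F : Bits W → ℝ) :
    ∑ b : Bits W, ∑ d : Bits J, F (Function.extend w d b) =
      (2 : ℝ) ^ Fintype.card J * ∑ b : Bits W, F b := by
  rw [sum_sum_extend hw (fun b _ => F b)]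
  simp [Finset.mul_sum, ZMod.card]

end Extend

/-! ### Oracles as collections of predicates -/

/-- Answers of an arbitrary classical oracle with the four query types of an `Oracle`. The answers
need not come from a common banknote generator, so single components can be tampered with. -/
structure World (n : ℕ) where
  /-- the answer `y · 𝒢(r)` of the generator -/
  generatorBit : Bits (Fin n) → (Fin (n / 2) → Bits (Fin n)) → Bits (Fin (3 * n)) → ZMod 2
  /-- the serial number checker -/
  Valid : Bits (Fin (3 * n)) → Prop
  /-- the primal tester -/
  Primal : Bits (Fin (3 * n)) → Bits (Fin n) → Prop
  /-- the dual tester -/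
  Dual : Bits (Fin (3 * n)) → Bits (Fin n) → Prop

/-- The answers of a genuine oracle. -/
def Oracle.world {n : ℕ} (O : Oracle n) : World n := ⟨O.generatorBit, O.Valid, O.Primal, O.Dual⟩

namespace Gate

variable {n : ℕ} {W : Type}

/-- The basis states whose sign the gate flips. -/
def Flips (w : World n) : Gate n W → Bits W → Prop
  | unitary _ _ _, _ => False
  | generator c r yg ys, b =>
      b c = 1 ∧ w.generatorBit (b ∘ r) (fun i => b ∘ yg i) (b ∘ ys) = 1
  | serialChecker c s, b => b c = 1 ∧ w.Valid (b ∘ s)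
  | primalTester c s x, b => b c = 1 ∧ w.Primal (b ∘ s) (b ∘ x)
  | dualTester c s x, b => b c = 1 ∧ w.Dual (b ∘ s) (b ∘ x)

/-- The unitary part of a gate; queries are ignored. -/
noncomputable def unitaryPart : Gate n W → State W → State W
  | unitary _ w u, ψ => fun b => ∑ c, u.1 (b ∘ w) c * ψ (Function.extend w c b)
  | _, ψ => ψ

open scoped Classical in
/-- The action of a gate when queries are answered by `w`. -/
noncomputable def act (w : World n) (g : Gate n W) (ψ : State W) : State W :=
  fun b => (if g.Flips w b then -1 else 1) * g.unitaryPart ψ b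

theorem apply_eq_act (O : Oracle n) (g : Gate n W) : g.apply O = g.act O.world := by
  funext ψ b
  cases g with
  | unitary => simp [apply, act, Flips, unitaryPart]
  | _ => simp only [apply, act, Flips, unitaryPart, Oracle.world]; congr

theorem unitaryPart_add (g : Gate n W) (ψ φ : State W) :
    g.unitaryPart (ψ + φ) = g.unitaryPart ψ + g.unitaryPart φ := by
  cases g <;> simp [unitaryPart, funext_iff, mul_add, Finset.sum_add_distrib]

theorem unitaryPart_smul (g : Gate n W) (a : ℂ) (ψ : State W) :
    g.unitaryPart (a • ψ) = a • g.unitaryPart ψ := by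
  cases g <;> simp [unitaryPart, funext_iff, Finset.mul_sum, mul_left_comm]

theorem act_add (w : World n) (g : Gate n W) (ψ φ : State W) :
    g.act w (ψ + φ) = g.act w ψ + g.act w φ := by
  funext b; simp [act, unitaryPart_add, mul_add]

theorem act_smul (w : World n) (g : Gate n W) (a : ℂ) (ψ : State W) :
    g.act w (a • ψ) = a • g.act w ψ := by
  funext b; simp [act, unitaryPart_smul, mul_left_comm]

end Gate

namespace Circuit

variable {n : ℕ} {W : Type}

/-- Run a circuit when queries are answered by `w`, as a linear map. -/
noncomputable def runIn (w : World n) (C : Circuit n W) : State W →ₗ[ℂ] State W where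
  toFun ψ := C.foldl (fun φ g => g.act w φ) ψ
  map_add' ψ φ := by
    induction C generalizing ψ φ with
    | nil => rfl
    | cons g C ih => simp only [List.foldl_cons, Gate.act_add, ih]
  map_smul' a ψ := by
    induction C generalizing ψ with
    | nil => rfl
    | cons g C ih => simp only [List.foldl_cons, Gate.act_smul, ih, RingHom.id_apply]

@[simp] theorem runIn_nil (w : World n) (ψ : State W) : runIn w [] ψ = ψ := rfl

@[simp] theorem runIn_cons (w : World n) (g : Gate n W) (C : Circuit n W) (ψ : State W) :
    runIn w (g :: C) ψ = runIn w C (g.act w ψ) := rfl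

@[simp] theorem runIn_append (w : World n) (C D : Circuit n W) (ψ : State W) :
    runIn w (C ++ D) ψ = runIn w D (runIn w C ψ) := List.foldl_append ..

theorem run_eq_runIn (O : Oracle n) (C : Circuit n W) (ψ : State W) :
    C.run O ψ = C.runIn O.world ψ := by
  simp only [run, Gate.apply_eq_act]; rfl

end Circuit

/-! ### Norms -/

section Norm

variable {n : ℕ} {W : Type} [Fintype W] [DecidableEq W]

/-- The `ℓ²` norm of a vector of amplitudes. -/
noncomputable def nrm (ψ : State W) : ℝ := ‖WithLp.toLp 2 ψ‖

theorem nrm_sq (ψ : State W) : nrm ψ ^ 2 = ∑ b, ‖ψ b‖ ^ 2 := by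
  rw [nrm, EuclideanSpace.norm_sq_eq]

theorem nrm_nonneg (ψ : State W) : 0 ≤ nrm ψ := norm_nonneg _

theorem nrm_sub_le (ψ φ χ : State W) : nrm (ψ - χ) ≤ nrm (ψ - φ) + nrm (φ - χ) :=
  norm_sub_le_norm_sub_add_norm_sub (WithLp.toLp 2 ψ) (WithLp.toLp 2 φ) (WithLp.toLp 2 χ)

theorem sum_norm_sq_mulVec {ι : Type*} [Fintype ι] [DecidableEq ι]
    (u : Matrix.unitaryGroup ι ℂ) (v : ι → ℂ) :
    ∑ d, ‖∑ c, u.1 d c * v c‖ ^ 2 = ∑ c, ‖v c‖ ^ 2 := by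
  have h2 : star (Matrix.mulVec u.1 v) ⬝ᵥ (Matrix.mulVec u.1 v) = star v ⬝ᵥ v := by
    rw [Matrix.star_mulVec, Matrix.dotProduct_mulVec, Matrix.vecMul_vecMul]
    have : u.1.conjTranspose * u.1 = 1 := by
      simpa [Matrix.star_eq_conjTranspose] using (Matrix.mem_unitaryGroup_iff'.1 u.2)
    rw [this, Matrix.vecMul_one]
  have key : ∀ x : ι → ℂ, star x ⬝ᵥ x = ((∑ c, ‖x c‖ ^ 2 : ℝ) : ℂ) := by
    intro x
    simp only [dotProduct, Pi.star_apply, Complex.ofReal_sum]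
    refine Finset.sum_congr rfl fun c _ => ?_
    rw [RCLike.star_def, ← Complex.normSq_eq_conj_mul_self, Complex.normSq_eq_norm_sq]
  rw [key, key] at h2
  exact_mod_cast h2

theorem Gate.nrm_unitaryPart (g : Gate n W) (ψ : State W) : nrm (g.unitaryPart ψ) = nrm ψ := by
  have : nrm (g.unitaryPart ψ) ^ 2 = nrm ψ ^ 2 := by
    cases g with
    | unitary k w u =>
      have hw := w.injective
      have h1 := sum_extend hw (fun b => ‖(Gate.unitary (n := n) k w u).unitaryPart ψ b‖ ^ 2)
      have h2 := sum_extend hw (fun b => ‖ψ b‖ ^ 2)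
      rw [nrm_sq, nrm_sq]
      have h3 : ∀ b : Bits W,
          ∑ d, ‖(Gate.unitary (n := n) k w u).unitaryPart ψ (Function.extend w d b)‖ ^ 2 =
            ∑ d, ‖ψ (Function.extend w d b)‖ ^ 2 := by
        intro b
        simp only [unitaryPart, extend_comp' hw, extend_extend hw]
        exact sum_norm_sq_mulVec u _
      simp only [h3] at h1
      have h4 : (2 : ℝ) ^ Fintype.card (Fin k) ≠ 0 := by positivity
      exact mul_left_cancel₀ h4 (h1.symm.trans h2)
    | _ => rfl
  exact (pow_left_inj₀ (nrm_nonneg _) (nrm_nonneg _) two_ne_zero).1 this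

theorem Gate.nrm_act (w : World n) (g : Gate n W) (ψ : State W) : nrm (g.act w ψ) = nrm ψ := by
  rw [← g.nrm_unitaryPart ψ, ← pow_left_inj₀ (nrm_nonneg _) (nrm_nonneg _) two_ne_zero,
    nrm_sq, nrm_sq]
  refine Finset.sum_congr rfl fun b _ => ?_
  unfold act
  split_ifs <;> simp

theorem Circuit.nrm_runIn (w : World n) (C : Circuit n W) (ψ : State W) :
    nrm (C.runIn w ψ) = nrm ψ := by
  induction C generalizing ψ with
  | nil => rfl
  | cons g C ih => rw [runIn_cons, ih, Gate.nrm_act]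

/-! ### The hybrid argument -/

/-- The squared amplitude that a run in the world `w` puts, summed over all gates, on basis states
on which the next gate behaves differently in the world `w'`. -/
noncomputable def Circuit.discrepancy (w w' : World n) : Circuit n W → State W → ℝ
  | [], _ => 0
  | g :: C, ψ => (open scoped Classical in
      ∑ b, if (g.Flips w b ↔ g.Flips w' b) then 0 else ‖ψ b‖ ^ 2) +
      Circuit.discrepancy w w' C (g.act w ψ)

theorem Circuit.discrepancy_nonneg (w w' : World n) (C : Circuit n W) (ψ : State W) :
    0 ≤ C.discrepancy w w' ψ := by
  induction C generalizing ψ with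
  | nil => exact le_rfl
  | cons g C ih =>
    refine add_nonneg (Finset.sum_nonneg fun b _ => ?_) (ih _)
    split_ifs <;> positivity

open scoped Classical in
theorem Gate.nrm_act_sub_act (w w' : World n) (g : Gate n W) (ψ : State W) :
    nrm (g.act w' ψ - g.act w ψ) ^ 2 =
      4 * ∑ b, if (g.Flips w b ↔ g.Flips w' b) then 0 else ‖ψ b‖ ^ 2 := by
  rw [nrm_sq, Finset.mul_sum]
  refine Finset.sum_congr rfl fun b _ => ?_
  cases g with
  | unitary k v u => simp [act, Flips]
  | _ =>
    simp only [Pi.sub_apply, act, unitaryPart]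
    rw [← sub_mul, norm_mul, mul_pow]
    split_ifs <;> (first | (exfalso; tauto) | norm_num)

open scoped Classical in
/-- The hybrid argument: errors add up over the gates. -/
theorem Circuit.nrm_runIn_sub_runIn (w w' : World n) (C : Circuit n W) (ψ : State W) :
    nrm (C.runIn w' ψ - C.runIn w ψ) ^ 2 ≤ 4 * C.length * C.discrepancy w w' ψ := by
  induction C generalizing ψ with
  | nil => simp [discrepancy, nrm_sq]
  | cons g C ih =>
    have h1 : nrm (runIn w' C (g.act w' ψ) - runIn w C (g.act w ψ)) ≤
        nrm (g.act w' ψ - g.act w ψ) + nrm (runIn w' C (g.act w ψ) - runIn w C (g.act w ψ)) := by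
      refine (nrm_sub_le _ (runIn w' C (g.act w ψ)) _).trans ?_
      rw [← map_sub, nrm_runIn]
    have h2 := g.nrm_act_sub_act w w' ψ
    have h3 := ih (g.act w ψ)
    have h5 := discrepancy_nonneg w w' C (g.act w ψ)
    simp only [runIn_cons, discrepancy, List.length_cons, Nat.cast_succ]
    set a := nrm (g.act w' ψ - g.act w ψ)
    set e := nrm (runIn w' C (g.act w ψ) - runIn w C (g.act w ψ))
    set d := discrepancy w w' C (g.act w ψ)
    set s : ℝ := ∑ b : Bits W, if (g.Flips w b ↔ g.Flips w' b) then 0 else ‖ψ b‖ ^ 2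
    have h4 := nrm_nonneg (runIn w' C (g.act w' ψ) - runIn w C (g.act w ψ))
    have hs : 0 ≤ s := by nlinarith [sq_nonneg a]
    have ha : 0 ≤ a := nrm_nonneg _
    have he : 0 ≤ e := nrm_nonneg _
    have hL : (0 : ℝ) ≤ (C.length : ℝ) := Nat.cast_nonneg _
    set L : ℝ := (C.length : ℝ)
    -- Cauchy–Schwarz in the form `(√s + √(L d))² ≤ (1 + L) (s + d)`
    have hae : 2 * (a * e) ≤ 4 * (L * s + d) := by
      refine abs_le_of_sq_le_sq' ?_ (by positivity) |>.2
      have : (a * e) ^ 2 ≤ 4 * s * (4 * L * d) := by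
        rw [mul_pow, h2]
        exact mul_le_mul_of_nonneg_left h3 (by positivity)
      nlinarith [sq_nonneg (L * s - d)]
    calc _ ≤ (a + e) ^ 2 := pow_le_pow_left₀ h4 h1 2
      _ ≤ _ := by nlinarith

/-- If every basis state is treated differently by at most one of the worlds `w' i`, then running a
circuit in the world `w` instead of a random `w' i` goes mostly unnoticed. -/
theorem Circuit.sum_nrm_runIn_sub_runIn {ι : Type*} [Fintype ι] (w : World n) (w' : ι → World n)
    (h : ∀ (g : Gate n W) b i j, ¬ (g.Flips w b ↔ g.Flips (w' i) b) →
      ¬ (g.Flips w b ↔ g.Flips (w' j) b) → i = j) (C : Circuit n W) (ψ : State W) :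
    ∑ i, nrm (C.runIn (w' i) ψ - C.runIn w ψ) ^ 2 ≤ 4 * (C.length : ℝ) ^ 2 * nrm ψ ^ 2 := by
  classical
  have key : ∑ i, C.discrepancy w (w' i) ψ ≤ C.length * nrm ψ ^ 2 := by
    induction C generalizing ψ with
    | nil => simp [discrepancy]
    | cons g C ih =>
      simp only [discrepancy, Finset.sum_add_distrib, List.length_cons, Nat.cast_succ]
      have h1 := ih (g.act w ψ)
      rw [Gate.nrm_act] at h1
      have h2 : ∑ i, ∑ b, (if (g.Flips w b ↔ g.Flips (w' i) b) then 0 else ‖ψ b‖ ^ 2) ≤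
          nrm ψ ^ 2 := by
        rw [Finset.sum_comm, nrm_sq]
        refine Finset.sum_le_sum fun b _ => ?_
        by_cases hb : ∃ i, ¬ (g.Flips w b ↔ g.Flips (w' i) b)
        · obtain ⟨i, hi⟩ := hb
          rw [Finset.sum_eq_single i]
          · simp [hi]
          · intro j _ hj
            rw [if_pos]
            by_contra hj'
            exact hj (h g b j i hj' hi)
          · simp
        · push Not at hb
          rw [Finset.sum_eq_zero fun i _ => if_pos (hb i)]
          positivity
      linarith
  calc _ ≤ ∑ i, 4 * C.length * C.discrepancy w (w' i) ψ :=
        Finset.sum_le_sum fun i _ => nrm_runIn_sub_runIn _ _ _ _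
    _ ≤ _ := by
        rw [← Finset.mul_sum]
        nlinarith [mul_le_mul_of_nonneg_left key (by positivity : (0 : ℝ) ≤ 4 * C.length)]

end Norm

/-! ### Circuits on a part of the qubits -/

section Map

variable {n : ℕ} {W W' : Type}

theorem extend_extend_comp {J : Type} {w : J → W} {e : W → W'} (hw : w.Injective)
    (he : e.Injective) (c : Bits J) (b : Bits W') :
    Function.extend e (Function.extend w c (b ∘ e)) b = Function.extend (e ∘ w) c b := by
  funext x
  by_cases h : ∃ a, e a = x
  · obtain ⟨a, rfl⟩ := h
    rw [he.extend_apply]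
    by_cases h' : ∃ j, w j = a
    · obtain ⟨j, rfl⟩ := h'
      rw [hw.extend_apply]
      exact ((he.comp hw).extend_apply c b j).symm
    · rw [Function.extend_apply' _ _ _ h', Function.extend_apply']
      · rfl
      · rintro ⟨j, hj⟩
        exact h' ⟨j, he hj⟩
  · rw [Function.extend_apply' _ _ _ h, Function.extend_apply']
    rintro ⟨j, hj⟩
    exact h ⟨w j, hj⟩

theorem Gate.act_unitary (wd : World n) (k : ℕ) (w : Fin k ↪ W)
    (u : Matrix.unitaryGroup (Bits (Fin k)) ℂ) (ψ : State W) (b : Bits W) :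
    (Gate.unitary k w u).act wd ψ b = ∑ c, u.1 (b ∘ w) c * ψ (Function.extend w c b) := by
  simp [act, Flips, unitaryPart]

theorem Gate.act_map (w : World n) (e : W ↪ W') (g : Gate n W) (ψ : State W') (b : Bits W') :
    (g.map e).act w ψ b = g.act w (fun a => ψ (Function.extend e a b)) (b ∘ e) := by
  cases g with
  | unitary k v u =>
    rw [map, act_unitary, act_unitary]
    refine Finset.sum_congr rfl fun c _ => ?_
    rw [extend_extend_comp v.injective e.injective]
    rfl
  | _ =>
    simp only [map, act, Flips, unitaryPart, extend_comp_self e.injective]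
    rfl

/-- A circuit that acts on the qubits `e` only acts on each slice with the other qubits fixed. -/
theorem Circuit.runIn_map (w : World n) (e : W ↪ W') (C : Circuit n W) (ψ : State W')
    (b : Bits W') :
    Circuit.runIn w (C.map (Gate.map e)) ψ b =
      C.runIn w (fun a => ψ (Function.extend e a b)) (b ∘ e) := by
  induction C generalizing ψ with
  | nil => simp [extend_comp_self e.injective]
  | cons g C ih =>
    simp only [List.map_cons, runIn_cons, ih]
    refine congrArg (fun φ => runIn w C φ (b ∘ e)) (funext fun a => ?_)
    rw [Gate.act_map, extend_comp' e.injective]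
    simp only [extend_extend e.injective]

end Map

/-! ### Hadamard gates -/

/-- The sign `(-1)^c` of a bit. -/
noncomputable def sgn (c : ZMod 2) : ℂ := if c = 1 then -1 else 1

@[simp] theorem sgn_zero : sgn 0 = 1 := by simp [sgn]

@[simp] theorem sgn_one : sgn 1 = -1 := by simp [sgn]

theorem bit_cases (a : ZMod 2) : a = 0 ∨ a = 1 := by revert a; decide

theorem bit_one_add_one : (1 + 1 : ZMod 2) = 0 := by decide

theorem sgn_add (a b : ZMod 2) : sgn (a + b) = sgn a * sgn b := by
  rcases bit_cases a with rfl | rfl <;> rcases bit_cases b with rfl | rfl <;>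
    simp [bit_one_add_one]

theorem sum_bit {M : Type*} [AddCommMonoid M] (f : ZMod 2 → M) : ∑ c, f c = f 0 + f 1 :=
  Fin.sum_univ_two f

theorem inv_sqrt_two_mul_self : ((√2 : ℝ) : ℂ)⁻¹ * ((√2 : ℝ) : ℂ)⁻¹ = 1 / 2 := by
  rw [← mul_inv, ← Complex.ofReal_mul, Real.mul_self_sqrt (by norm_num)]
  norm_num

section Hadamard

variable {n : ℕ} {W : Type} [DecidableEq W]

theorem extend_const_eq_update (i : W) (c : Bits (Fin 1)) (b : Bits W) :
    Function.extend (fun _ : Fin 1 => i) c b = Function.update b i (c 0) := by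
  have hi : Function.Injective (fun _ : Fin 1 => i) := fun _ _ _ => Subsingleton.elim _ _
  funext x
  by_cases h : x = i
  · subst h
    simpa using hi.extend_apply c b 0
  · rw [Function.update_of_ne h, Function.extend_apply']
    rintro ⟨_, h'⟩
    exact h h'.symm

theorem act_hadamard (w : World n) (i : W) (ψ : State W) (b : Bits W) :
    (hadamard i : Gate n W).act w ψ b =
      ((√2 : ℝ) : ℂ)⁻¹ * ∑ c, sgn (b i * c) * ψ (Function.update b i c) := by
  have hw : ∀ c, Function.extend (fun _ : Fin 1 => i) c b = Function.update b i (c 0) :=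
    fun c => extend_const_eq_update i c b
  rw [hadamard, Gate.act_unitary, Finset.mul_sum]
  change ∑ c, hadamardMatrix (fun _ => b i) c *
    ψ (Function.extend (fun _ : Fin 1 => i) c b) = _
  rw [← (Equiv.funUnique (Fin 1) (ZMod 2)).sum_comp]
  refine Finset.sum_congr rfl fun c _ => ?_
  simp only [hw, Equiv.funUnique_apply, Fin.default_eq_zero, ← mul_assoc]
  congr 1
  simp only [hadamardMatrix, Matrix.of_apply, sgn]
  rcases bit_cases (b i) with h | h <;> rcases bit_cases (c 0) with h' | h' <;> simp [h, h']

/-- A query controlled by a qubit in the state `|+⟩`, measured in the basis `|+⟩, |-⟩`, flips the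
control if the queried predicate holds. -/
theorem runIn_hadamard_query_hadamard (w : World n) (c : W) (q : Gate n W) (p : Bits W → Prop)
    (hq : ∀ ψ, q.unitaryPart ψ = ψ) (hf : ∀ b, q.Flips w b ↔ b c = 1 ∧ p b)
    (hp : ∀ b v, p (Function.update b c v) ↔ p b) (ψ : State W) (b : Bits W) :
    Circuit.runIn w [hadamard c, q, hadamard c] ψ b =
      (open scoped Classical in
        if p b then ψ (Function.update b c (b c + 1)) else ψ b) := by
  classical
  have hb : ψ b = ψ (Function.update b c (b c)) := by rw [Function.update_eq_self]
  have h2 := inv_sqrt_two_mul_self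
  have hact : ∀ φ b, q.act w φ b = (if b c = 1 ∧ p b then -1 else 1) * φ b := fun φ b => by
    rw [Gate.act, hq]
    simp only [hf]
  simp only [Circuit.runIn_cons, Circuit.runIn_nil, act_hadamard, hact, hp,
    Function.update_self, Function.update_idem, sum_bit]
  rcases bit_cases (b c) with h | h <;> rw [hb, h] <;> by_cases h' : p b
  · simp [h']
    linear_combination (2 * ψ (Function.update b c 1)) * h2
  · simp [h']
    linear_combination (2 * ψ (Function.update b c 0)) * h2
  · simp [h', bit_one_add_one]
    linear_combination (2 * ψ (Function.update b c 0)) * h2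
  · simp [h']
    linear_combination (2 * ψ (Function.update b c 1)) * h2

omit [DecidableEq W] in
theorem sum_update {J : Type} [Fintype J] [DecidableEq J] (i : J) (F : Bits J → ℂ) :
    ∑ y, ∑ c, F (Function.update y i c) = 2 * ∑ y, F y := by
  have h := sum_sum_extend (J := Fin 1) (w := fun _ : Fin 1 => i)
    (fun _ _ _ => Subsingleton.elim _ _) (fun b _ => F b)
  simp only [extend_const_eq_update] at h
  have h1 : ∀ y, ∑ c, F (Function.update y i c) =
      ∑ d : Bits (Fin 1), F (Function.update y i (d 0)) := fun y =>
    ((Equiv.funUnique (Fin 1) (ZMod 2)).sum_comp fun c => F (Function.update y i c)).symm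
  simp only [h1, h]
  simp [Finset.mul_sum, ZMod.card]

/-- The Hadamard transform of the qubits in a list. The sum runs over all bits, so every term is
repeated for the bits outside the list. -/
theorem runIn_hadamard_list {J : Type} [Fintype J] [DecidableEq J] (w : World n) (l : List J)
    (hl : l.Nodup) (ψ : State J) (b : Bits J) :
    Circuit.runIn w (l.map (hadamard (n := n))) ψ b =
      (((√2 : ℝ) : ℂ)⁻¹) ^ l.length * (2 ^ l.length / 2 ^ Fintype.card J) *
        ∑ y : Bits J, sgn (l.map fun j => b j * y j).sum *
          ψ (fun j => if j ∈ l then y j else b j) := by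
  induction l generalizing ψ with
  | nil => simp [ZMod.card]
  | cons i l ih =>
    obtain ⟨hi, hl⟩ := List.nodup_cons.1 hl
    rw [List.map_cons, Circuit.runIn_cons, ih hl]
    simp only [act_hadamard, if_neg hi]
    have h := sum_update i fun y => sgn ((i :: l).map fun j => b j * y j).sum *
          ψ (fun j => if j ∈ i :: l then y j else b j)
    have h1 : ∀ y : Bits J, ∀ c, (l.map fun j => b j * Function.update y i c j) =
        l.map fun j => b j * y j := fun y c => by
      refine List.map_congr_left fun j hj => ?_
      rw [Function.update_of_ne (by rintro rfl; exact hi hj)]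
    have h2 : ∀ y : Bits J, ∀ c,
        (fun j => if j ∈ i :: l then Function.update y i c j else b j) =
          Function.update (fun j => if j ∈ l then y j else b j) i c := fun y c => by
      funext j
      by_cases hj : j = i
      · subst hj; simp
      · simp [hj]
    simp only [h2, List.map_cons, List.sum_cons, h1, Function.update_self, sgn_add] at h
    have h4 : ∑ y : Bits J, sgn (l.map fun j => b j * y j).sum * (((√2 : ℝ) : ℂ)⁻¹ *
        ∑ c, sgn (b i * c) * ψ (Function.update (fun j => if j ∈ l then y j else b j) i c)) =
        ((√2 : ℝ) : ℂ)⁻¹ * ∑ y : Bits J, ∑ c, sgn (b i * c) *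
          sgn (l.map fun j => b j * y j).sum *
          ψ (Function.update (fun j => if j ∈ l then y j else b j) i c) := by
      simp only [Finset.mul_sum]
      refine Finset.sum_congr rfl fun y _ => Finset.sum_congr rfl fun c _ => by ring
    rw [h4, h]
    simp only [List.map_cons, List.sum_cons, sgn_add, List.length_cons]
    ring

omit [DecidableEq W] in
/-- The Hadamard transform of the qubits `e`. -/
theorem runIn_map_hadamard {J : Type} [Fintype J] [DecidableEq J] (w : World n) (e : J ↪ W)
    (l : List J) (hl : l.Nodup) (hl' : ∀ j, j ∈ l) (ψ : State W) (b : Bits W) :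
    Circuit.runIn w (l.map fun j => (hadamard (e j) : Gate n W)) ψ b =
      (((√2 : ℝ) : ℂ)⁻¹) ^ Fintype.card J *
        ∑ y : Bits J, sgn ((b ∘ e) ⬝ᵥ y) * ψ (Function.extend e y b) := by
  have h : (l.map fun j => (hadamard (e j) : Gate n W)) =
      (l.map (hadamard (n := n))).map (Gate.map e) := by
    rw [List.map_map]
    rfl
  have hlen : l.length = Fintype.card J := by
    rw [← Finset.card_univ, ← List.toFinset_card_of_nodup hl]
    congr
    ext j
    simp [hl']
  have hsum : ∀ y : Bits J, (l.map fun j => (b ∘ e) j * y j).sum = (b ∘ e) ⬝ᵥ y := fun y => by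
    rw [← List.sum_toFinset _ hl, dotProduct]
    congr
    ext j
    simp [hl']
  rw [h, Circuit.runIn_map, runIn_hadamard_list _ _ hl]
  simp only [hl', if_true, hlen, hsum]
  rw [div_self (pow_ne_zero _ two_ne_zero), mul_one]

end Hadamard

/-! ### Character sums -/

section Characters

variable {n : ℕ} {J : Type} [Fintype J] [DecidableEq J]

open scoped Classical in
/-- The sum of a character over a subspace vanishes unless the character is trivial on it. -/
theorem sum_sgn_submodule (A : Submodule (ZMod 2) (Bits J)) (z : Bits J) :
    ∑ a, (if a ∈ A then sgn (a ⬝ᵥ z) else 0) =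
      if ∀ a ∈ A, a ⬝ᵥ z = 0 then (Nat.card A : ℂ) else 0 := by
  split_ifs with h
  · have : ∀ a, (if a ∈ A then sgn (a ⬝ᵥ z) else 0) = if a ∈ A then 1 else 0 := fun a => by
      split_ifs with ha
      · simp [h a ha]
      · rfl
    simp only [this, Finset.sum_boole]
    rw [← Fintype.card_subtype, Nat.card_eq_fintype_card]
  · push Not at h
    obtain ⟨a₀, ha₀, h1⟩ := h
    have h2 : a₀ ⬝ᵥ z = 1 := (bit_cases _).resolve_left h1
    have h3 := Equiv.sum_comp (Equiv.addRight a₀) fun a => if a ∈ A then sgn (a ⬝ᵥ z) else 0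
    simp only [Equiv.coe_addRight, add_dotProduct, sgn_add, h2, sgn_one,
      A.add_mem_iff_left ha₀] at h3
    have h4 : ∑ a, (if a ∈ A then sgn (a ⬝ᵥ z) * -1 else 0) =
        - ∑ a, (if a ∈ A then sgn (a ⬝ᵥ z) else 0) := by
      rw [← Finset.sum_neg_distrib]
      refine Finset.sum_congr rfl fun a _ => ?_
      split_ifs <;> simp
    rw [h4] at h3
    linear_combination (-1 / 2) * h3

theorem sum_sgn (z : Bits J) :
    ∑ a : Bits J, sgn (a ⬝ᵥ z) = if z = 0 then (2 : ℂ) ^ Fintype.card J else 0 := by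
  have h := sum_sgn_submodule ⊤ z
  simp only [Submodule.mem_top, if_true, true_implies] at h
  rw [h]
  have h1 : (∀ a : Bits J, a ⬝ᵥ z = 0) ↔ z = 0 :=
    ⟨fun h => by funext i; simpa using h (Pi.single i 1), by rintro rfl; simp⟩
  simp only [h1]
  congr 1
  rw [Nat.card_eq_fintype_card]
  simp [ZMod.card]

open scoped Classical in
/-- The Fourier transform of the indicator function of `A^⊥` is that of `A`, up to a factor. -/
theorem sum_sgn_dual (A : Submodule (ZMod 2) (Bits (Fin n))) (v : Bits (Fin n)) :
    ∑ z, (if ∀ a ∈ A, a ⬝ᵥ z = 0 then sgn (v ⬝ᵥ z) else 0) =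
      if v ∈ A then (2 : ℂ) ^ n / Nat.card A else 0 := by
  have hA : (Nat.card A : ℂ) ≠ 0 := by exact_mod_cast Nat.card_pos.ne'
  have h1 : ∀ z, (if ∀ a ∈ A, a ⬝ᵥ z = 0 then sgn (v ⬝ᵥ z) else 0) =
      (Nat.card A : ℂ)⁻¹ * ∑ a, if a ∈ A then sgn (z ⬝ᵥ (a + v)) else 0 := fun z => by
    have : ∀ a, (if a ∈ A then sgn (z ⬝ᵥ (a + v)) else 0) =
        sgn (v ⬝ᵥ z) * (if a ∈ A then sgn (a ⬝ᵥ z) else 0) := fun a => by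
      split_ifs
      · rw [dotProduct_add, sgn_add, dotProduct_comm z a, dotProduct_comm z v, mul_comm]
      · simp
    simp only [this]
    rw [← Finset.mul_sum, sum_sgn_submodule]
    split_ifs
    · field_simp
    · simp
  have h2 : ∀ a : Bits (Fin n), a + v = 0 ↔ a = v := fun a => by
    rw [add_eq_zero_iff_eq_neg, show -v = v from funext fun i => CharTwo.neg_eq (v i)]
  simp only [h1, ← Finset.mul_sum]
  rw [Finset.sum_comm]
  have h3 : ∀ a, ∑ z, (if a ∈ A then sgn (z ⬝ᵥ (a + v)) else 0) =
      if a = v then (if v ∈ A then (2 : ℂ) ^ n else 0) else 0 := fun a => by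
    have h4 := sum_sgn (a + v)
    simp only [h2, Fintype.card_fin] at h4
    by_cases hav : a = v
    · subst hav
      by_cases ha : a ∈ A
      · simp only [ha, if_true, h4]
      · simp [ha]
    · by_cases ha : a ∈ A
      · simp only [ha, if_true, h4, hav, if_false]
      · simp [ha, hav]
  simp only [h3, Finset.sum_ite_eq', Finset.mem_univ, if_true]
  split_ifs
  · field_simp
  · simp

end Characters

/-! ### The verifier -/

section Verifier

variable {n : ℕ}

/-- The positions of the money state among the qubits of the verifier. -/
def moneyWires (n : ℕ) : Fin n ↪ Note n ⊕ Fin 3 :=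
  ⟨fun j => .inl (.inr j), fun _ _ h => by simpa using h⟩

/-- The bits of a verification: serial number, money state, and work qubits. -/
def noteBits (s : Bits (Fin (3 * n))) (x : Bits (Fin n)) (a : Bits (Fin 3)) :
    Bits (Note n ⊕ Fin 3) := Sum.elim (Sum.elim s x) a

theorem extend_moneyWires (s : Bits (Fin (3 * n))) (x y : Bits (Fin n)) (a : Bits (Fin 3)) :
    Function.extend (moneyWires n) y (noteBits s x a) = noteBits s y a := by
  funext i
  rcases i with (i | i) | i
  · rw [Function.extend_apply' _ _ _ (by rintro ⟨j, hj⟩; cases hj)]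
    rfl
  · exact (moneyWires n).injective.extend_apply y _ i
  · rw [Function.extend_apply' _ _ _ (by rintro ⟨j, hj⟩; cases hj)]
    rfl

theorem update_noteBits (s : Bits (Fin (3 * n))) (x : Bits (Fin n)) (a : Bits (Fin 3)) (i : Fin 3)
    (v : ZMod 2) :
    Function.update (noteBits s x a) (.inr i) v = noteBits s x (Function.update a i v) := by
  funext j
  rcases j with (j | j) | j
  · rfl
  · rfl
  · by_cases h : j = i
    · subst h; simp [noteBits]
    · simp [noteBits, h]

open scoped Classical in
/-- The amplitudes of the verifier for the three outcomes `1`: a projection onto the strings that pass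
the primal test, followed by one onto the strings that pass the dual test, between Hadamard
transforms. -/
theorem runIn_verCircuit (w : World n) (χ : State (Note n ⊕ Fin 3))
    (hχ : ∀ s x a, a ≠ 0 → χ (noteBits s x a) = 0) (s : Bits (Fin (3 * n))) (x : Bits (Fin n)) :
    (verCircuit n).runIn w χ (noteBits s x 1) =
      ∑ z : Bits (Fin n), ∑ y : Bits (Fin n), (1 / 2) ^ n * (sgn (x ⬝ᵥ z) * sgn (z ⬝ᵥ y)) *
        if w.Valid s ∧ w.Primal s y ∧ w.Dual s z then χ (noteBits s y 0) else 0 := by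
  have had : ∀ (ψ : State (Note n ⊕ Fin 3)) s x a,
      Circuit.runIn w ((List.finRange n).map fun j => hadamard (.inl (.inr j))) ψ (noteBits s x a) =
        (((√2 : ℝ) : ℂ)⁻¹) ^ n * ∑ y : Bits (Fin n), sgn (x ⬝ᵥ y) * ψ (noteBits s y a) := by
    intro ψ s x a
    have h := runIn_map_hadamard w (moneyWires n) (List.finRange n) (List.nodup_finRange n)
      List.mem_finRange ψ (noteBits s x a)
    simp only [extend_moneyWires, Fintype.card_fin] at h
    exact h
  have h0 : ∀ ψ s x a, Circuit.runIn w [hadamard (.inr 0), .serialChecker (.inr 0)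
      (fun l => .inl (.inl l)), hadamard (.inr 0)] ψ (noteBits s x a) =
        if w.Valid s then ψ (noteBits s x (Function.update a 0 (a 0 + 1)))
        else ψ (noteBits s x a) := by
    intro ψ s x a
    rw [runIn_hadamard_query_hadamard w (.inr 0) _
      (fun b : Bits (Note n ⊕ Fin 3) => w.Valid fun l => b (.inl (.inl l)))
      (fun _ => rfl) (fun _ => Iff.rfl) (fun b v => Iff.rfl), update_noteBits]
    rfl
  have h1 : ∀ ψ s x a, Circuit.runIn w [hadamard (.inr 1), .primalTester (.inr 1)
      (fun l => .inl (.inl l)) (fun j => .inl (.inr j)), hadamard (.inr 1)] ψ (noteBits s x a) =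
        if w.Primal s x then ψ (noteBits s x (Function.update a 1 (a 1 + 1)))
        else ψ (noteBits s x a) := by
    intro ψ s x a
    rw [runIn_hadamard_query_hadamard w (.inr 1) _
      (fun b : Bits (Note n ⊕ Fin 3) =>
        w.Primal (fun l => b (.inl (.inl l))) fun j => b (.inl (.inr j)))
      (fun _ => rfl) (fun _ => Iff.rfl) (fun b v => Iff.rfl), update_noteBits]
    rfl
  have h2 : ∀ ψ s x a, Circuit.runIn w [hadamard (.inr 2), .dualTester (.inr 2)
      (fun l => .inl (.inl l)) (fun j => .inl (.inr j)), hadamard (.inr 2)] ψ (noteBits s x a) =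
        if w.Dual s x then ψ (noteBits s x (Function.update a 2 (a 2 + 1)))
        else ψ (noteBits s x a) := by
    intro ψ s x a
    rw [runIn_hadamard_query_hadamard w (.inr 2) _
      (fun b : Bits (Note n ⊕ Fin 3) =>
        w.Dual (fun l => b (.inl (.inl l))) fun j => b (.inl (.inr j)))
      (fun _ => rfl) (fun _ => Iff.rfl) (fun b v => Iff.rfl), update_noteBits]
    rfl
  have hpow : (((√2 : ℝ) : ℂ)⁻¹) ^ n * (((√2 : ℝ) : ℂ)⁻¹) ^ n = (1 / 2) ^ n := by
    rw [← mul_pow, inv_sqrt_two_mul_self]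
  simp only [verCircuit, Circuit.runIn_append, had, h0, h1, h2, Finset.mul_sum, ← hpow]
  refine Finset.sum_congr rfl fun z _ => ?_
  have hz : ∀ y (a : Bits (Fin 3)), a = 0 → χ (noteBits s y a) = χ (noteBits s y 0) :=
    fun y a ha => by rw [ha]
  by_cases hd : w.Dual s z
  · simp only [hd, if_true, and_true, Finset.mul_sum]
    refine Finset.sum_congr rfl fun y _ => ?_
    by_cases hp : w.Primal s y <;> by_cases hv : w.Valid s <;>
      simp only [hp, hv, if_true, if_false, and_true, and_false]
    · rw [hz]
      · ring
      · decide
    all_goals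
      rw [hχ]
      · simp
      · decide
  · simp only [hd, if_false, and_false, Finset.mul_sum]
    refine Finset.sum_congr rfl fun y _ => ?_
    by_cases hp : w.Primal s y <;> by_cases hv : w.Valid s <;>
      simp only [hp, hv, if_true, if_false]
    all_goals
      rw [hχ]
      · simp
      · decide

theorem Oracle.primal_serial (O : Oracle n) (r : Bits (Fin n)) (x : Bits (Fin n)) :
    O.Primal (O.serial r) x ↔ x ∈ O.subspace r :=
  ⟨fun ⟨_, h, hx⟩ => O.2.2 h ▸ hx, fun h => ⟨r, rfl, h⟩⟩

theorem Oracle.dual_serial (O : Oracle n) (r : Bits (Fin n)) (x : Bits (Fin n)) :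
    O.Dual (O.serial r) x ↔ ∀ a ∈ O.subspace r, a ⬝ᵥ x = 0 :=
  ⟨fun ⟨_, h, hx⟩ => O.2.2 h ▸ hx, fun h => ⟨r, rfl, h⟩⟩

open scoped Classical in
/-- On a valid serial number the verifier projects onto `|A_r⟩`: its amplitudes for the three
outcomes `1` are those of `|A_r⟩⟨A_r|`. -/
theorem runIn_verCircuit_serial (O : Oracle n) (r : Bits (Fin n)) (χ : State (Note n ⊕ Fin 3))
    (hχ : ∀ s x a, a ≠ 0 → χ (noteBits s x a) = 0) (x : Bits (Fin n)) :
    (verCircuit n).runIn O.world χ (noteBits (O.serial r) x 1) =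
      if x ∈ O.subspace r then (Nat.card (O.subspace r) : ℂ)⁻¹ *
        ∑ y, (if y ∈ O.subspace r then χ (noteBits (O.serial r) y 0) else 0) else 0 := by
  have hv : O.Valid (O.serial r) := ⟨r, rfl⟩
  rw [runIn_verCircuit _ _ hχ]
  simp only [Oracle.world, hv, O.primal_serial, O.dual_serial, true_and]
  rw [Finset.sum_comm]
  have h1 : ∀ y, ∑ z, (1 / 2) ^ n * (sgn (x ⬝ᵥ z) * sgn (z ⬝ᵥ y)) *
      (if y ∈ O.subspace r ∧ ∀ a ∈ O.subspace r, a ⬝ᵥ z = 0 then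
        χ (noteBits (O.serial r) y 0) else 0) =
      ((1 / 2) ^ n * if y ∈ O.subspace r then χ (noteBits (O.serial r) y 0) else 0) *
      ∑ z, if ∀ a ∈ O.subspace r, a ⬝ᵥ z = 0 then sgn ((x + y) ⬝ᵥ z) else 0 := fun y => by
    rw [Finset.mul_sum]
    refine Finset.sum_congr rfl fun z _ => ?_
    rw [add_dotProduct, sgn_add, dotProduct_comm z y]
    split_ifs <;> first | (exfalso; tauto) | ring
  simp only [h1, sum_sgn_dual]
  have h2 : ((1 / 2 : ℂ)) ^ n * 2 ^ n = 1 := by rw [← mul_pow]; norm_num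
  by_cases hx : x ∈ O.subspace r
  · rw [if_pos hx, Finset.mul_sum]
    refine Finset.sum_congr rfl fun y _ => ?_
    by_cases hy : y ∈ O.subspace r
    · rw [if_pos hy, if_pos (add_mem hx hy)]
      linear_combination (χ (noteBits (O.serial r) y 0) / Nat.card (O.subspace r)) * h2
    · simp [hy]
  · rw [if_neg hx]
    refine Finset.sum_eq_zero fun y _ => ?_
    by_cases hy : y ∈ O.subspace r
    · have hxy : x + y ∉ O.subspace r := by rwa [(O.subspace r).add_mem_iff_left hy]
      simp [hxy]
    · simp [hy]

/-- The verifier leaves the serial number alone. -/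
theorem runIn_verCircuit_eq_zero (w : World n) (χ : State (Note n ⊕ Fin 3))
    (s : Bits (Fin (3 * n))) (hχ : ∀ t x a, t = s ∨ a ≠ 0 → χ (noteBits t x a) = 0)
    (x : Bits (Fin n)) : (verCircuit n).runIn w χ (noteBits s x 1) = 0 := by
  rw [runIn_verCircuit _ _ fun t x a ha => hχ t x a (.inr ha)]
  simp [hχ s _ 0 (.inl rfl)]

/-! ### Completeness and size of the verifier -/

theorem isElementary_hadamard {W : Type} (i : W) : (hadamard i : Gate n W).IsElementary := by
  refine ⟨by norm_num, fun x y => ?_⟩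
  simp only [hadamardMatrix, Matrix.of_apply]
  split_ifs <;> simp

theorem verifierPolynomialSize : VerifierPolynomialSize := by
  refine ⟨2 * Polynomial.X + 9, fun n => ⟨?_, ?_⟩⟩
  · simp [verCircuit]
    omega
  · intro g hg
    simp only [verCircuit, List.mem_append, List.mem_cons, List.mem_map, List.not_mem_nil,
      or_false] at hg
    rcases hg with (((((h | h | h) | (h | h | h)) | h) | (h | h | h)) | h)
    all_goals first
      | (subst h; first | exact isElementary_hadamard _ | trivial)
      | (obtain ⟨j, _, rfl⟩ := h; exact isElementary_hadamard _)

open scoped Classical in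
theorem sum_normSq_subspaceState (A : Submodule (ZMod 2) (Bits (Fin n))) :
    ∑ x, ‖subspaceState A x‖ ^ 2 = 1 := by
  have hA : (0 : ℝ) < Nat.card A := by exact_mod_cast Nat.card_pos
  have h : ∀ x, ‖subspaceState A x‖ ^ 2 = if x ∈ A then (Nat.card A : ℝ)⁻¹ else 0 := fun x => by
    unfold subspaceState
    split_ifs
    · rw [norm_inv, Complex.norm_real, Real.norm_of_nonneg (Real.sqrt_nonneg _), inv_pow,
        Real.sq_sqrt hA.le]
    · simp
  simp only [h]
  rw [← Finset.sum_filter, Finset.sum_const, ← Fintype.card_subtype]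
  have : Fintype.card {x // x ∈ A} = Nat.card A := (Nat.card_eq_fintype_card).symm
  rw [this, nsmul_eq_mul, mul_inv_cancel₀ hA.ne']

open scoped Classical in
theorem card_inv_mul_sum_subspaceState (A : Submodule (ZMod 2) (Bits (Fin n))) :
    (Nat.card A : ℂ)⁻¹ * ∑ y, (if y ∈ A then subspaceState A y else 0) =
      ((√(Nat.card A : ℝ) : ℝ) : ℂ)⁻¹ := by
  have hA : (Nat.card A : ℂ) ≠ 0 := by exact_mod_cast Nat.card_pos.ne'
  have h : ∀ y, (if y ∈ A then subspaceState A y else 0) =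
      if y ∈ A then ((√(Nat.card A : ℝ) : ℝ) : ℂ)⁻¹ else 0 := fun y => by
    unfold subspaceState
    split_ifs <;> rfl
  simp only [h]
  rw [← Finset.sum_filter, Finset.sum_const, ← Fintype.card_subtype]
  have : Fintype.card {x // x ∈ A} = Nat.card A := (Nat.card_eq_fintype_card).symm
  rw [this, nsmul_eq_mul, ← mul_assoc, inv_mul_cancel₀ hA, one_mul]

/-- The bits of a verification, in components. -/
def noteBitsEquiv (n : ℕ) :
    Bits (Note n ⊕ Fin 3) ≃ (Bits (Fin (3 * n)) × Bits (Fin n)) × Bits (Fin 3) :=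
  (Equiv.sumArrowEquivProdArrow _ _ _).trans
    ((Equiv.sumArrowEquivProdArrow _ _ _).prodCongr (Equiv.refl _))

theorem perfectCompleteness : PerfectCompleteness := by
  classical
  intro n O r
  set A := O.subspace r with hAdef
  have hχ : ∀ s x a, a ≠ 0 → withZeros (Z := Fin 3) (banknote O r) (noteBits s x a) = 0 := by
    intro s x a ha
    exact if_neg ha
  have hχ0 : ∀ s x, withZeros (Z := Fin 3) (banknote O r) (noteBits s x 0) =
      if s = O.serial r then subspaceState A x else 0 := by
    intro s x
    rw [withZeros, if_pos (by rfl)]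
    rfl
  have hrun : ∀ s x, (verCircuit n).run O (withZeros (banknote O r)) (noteBits s x 1) =
      if s = O.serial r then subspaceState A x else 0 := by
    intro s x
    rw [Circuit.run_eq_runIn]
    split_ifs with hs
    · subst hs
      rw [runIn_verCircuit_serial O r _ hχ]
      simp only [hχ0, if_true]
      rw [card_inv_mul_sum_subspaceState]
      rfl
    · refine runIn_verCircuit_eq_zero _ _ _ (fun t x a h => ?_) x
      rcases h with rfl | h
      · by_cases ha : a = 0
        · rw [ha, hχ0, if_neg hs]
        · exact hχ _ _ _ ha
      · exact hχ _ _ _ h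
  rw [verProb, ← (noteBitsEquiv n).symm.sum_comp, Fintype.sum_prod_type, Fintype.sum_prod_type]
  have h1 : ∀ s x, ∑ a, (if ∀ i, (noteBitsEquiv n).symm ((s, x), a) (.inr i) = 1 then
      ‖(verCircuit n).run O (withZeros (banknote O r)) ((noteBitsEquiv n).symm ((s, x), a))‖ ^ 2
      else 0) = if s = O.serial r then ‖subspaceState A x‖ ^ 2 else 0 := by
    intro s x
    have h2 : ∀ a, (noteBitsEquiv n).symm ((s, x), a) = noteBits s x a := fun a => rfl
    have h3 : ∀ a : Bits (Fin 3), (∀ i, noteBits s x a (.inr i) = 1) ↔ a = 1 := fun a =>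
      ⟨fun h => funext h, by rintro rfl i; rfl⟩
    simp only [h2, h3, Finset.sum_ite_eq', Finset.mem_univ, if_true, hrun]
    split_ifs <;> simp
  simp only [h1]
  rw [Finset.sum_comm]
  simp only [Finset.sum_ite_eq', Finset.mem_univ, if_true]
  exact sum_normSq_subspaceState A

end Verifier

/-! ### The success probability as an overlap -/

section Overlap

variable {J W : Type} [Fintype J] [DecidableEq J] [Fintype W] [DecidableEq W]

/-- The squared norm of the projection of `φ` onto the states whose register `out` is in the uniform
superposition over `V`. For every assignment of the other qubits the summand occurs `2^|J|` times,
once for each assignment of the register. -/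
noncomputable def overlap (V : Finset (Bits J)) (out : J ↪ W) (φ : State W) : ℝ :=
  ((2 : ℝ) ^ Fintype.card J)⁻¹ * ∑ b : Bits W,
    (V.card : ℝ)⁻¹ * ‖∑ y ∈ V, φ (Function.extend out y b)‖ ^ 2

theorem overlap_eq (V : Finset (Bits J)) (out : J ↪ W) (φ : State W) :
    overlap V out φ = ∑ b : Bits W, if b ∘ out ∈ V then
      ‖(V.card : ℂ)⁻¹ * ∑ y ∈ V, φ (Function.extend out y b)‖ ^ 2 else 0 := by
  have h := sum_extend out.injective fun b => if b ∘ out ∈ V then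
      ‖(V.card : ℂ)⁻¹ * ∑ y ∈ V, φ (Function.extend out y b)‖ ^ 2 else 0
  have h2 : (2 : ℝ) ^ Fintype.card J ≠ 0 := by positivity
  rw [overlap, inv_mul_eq_iff_eq_mul₀ h2, ← h]
  refine Finset.sum_congr rfl fun b _ => ?_
  simp only [extend_comp' out.injective, extend_extend out.injective]
  rw [← Finset.sum_filter, Finset.sum_const, nsmul_eq_mul, norm_mul, mul_pow, ← mul_assoc]
  congr 1
  have : Finset.univ.filter (fun x => x ∈ V) = V := by ext; simp
  rw [this]
  by_cases hV : (V.card : ℝ) = 0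
  · simp [hV]
  · rw [norm_inv, Complex.norm_natCast]
    field_simp

theorem norm_add_sq_le (z w : ℂ) : ‖z + w‖ ^ 2 ≤ 2 * ‖z‖ ^ 2 + 2 * ‖w‖ ^ 2 := by
  have h := norm_add_le z w
  nlinarith [norm_nonneg (z + w), sq_nonneg (‖z‖ - ‖w‖)]

theorem norm_sum_sq_le {ι : Type*} (V : Finset ι) (f : ι → ℂ) :
    ‖∑ y ∈ V, f y‖ ^ 2 ≤ V.card * ∑ y ∈ V, ‖f y‖ ^ 2 :=
  (pow_le_pow_left₀ (norm_nonneg _) (norm_sum_le _ _) 2).trans sq_sum_le_card_mul_sum_sq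

theorem overlap_le_nrm_sq (V : Finset (Bits J)) (out : J ↪ W) (φ : State W) :
    overlap V out φ ≤ nrm φ ^ 2 := by
  have h2 : (0 : ℝ) < 2 ^ Fintype.card J := by positivity
  rw [overlap, inv_mul_le_iff₀ h2, nrm_sq, ← sum_extend out.injective fun b => ‖φ b‖ ^ 2]
  refine Finset.sum_le_sum fun b _ => ?_
  rcases V.eq_empty_or_nonempty with rfl | hV
  · simp only [Finset.card_empty, Nat.cast_zero, inv_zero, zero_mul]
    positivity
  · rw [inv_mul_le_iff₀ (by exact_mod_cast hV.card_pos)]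
    refine (norm_sum_sq_le V _).trans (mul_le_mul_of_nonneg_left ?_ (by positivity))
    exact Finset.sum_le_univ_sum_of_nonneg fun _ => by positivity

theorem overlap_le_of_sub (V : Finset (Bits J)) (out : J ↪ W) (φ χ : State W) :
    overlap V out φ ≤ 2 * overlap V out χ + 2 * nrm (φ - χ) ^ 2 := by
  have h1 : overlap V out φ ≤ 2 * overlap V out χ + 2 * overlap V out (φ - χ) := by
    unfold overlap
    rw [mul_left_comm 2, mul_left_comm 2, ← mul_add, Finset.mul_sum (a := (2 : ℝ)),
      Finset.mul_sum (a := (2 : ℝ)), ← Finset.sum_add_distrib]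
    refine mul_le_mul_of_nonneg_left (Finset.sum_le_sum fun b _ => ?_) (by positivity)
    rw [mul_left_comm 2, mul_left_comm 2, ← mul_add]
    refine mul_le_mul_of_nonneg_left ?_ (by positivity)
    have := norm_add_sq_le (∑ y ∈ V, χ (Function.extend out y b))
      (∑ y ∈ V, (φ - χ) (Function.extend out y b))
    rwa [← Finset.sum_add_distrib, Finset.sum_congr rfl fun y _ => by
      rw [Pi.sub_apply, add_sub_cancel]] at this
  linarith [overlap_le_nrm_sq V out (φ - χ)]

end Overlap

section Attempt

variable {n : ℕ}

open scoped Classical in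
/-- The pairs of elements of `A`, as bits of two registers. -/
noncomputable def squareSet (A : Submodule (ZMod 2) (Bits (Fin n))) : Finset (Bits (Fin 2 × Fin n)) :=
  Finset.univ.filter fun y => ∀ i, (fun j => y (i, j)) ∈ A

theorem mem_squareSet {A : Submodule (ZMod 2) (Bits (Fin n))} {y : Bits (Fin 2 × Fin n)} :
    y ∈ squareSet A ↔ ∀ i, (fun j => y (i, j)) ∈ A := by
  simp [squareSet]

/-- Two strings, side by side. -/
def pairBits {J : Type} (x y : Bits J) : Bits (Fin 2 × J) :=
  fun p => if p.1 = 0 then x p.2 else y p.2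

theorem pairBits_eq_zero {J : Type} (x y : Bits J) : pairBits x y = 0 ↔ x = 0 ∧ y = 0 := by
  constructor
  · intro h
    exact ⟨funext fun j => congrFun h (0, j), funext fun j => congrFun h (1, j)⟩
  · rintro ⟨rfl, rfl⟩
    funext p
    unfold pairBits
    split_ifs <;> rfl

/-- Strings on two registers are pairs of strings. -/
def pairBitsEquiv (J : Type) : Bits J × Bits J ≃ Bits (Fin 2 × J) where
  toFun p := pairBits p.1 p.2
  invFun y := (fun j => y (0, j), fun j => y (1, j))
  left_inv p := rfl
  right_inv y := by
    funext ⟨i, j⟩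
    rcases Fin.exists_fin_two.1 ⟨i, rfl⟩ with rfl | rfl <;> rfl

open scoped Classical in
theorem sum_squareSet {M : Type*} [AddCommMonoid M] (A : Submodule (ZMod 2) (Bits (Fin n)))
    (f : Bits (Fin 2 × Fin n) → M) :
    ∑ y ∈ squareSet A, f y =
      ∑ x, ∑ y, if x ∈ A ∧ y ∈ A then f (pairBits x y) else 0 := by
  rw [squareSet, Finset.sum_filter, ← (pairBitsEquiv (Fin n)).sum_comp, Fintype.sum_prod_type]
  refine Finset.sum_congr rfl fun x _ => Finset.sum_congr rfl fun y _ => ?_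
  simp only [Fin.forall_fin_two]
  rfl

theorem card_squareSet (A : Submodule (ZMod 2) (Bits (Fin n))) :
    (squareSet A).card = Nat.card A ^ 2 := by
  classical
  rw [Finset.card_eq_sum_ones, sum_squareSet]
  have : ∀ x y : Bits (Fin n), (if x ∈ A ∧ y ∈ A then 1 else 0) =
      (if x ∈ A then 1 else 0) * if y ∈ A then 1 else 0 := fun x y => by
    split_ifs <;> simp_all
  simp only [this, ← Finset.sum_mul_sum]
  rw [← sq, Finset.sum_boole, Nat.cast_id, ← Fintype.card_subtype, Nat.card_eq_fintype_card]

namespace Counterfeiter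

variable (C : Counterfeiter n)

/-- The `i`-th output register. -/
def register (i : Fin 2) : Fin n ↪ Note n ⊕ Fin C.m :=
  ⟨fun j => C.out (i, j), fun _ _ h => (Prod.ext_iff.1 (C.out.injective h)).2⟩

/-- The bits of an attempt: those of the counterfeiter, the serial number, and the work qubits. -/
def wireBits (c : Bits (Note n ⊕ Fin C.m)) (t : Bits (Fin (3 * n))) (a : Bits (Fin 2 × Fin 3)) :
    Bits C.Wires := Sum.elim c (Sum.elim t a)

theorem extend_verWires_zero (c t a₀ a₁ t' x a') :
    Function.extend (C.verWires 0) (noteBits t' x a') (C.wireBits c t (pairBits a₀ a₁)) =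
      C.wireBits (Function.extend (C.register 0) x c) t' (pairBits a' a₁) := by
  refine extend_eq (C.verWires 0).injective ?_ ?_
  · rintro ((l | j) | k)
    · rfl
    · exact (C.register 0).injective.extend_apply x c j
    · rfl
  · rintro (i | l | ⟨i, k⟩) h
    · exact Function.extend_apply' _ _ _ fun ⟨j, hj⟩ => h (.inl (.inr j)) (congrArg Sum.inl hj)
    · exact absurd rfl (h (.inl (.inl l)))
    · rcases Fin.exists_fin_two.1 ⟨i, rfl⟩ with rfl | rfl
      · exact absurd rfl (h (.inr k))
      · rfl

theorem extend_verWires_one (c t a₀ a₁ t' x a') :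
    Function.extend (C.verWires 1) (noteBits t' x a') (C.wireBits c t (pairBits a₀ a₁)) =
      C.wireBits (Function.extend (C.register 1) x c) t' (pairBits a₀ a') := by
  refine extend_eq (C.verWires 1).injective ?_ ?_
  · rintro ((l | j) | k)
    · rfl
    · exact (C.register 1).injective.extend_apply x c j
    · rfl
  · rintro (i | l | ⟨i, k⟩) h
    · exact Function.extend_apply' _ _ _ fun ⟨j, hj⟩ => h (.inl (.inr j)) (congrArg Sum.inl hj)
    · exact absurd rfl (h (.inl (.inl l)))
    · rcases Fin.exists_fin_two.1 ⟨i, rfl⟩ with rfl | rfl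
      · rfl
      · exact absurd rfl (h (.inr k))

theorem extend_register (x y : Bits (Fin n)) (c : Bits (Note n ⊕ Fin C.m)) :
    Function.extend (C.register 0) x (Function.extend (C.register 1) y c) =
      Function.extend C.out (pairBits x y) c := by
  refine extend_eq (C.register 0).injective (fun j => C.out.injective.extend_apply _ _ (0, j)) ?_
  intro w hw
  by_cases hw' : ∃ j, C.register 1 j = w
  · obtain ⟨j, rfl⟩ := hw'
    rw [(C.register 1).injective.extend_apply]
    exact C.out.injective.extend_apply _ _ (1, j)
  · rw [Function.extend_apply' _ _ _ hw', Function.extend_apply']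
    rintro ⟨⟨i, j⟩, hj⟩
    rcases Fin.exists_fin_two.1 ⟨i, rfl⟩ with rfl | rfl
    · exact hw j hj
    · exact hw' ⟨j, hj⟩

theorem extend_register_comp (y : Bits (Fin n)) (c : Bits (Note n ⊕ Fin C.m)) :
    Function.extend (C.register 1) y c ∘ C.register 0 = c ∘ C.register 0 := by
  funext j
  refine Function.extend_apply' _ _ _ fun ⟨j', hj⟩ => ?_
  simpa using (Prod.ext_iff.1 (C.out.injective hj)).1

open scoped Classical in
/-- Both verifications together project the output registers onto `|A_r⟩|A_r⟩`, which is the uniform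
superposition over `A_r × A_r`. -/
theorem successProbAt_eq_overlap (O : Oracle n) (r : Bits (Fin n)) :
    C.successProbAt O r = overlap (squareSet (O.subspace r)) C.out
      (C.circuit.runIn O.world (withZeros (banknote O r))) := by
  set A := O.subspace r
  set φ := C.circuit.runIn O.world (withZeros (banknote O r))
  have h0 : ∀ c t a, Circuit.runIn O.world
      (C.circuit.map (Gate.map Function.Embedding.inl)) (C.initial O r) (C.wireBits c t a) =
        if t = O.serial r ∧ a = 0 then φ c else 0 := by
    intro c t a
    rw [Circuit.runIn_map]
    have h1 : ∀ c', Function.extend (Function.Embedding.inl : _ ↪ C.Wires) c' (C.wireBits c t a) =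
        C.wireBits c' t a := by
      intro c'
      funext x
      rcases x with x | x
      · exact (Function.Embedding.inl : _ ↪ C.Wires).injective.extend_apply c' _ x
      · rw [Function.extend_apply' _ _ _ (by rintro ⟨j, hj⟩; cases hj)]
        rfl
    have h2 : (fun c' => C.initial O r (C.wireBits c' t a)) =
        if t = O.serial r ∧ a = 0 then withZeros (banknote O r) else 0 := by
      funext c'
      have : C.initial O r (C.wireBits c' t a) =
          if t = O.serial r ∧ a = 0 then withZeros (banknote O r) c' else 0 := rfl
      rw [this]
      split_ifs <;> rfl
    simp only [h1, h2]
    split_ifs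
    · rfl
    · rw [map_zero]; rfl
  set φ₀ := Circuit.runIn O.world
      (C.circuit.map (Gate.map Function.Embedding.inl)) (C.initial O r) with hφ₀
  have h1 : ∀ c t a₁, Circuit.runIn O.world ((verCircuit n).map (Gate.map (C.verWires 0))) φ₀
      (C.wireBits c t (pairBits 1 a₁)) = if t = O.serial r ∧ a₁ = 0 then
        (if c ∘ C.register 0 ∈ A then (Nat.card A : ℂ)⁻¹ *
        ∑ y, (if y ∈ A then φ (Function.extend (C.register 0) y c) else 0) else 0) else 0 := by
    intro c t a₁
    have hb : C.wireBits c t (pairBits 1 a₁) ∘ C.verWires 0 = noteBits t (c ∘ C.register 0) 1 := by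
      funext x
      rcases x with (x | x) | x <;> rfl
    have hχ : ∀ t' x a', φ₀ (Function.extend (C.verWires 0) (noteBits t' x a')
        (C.wireBits c t (pairBits 1 a₁))) = if t' = O.serial r ∧ a' = 0 ∧ a₁ = 0 then
          φ (Function.extend (C.register 0) x c) else 0 := by
      intro t' x a'
      simp only [extend_verWires_zero, h0, pairBits_eq_zero]
    rw [Circuit.runIn_map, hb]
    by_cases ht : t = O.serial r
    · subst ht
      rw [runIn_verCircuit_serial]
      · simp only [hχ, true_and]
        by_cases ha : a₁ = 0
        · simp only [ha, if_true]
          rfl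
        · simp [ha]
      · intro s x a ha
        rw [hχ, if_neg (by tauto)]
    · rw [if_neg (by tauto)]
      refine runIn_verCircuit_eq_zero _ _ _ (fun t' x a h => ?_) _
      rw [hχ, if_neg]
      rintro ⟨rfl, rfl, _⟩
      exact h.elim (fun h => ht h.symm) (fun h => h rfl)
  set φ₁ := Circuit.runIn O.world ((verCircuit n).map (Gate.map (C.verWires 0))) φ₀
  have h2 : ∀ c t, Circuit.runIn O.world ((verCircuit n).map (Gate.map (C.verWires 1))) φ₁
      (C.wireBits c t (pairBits 1 1)) = if t = O.serial r then
        (if c ∘ C.out ∈ squareSet A then ((squareSet A).card : ℂ)⁻¹ *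
        ∑ y ∈ squareSet A, φ (Function.extend C.out y c) else 0) else 0 := by
    intro c t
    have hb : C.wireBits c t (pairBits 1 1) ∘ C.verWires 1 = noteBits t (c ∘ C.register 1) 1 := by
      funext x
      rcases x with (x | x) | x <;> rfl
    have hχ : ∀ t' x a', φ₁ (Function.extend (C.verWires 1) (noteBits t' x a')
        (C.wireBits c t (pairBits 1 1))) = if t' = O.serial r ∧ a' = 0 then
        (if c ∘ C.register 0 ∈ A then (Nat.card A : ℂ)⁻¹ *
        ∑ y, (if y ∈ A then φ (Function.extend C.out (pairBits y x) c) else 0) else 0) else 0 := by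
      intro t' x a'
      rw [extend_verWires_one, h1, extend_register_comp]
      simp only [extend_register]
    rw [Circuit.runIn_map, hb]
    by_cases ht : t = O.serial r
    · subst ht
      rw [runIn_verCircuit_serial]
      · simp only [hχ, true_and, if_true]
        have hmem : c ∘ C.out ∈ squareSet A ↔ c ∘ C.register 0 ∈ A ∧ c ∘ C.register 1 ∈ A := by
          rw [mem_squareSet, Fin.forall_fin_two]
          rfl
        rw [card_squareSet, sum_squareSet]
        by_cases hc0 : c ∘ C.register 0 ∈ A <;> by_cases hc1 : c ∘ C.register 1 ∈ A <;>
          simp only [hmem, hc0, hc1, and_true, and_false, if_true, if_false, ite_self,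
            Finset.sum_const_zero, mul_zero]
        · rw [if_pos hc1, Finset.sum_comm, Nat.cast_pow, sq, mul_inv, mul_assoc]
          congr 1
          rw [Finset.mul_sum]
          refine Finset.sum_congr rfl fun y _ => ?_
          by_cases hy : y ∈ A
          · simp only [hy, and_true]
            rw [if_pos hy]
          · simp only [hy, and_false, if_false, Finset.sum_const_zero, mul_zero]
            rw [if_neg hy]
        · rw [if_neg hc1]
      · intro s x a ha
        rw [hχ, if_neg (by tauto)]
    · rw [if_neg (by tauto)]
      refine runIn_verCircuit_eq_zero _ _ _ (fun t' x a h => ?_) _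
      rw [hχ, if_neg]
      rintro ⟨rfl, rfl⟩
      exact h.elim (fun h => ht h.symm) (fun h => h rfl)
  have hrun : C.attempt.run O (C.initial O r) =
      Circuit.runIn O.world ((verCircuit n).map (Gate.map (C.verWires 1))) φ₁ := by
    rw [Circuit.run_eq_runIn, attempt, Circuit.runIn_append, Circuit.runIn_append]
  let e : Bits C.Wires ≃ Bits (Note n ⊕ Fin C.m) × Bits (Fin (3 * n)) × Bits (Fin 2 × Fin 3) :=
    (Equiv.sumArrowEquivProdArrow _ _ _).trans
      ((Equiv.refl _).prodCongr (Equiv.sumArrowEquivProdArrow _ _ _))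
  rw [successProbAt, hrun, overlap_eq, ← e.symm.sum_comp, Fintype.sum_prod_type]
  refine Finset.sum_congr rfl fun c _ => ?_
  rw [Fintype.sum_prod_type]
  have h3 : ∀ t a, e.symm (c, t, a) = C.wireBits c t a := fun t a => rfl
  have h4 : ∀ t (a : Bits (Fin 2 × Fin 3)), (∀ p, C.wireBits c t a (.inr (.inr p)) = 1) ↔
      a = pairBits 1 1 := fun t a =>
    ⟨fun h => funext fun p => (h p).trans (by unfold pairBits; split_ifs <;> rfl),
      by rintro rfl p; change pairBits 1 1 p = 1; unfold pairBits; split_ifs <;> rfl⟩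
  simp only [h3, h4, Finset.sum_ite_eq', Finset.mem_univ, if_true, h2]
  rw [Finset.sum_eq_single (O.serial r)]
  · rw [if_pos rfl]
    split_ifs <;> simp
  · intro t _ ht
    rw [if_neg ht]; simp
  · simp

end Counterfeiter

end Attempt

/-! ### An almost orthogonality inequality -/

section AlmostOrthogonal

/-- An inequality of Bessel type for indicator functions of sets with small pairwise intersections,
proved by duality. -/
theorem sum_norm_sq_sum_le {ι κ : Type*} [Fintype ι] [Fintype κ] [DecidableEq κ]
    (V : ι → Finset κ) (B : ℝ) (hB0 : 0 ≤ B) (hB : ∀ i, ∑ j, ((V i ∩ V j).card : ℝ) ≤ B) (Ψ : κ → ℂ) :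
    ∑ i, ‖∑ k ∈ V i, Ψ k‖ ^ 2 ≤ B * ∑ k, ‖Ψ k‖ ^ 2 := by
  set c : ι → ℂ := fun i => ∑ k ∈ V i, Ψ k with hc
  set S : ℝ := ∑ i, ‖c i‖ ^ 2 with hS
  set d : κ → ℂ := fun k => ∑ i, if k ∈ V i then c i else 0 with hd
  have hS0 : 0 ≤ S := Finset.sum_nonneg fun i _ => by positivity
  have hΨ0 : 0 ≤ ∑ k, ‖Ψ k‖ ^ 2 := Finset.sum_nonneg fun i _ => by positivity
  -- `S` is the inner product of `Ψ` and `d`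
  have h1 : (S : ℂ) = ∑ k, Ψ k * (starRingEnd ℂ) (d k) := by
    have : ∀ i, ((‖c i‖ ^ 2 : ℝ) : ℂ) =
        ∑ k, if k ∈ V i then Ψ k * (starRingEnd ℂ) (c i) else 0 := fun i => by
      rw [← Finset.sum_filter, ← Finset.sum_mul, ← Complex.normSq_eq_norm_sq,
        ← Complex.mul_conj]
      congr 2
      simp [hc]
    rw [hS, Complex.ofReal_sum]
    simp only [this]
    rw [Finset.sum_comm]
    refine Finset.sum_congr rfl fun k _ => ?_
    simp only [hd, map_sum, Finset.mul_sum]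
    refine Finset.sum_congr rfl fun i _ => ?_
    split_ifs <;> simp
  have h2 : ∑ k, ‖d k‖ ^ 2 ≤ B * S := by
    have h3 : ∀ k, ‖d k‖ ^ 2 ≤ ∑ i, ∑ j, (if k ∈ V i ∩ V j then
        (‖c i‖ ^ 2 + ‖c j‖ ^ 2) / 2 else 0) := fun k => by
      have : ‖d k‖ ≤ ∑ i, if k ∈ V i then ‖c i‖ else 0 := by
        refine (norm_sum_le _ _).trans (Finset.sum_le_sum fun i _ => ?_)
        split_ifs <;> simp
      refine (pow_le_pow_left₀ (norm_nonneg _) this 2).trans ?_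
      rw [sq, Finset.sum_mul_sum]
      refine Finset.sum_le_sum fun i _ => Finset.sum_le_sum fun j _ => ?_
      by_cases hi : k ∈ V i <;> by_cases hj : k ∈ V j <;> simp [hi, hj]
      nlinarith [sq_nonneg (‖c i‖ - ‖c j‖)]
    have h4 : ∀ i j, ∑ k, (if k ∈ V i ∩ V j then (‖c i‖ ^ 2 + ‖c j‖ ^ 2) / 2 else 0) =
        ((V i ∩ V j).card : ℝ) * ‖c i‖ ^ 2 / 2 + ((V j ∩ V i).card : ℝ) * ‖c j‖ ^ 2 / 2 := by
      intro i j
      rw [← Finset.sum_filter, Finset.sum_const, Finset.inter_comm (V j)]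
      have : Finset.univ.filter (fun k => k ∈ V i ∩ V j) = V i ∩ V j := by ext; simp
      rw [this, nsmul_eq_mul]
      ring
    have h5 : ∑ i, ∑ j, ((V i ∩ V j).card : ℝ) * ‖c i‖ ^ 2 / 2 ≤ B * S / 2 := by
      rw [hS, Finset.mul_sum, Finset.sum_div]
      refine Finset.sum_le_sum fun i _ => ?_
      rw [← Finset.sum_div, ← Finset.sum_mul]
      have := mul_le_mul_of_nonneg_right (hB i) (sq_nonneg ‖c i‖)
      linarith
    calc ∑ k, ‖d k‖ ^ 2 ≤ ∑ k, ∑ i, ∑ j, (if k ∈ V i ∩ V j then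
          (‖c i‖ ^ 2 + ‖c j‖ ^ 2) / 2 else 0) := Finset.sum_le_sum fun k _ => h3 k
      _ = ∑ i, ∑ j, ∑ k, (if k ∈ V i ∩ V j then (‖c i‖ ^ 2 + ‖c j‖ ^ 2) / 2 else 0) := by
          rw [Finset.sum_comm]
          exact Finset.sum_congr rfl fun i _ => Finset.sum_comm
      _ = ∑ i, ∑ j, ((V i ∩ V j).card : ℝ) * ‖c i‖ ^ 2 / 2 +
          ∑ j, ∑ i, ((V j ∩ V i).card : ℝ) * ‖c j‖ ^ 2 / 2 := by
          simp only [h4, Finset.sum_add_distrib]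
          congr 1
          exact Finset.sum_comm
      _ ≤ B * S := by linarith
  have h6 : S ≤ ∑ k, ‖Ψ k‖ * ‖d k‖ := by
    have : ‖(S : ℂ)‖ = S := by rw [Complex.norm_real, Real.norm_of_nonneg hS0]
    rw [← this, h1]
    refine (norm_sum_le _ _).trans (Finset.sum_le_sum fun k _ => ?_)
    rw [norm_mul, RCLike.norm_conj]
  have h7 : S ^ 2 ≤ (∑ k, ‖Ψ k‖ ^ 2) * (B * S) :=
    (pow_le_pow_left₀ hS0 h6 2).trans
      ((Finset.sum_mul_sq_le_sq_mul_sq _ _ _).trans (mul_le_mul_of_nonneg_left h2 hΨ0))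
  rcases hS0.eq_or_lt with h | h
  · rw [← h]
    exact mul_nonneg hB0 hΨ0
  · nlinarith

variable {J W κ ι : Type} [Fintype J] [DecidableEq J] [Fintype W] [DecidableEq W]
  [Fintype κ] [DecidableEq κ] [Fintype ι]

omit [DecidableEq J] in
theorem overlap_smul (V : Finset (Bits J)) (out : J ↪ W) (a : ℂ) (φ : State W) :
    overlap V out (a • φ) = ‖a‖ ^ 2 * overlap V out φ := by
  rw [overlap, overlap, mul_left_comm (‖a‖ ^ 2), Finset.mul_sum _ _ (‖a‖ ^ 2)]
  congr 1
  refine Finset.sum_congr rfl fun b _ => ?_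
  simp only [Pi.smul_apply, smul_eq_mul, ← Finset.mul_sum, norm_mul, mul_pow]
  ring

/-- Superpositions of few common states `u k` cannot have large overlaps with many almost orthogonal
states of a register. -/
theorem sum_overlap_le (G : ι → Finset κ) (V : ι → Finset (Bits J)) (out : J ↪ W)
    (u : κ → State W) (v B : ℝ) (hv0 : 0 ≤ v)
    (hv : ∀ i, ((V i).card : ℝ) = v) (hB0 : 0 ≤ B)
    (hB : ∀ i, ∑ j, ((G i ∩ G j).card : ℝ) * ((V i ∩ V j).card : ℝ) ≤ B) :
    ∑ i, overlap (V i) out (∑ k ∈ G i, u k) ≤ v⁻¹ * (B * ∑ k, nrm (u k) ^ 2) := by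
  have key : ∀ b : Bits W, ∑ i, ‖∑ y ∈ V i, (∑ k ∈ G i, u k) (Function.extend out y b)‖ ^ 2 ≤
      B * ∑ k, ∑ y, ‖u k (Function.extend out y b)‖ ^ 2 := by
    intro b
    have h := sum_norm_sq_sum_le (fun i => G i ×ˢ V i) B hB0 (fun i => by
      simp only [Finset.product_inter_product, Finset.card_product, Nat.cast_mul]
      exact hB i) (fun p : κ × Bits J => u p.1 (Function.extend out p.2 b))
    simp only [Finset.sum_product, Fintype.sum_prod_type] at h
    refine le_trans (le_of_eq ?_) h
    refine Finset.sum_congr rfl fun i _ => ?_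
    simp only [Finset.sum_apply]
    rw [Finset.sum_comm]
  have h2 : (0 : ℝ) < 2 ^ Fintype.card J := by positivity
  simp only [overlap, hv, ← Finset.mul_sum]
  rw [mul_left_comm]
  refine mul_le_mul_of_nonneg_left ?_ (inv_nonneg.2 hv0)
  rw [inv_mul_le_iff₀ h2, Finset.sum_comm]
  refine (Finset.sum_le_sum fun b _ => key b).trans (le_of_eq ?_)
  rw [← Finset.mul_sum, Finset.sum_comm, mul_left_comm]
  congr 1
  rw [Finset.mul_sum]
  refine Finset.sum_congr rfl fun k _ => ?_
  rw [sum_extend out.injective fun b => ‖u k b‖ ^ 2, nrm_sq]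

end AlmostOrthogonal

/-! ### Flags of subspaces and shears -/

section Flags

variable (K E E' : Type) [Field K] [AddCommGroup E] [AddCommGroup E'] [Algebra (ZMod 2) K]
  [Module (ZMod 2) E] [Module (ZMod 2) E']

/-- Coordinates `(e, t, p; q, u, e')` on `𝔽₂ⁿ`. In these the hidden subspace is
`{q = u = 0, e' = 0}`; it lies between `{p = q = u = 0, e' = 0}` and `{u = 0, e' = 0}`. -/
abbrev Coord : Type := (E × K × K) × K × K × E'

variable {K}

/-- The hidden subspace, sheared by `f`: the graph `q = f p`. -/
def hiddenFlag (f : K →ₗ[ZMod 2] K) : Submodule (ZMod 2) (Coord K E E') where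
  carrier := {c | c.2.1 = f c.1.2.2 ∧ c.2.2 = 0}
  add_mem' := by rintro a b ⟨h1, h2⟩ ⟨h3, h4⟩; simp_all
  zero_mem' := by simp
  smul_mem' := by rintro a b ⟨h1, h2⟩; simp_all

/-- The superspace of the hidden subspace, sheared by `f`. -/
def upperFlag (f : K →ₗ[ZMod 2] K) : Submodule (ZMod 2) (Coord K E E') where
  carrier := {c | c.2.2.1 = f c.2.1 ∧ c.2.2.2 = 0}
  add_mem' := by rintro a b ⟨h1, h2⟩ ⟨h3, h4⟩; simp_all
  zero_mem' := by simp
  smul_mem' := by rintro a b ⟨h1, h2⟩; simp_all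

/-- The subspace of the hidden subspace, sheared by `f`. -/
def lowerFlag (f : K →ₗ[ZMod 2] K) : Submodule (ZMod 2) (Coord K E E') where
  carrier := {c | c.2 = 0 ∧ c.1.2.2 = f c.1.2.1}
  add_mem' := by rintro a b ⟨h1, h2⟩ ⟨h3, h4⟩; simp_all
  zero_mem' := by simp
  smul_mem' := by rintro a b ⟨h1, h2⟩; simp_all

/-- The shear `q ↦ q + f p`. It preserves the outer subspaces of the flag and moves the hidden one. -/
def innerShear (f : K →ₗ[ZMod 2] K) : Coord K E E' ≃ₗ[ZMod 2] Coord K E E' where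
  toFun c := (c.1, c.2.1 + f c.1.2.2, c.2.2)
  invFun c := (c.1, c.2.1 - f c.1.2.2, c.2.2)
  map_add' a b := by ext <;> simp; abel
  map_smul' a b := by ext <;> simp
  left_inv c := by simp
  right_inv c := by simp

/-- The shear `p ↦ p + f t`, `u ↦ u + f q`. It preserves the hidden subspace and moves the outer
subspaces of the flag. -/
def outerShear (f : K →ₗ[ZMod 2] K) : Coord K E E' ≃ₗ[ZMod 2] Coord K E E' where
  toFun c := ((c.1.1, c.1.2.1, c.1.2.2 + f c.1.2.1), c.2.1, c.2.2.1 + f c.2.1, c.2.2.2)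
  invFun c := ((c.1.1, c.1.2.1, c.1.2.2 - f c.1.2.1), c.2.1, c.2.2.1 - f c.2.1, c.2.2.2)
  map_add' a b := by ext <;> simp <;> abel
  map_smul' a b := by ext <;> simp
  left_inv c := by simp
  right_inv c := by simp

variable {E E'} (f : K →ₗ[ZMod 2] K)

theorem map_innerShear_hiddenFlag :
    (hiddenFlag E E' 0).map (innerShear E E' f : Coord K E E' →ₗ[ZMod 2] Coord K E E') =
      hiddenFlag E E' f := by
  ext c
  rw [Submodule.mem_map_equiv]
  simp [hiddenFlag, innerShear, sub_eq_zero]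

theorem map_innerShear_upperFlag :
    (upperFlag E E' 0).map (innerShear E E' f : Coord K E E' →ₗ[ZMod 2] Coord K E E') =
      upperFlag E E' 0 := by
  ext c
  rw [Submodule.mem_map_equiv]
  simp [upperFlag, innerShear]

theorem map_innerShear_lowerFlag :
    (lowerFlag E E' 0).map (innerShear E E' f : Coord K E E' →ₗ[ZMod 2] Coord K E E') =
      lowerFlag E E' 0 := by
  ext c
  rw [Submodule.mem_map_equiv]
  simp only [lowerFlag, innerShear, LinearEquiv.coe_symm_mk', Submodule.mem_mk,
    AddSubmonoid.mem_mk, AddSubsemigroup.mem_mk, Set.mem_ofPred_eq, LinearMap.zero_apply,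
    Prod.ext_iff, Prod.fst_zero, Prod.snd_zero]
  constructor
  · rintro ⟨⟨h1, h2⟩, h3⟩
    rw [h3] at h1
    simp_all
  · rintro ⟨⟨h1, h2⟩, h3⟩
    simp_all

theorem map_outerShear_hiddenFlag :
    (hiddenFlag E E' 0).map (outerShear E E' f : Coord K E E' →ₗ[ZMod 2] Coord K E E') =
      hiddenFlag E E' 0 := by
  ext c
  rw [Submodule.mem_map_equiv]
  simp only [hiddenFlag, outerShear, LinearEquiv.coe_symm_mk', Submodule.mem_mk,
    AddSubmonoid.mem_mk, AddSubsemigroup.mem_mk, Set.mem_ofPred_eq, LinearMap.zero_apply,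
    Prod.ext_iff, Prod.fst_zero, Prod.snd_zero]
  constructor
  · rintro ⟨h1, h2, h3⟩
    rw [h1] at h2
    simp_all
  · rintro ⟨h1, h2, h3⟩
    simp_all

theorem map_outerShear_upperFlag :
    (upperFlag E E' 0).map (outerShear E E' f : Coord K E E' →ₗ[ZMod 2] Coord K E E') =
      upperFlag E E' f := by
  ext c
  rw [Submodule.mem_map_equiv]
  simp [upperFlag, outerShear, sub_eq_zero]

theorem map_outerShear_lowerFlag :
    (lowerFlag E E' 0).map (outerShear E E' f : Coord K E E' →ₗ[ZMod 2] Coord K E E') =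
      lowerFlag E E' f := by
  ext c
  rw [Submodule.mem_map_equiv]
  simp only [lowerFlag, outerShear, LinearEquiv.coe_symm_mk', Submodule.mem_mk,
    AddSubmonoid.mem_mk, AddSubsemigroup.mem_mk, Set.mem_ofPred_eq, LinearMap.zero_apply,
    Prod.ext_iff, Prod.fst_zero, Prod.snd_zero, sub_eq_zero]
  constructor
  · rintro ⟨⟨h1, h2, h3⟩, h4⟩
    rw [h1] at h2
    simp_all
  · rintro ⟨⟨h1, h2, h3⟩, h4⟩
    simp_all

theorem lowerFlag_le : lowerFlag E E' f ≤ hiddenFlag E E' 0 := by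
  rintro c ⟨h, _⟩
  simp [hiddenFlag, h]

theorem hiddenFlag_le : hiddenFlag E E' 0 ≤ upperFlag E E' f := by
  rintro c ⟨h, h'⟩
  simp_all [upperFlag]

theorem card_hiddenFlag_inf (f g : K →ₗ[ZMod 2] K) [Finite K] [Finite E] [Finite E'] :
    Nat.card ↥(hiddenFlag E E' f ⊓ hiddenFlag E E' g) =
      Nat.card E * Nat.card K * Nat.card {p // f p = g p} := by
  rw [← Nat.card_prod, ← Nat.card_prod]
  refine Nat.card_congr ⟨fun c => ((c.1.1.1, c.1.1.2.1), ⟨c.1.1.2.2, ?_⟩),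
    fun d => ⟨((d.1.1, d.1.2, d.2.1), f d.2.1, 0), ⟨⟨rfl, rfl⟩, ⟨d.2.2, rfl⟩⟩⟩, ?_, ?_⟩
  · obtain ⟨c, ⟨h1, _⟩, ⟨h2, _⟩⟩ := c
    exact h1.symm.trans h2
  · rintro ⟨⟨⟨e, t, p⟩, q, u⟩, ⟨h1, h2⟩, h3⟩
    obtain rfl : q = f p := h1
    obtain rfl : u = 0 := h2
    rfl
  · rintro ⟨⟨e, t⟩, p, h⟩
    rfl

/-- Two different outer shears by multiplications have almost disjoint upper spaces. -/
theorem mem_hiddenFlag_of_mem_upperFlag {a a' : K} (h : a ≠ a') {c : Coord K E E'}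
    (h1 : c ∈ upperFlag E E' (LinearMap.mulLeft (ZMod 2) a))
    (h2 : c ∈ upperFlag E E' (LinearMap.mulLeft (ZMod 2) a')) : c ∈ hiddenFlag E E' 0 := by
  obtain ⟨h3, h4⟩ := h1
  obtain ⟨h5, -⟩ := h2
  simp only [LinearMap.mulLeft_apply] at h3 h5
  have h6 : (a - a') * c.2.1 = 0 := by rw [sub_mul, ← h3, ← h5, sub_self]
  have h7 : c.2.1 = 0 := (mul_eq_zero.1 h6).resolve_left (sub_ne_zero.2 h)
  refine ⟨h7, ?_⟩
  ext
  · simpa [h7] using h3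
  · exact h4

/-- The lower spaces of two different outer shears by multiplications span the hidden subspace. -/
theorem hiddenFlag_le_sup {a a' : K} (h : a ≠ a') :
    hiddenFlag E E' 0 ≤ lowerFlag E E' (LinearMap.mulLeft (ZMod 2) a) ⊔
      lowerFlag E E' (LinearMap.mulLeft (ZMod 2) a') := by
  rintro ⟨⟨e, t, p⟩, q, u⟩ ⟨h1, h2⟩
  obtain rfl : q = 0 := h1
  obtain rfl : u = 0 := h2
  set k := (p - a * t) / (a - a')
  have hk : a * t + (a - a') * k = p := by
    rw [mul_div_cancel₀ _ (sub_ne_zero.2 h)]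
    ring
  have h3 : (((e, t + k, a * (t + k)), 0) : Coord K E E') ∈
      lowerFlag E E' (LinearMap.mulLeft (ZMod 2) a) := ⟨rfl, rfl⟩
  have h4 : (((0, -k, a' * -k), 0) : Coord K E E') ∈
      lowerFlag E E' (LinearMap.mulLeft (ZMod 2) a') := ⟨rfl, rfl⟩
  convert Submodule.add_mem_sup h3 h4 using 1
  ext <;> simp
  rw [← hk]
  ring

end Flags

/-! ### Linearized polynomials -/

section Linearized

variable {K : Type} [Field K] [Algebra (ZMod 2) K]

theorem charP_of_algebra : CharP K 2 := charP_of_injective_algebraMap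
    (algebraMap (ZMod 2) K).injective 2

/-- The additive polynomial map `x ↦ a x + b x² + c x⁴`. -/
def linearized (abc : K × K × K) : K →ₗ[ZMod 2] K :=
  AddMonoidHom.toZModLinearMap 2
    { toFun := fun x => abc.1 * x + abc.2.1 * x ^ 2 + abc.2.2 * x ^ 4
      map_zero' := by simp
      map_add' := fun x y => by
        have := charP_of_algebra (K := K)
        have h2 := CharTwo.add_sq x y
        have h4 : (x + y) ^ 4 = x ^ 4 + y ^ 4 := by
          rw [show 4 = 2 * 2 from rfl, pow_mul, h2, CharTwo.add_sq, ← pow_mul, ← pow_mul]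
        rw [h2, h4]
        ring }

theorem linearized_apply (abc : K × K × K) (x : K) :
    linearized abc x = abc.1 * x + abc.2.1 * x ^ 2 + abc.2.2 * x ^ 4 := rfl

open Polynomial in
/-- Two different linearized polynomials of degree at most `4` agree in at most `4` points. -/
theorem card_linearized_eq_le {s s' : K × K × K} (h : s ≠ s') :
    Nat.card {x // linearized s x = linearized s' x} ≤ 4 := by
  classical
  set P : K[X] := C (s.1 - s'.1) * X + C (s.2.1 - s'.2.1) * X ^ 2 + C (s.2.2 - s'.2.2) * X ^ 4
  have hP : P ≠ 0 := by
    intro h0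
    apply h
    have h1 := congrArg (fun Q => coeff Q 1) h0
    have h2 := congrArg (fun Q => coeff Q 2) h0
    have h4 := congrArg (fun Q => coeff Q 4) h0
    simp only [P, coeff_add, coeff_C_mul, coeff_X, coeff_X_pow, coeff_zero] at h1 h2 h4
    norm_num [sub_eq_zero] at h1 h2 h4
    exact Prod.ext h1 (Prod.ext h2 h4)
  have hdeg : P.natDegree ≤ 4 := by
    simp only [P]
    compute_degree
  have hsub : {x | linearized s x = linearized s' x} ⊆ (P.roots.toFinset : Set K) := by
    intro x hx
    simp only [Finset.mem_coe, Multiset.mem_toFinset, mem_roots hP, IsRoot.def]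
    simp only [P, eval_add, eval_mul, eval_C, eval_X, eval_pow]
    have hx' : linearized s x = linearized s' x := hx
    rw [linearized_apply, linearized_apply] at hx'
    linear_combination hx'
  calc Nat.card {x // linearized s x = linearized s' x}
      = Set.ncard {x | linearized s x = linearized s' x} := rfl
    _ ≤ (P.roots.toFinset : Set K).ncard := Set.ncard_le_ncard hsub (Finset.finite_toSet _)
    _ = P.roots.toFinset.card := Set.ncard_coe_finset _
    _ ≤ P.roots.card := Multiset.toFinset_card_le _
    _ ≤ 4 := (card_roots' P).trans hdeg

/-- The cubes of the numbers of agreements of linearized polynomials are bounded on average. -/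
theorem sum_card_linearized_cube_le [Fintype K] [DecidableEq K] (s : K × K × K) :
    ∑ s', (Nat.card {x // linearized s x = linearized s' x} : ℝ) ^ 3 ≤
      65 * (Fintype.card K : ℝ) ^ 3 := by
  have h : ∀ s', (Nat.card {x // linearized s x = linearized s' x} : ℝ) ^ 3 ≤
      64 + if s' = s then (Fintype.card K : ℝ) ^ 3 else 0 := by
    intro s'
    split_ifs with hs
    · have : (Nat.card {x // linearized s x = linearized s' x} : ℝ) ≤ Fintype.card K := by
        rw [← Nat.card_eq_fintype_card]
        exact_mod_cast Finite.card_subtype_le _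
      have := pow_le_pow_left₀ (Nat.cast_nonneg _) this 3
      linarith
    · have : (Nat.card {x // linearized s x = linearized s' x} : ℝ) ≤ 4 := by
        exact_mod_cast card_linearized_eq_le (Ne.symm hs)
      have := pow_le_pow_left₀ (Nat.cast_nonneg _) this 3
      linarith
  refine (Finset.sum_le_sum fun s' _ => h s').trans (le_of_eq ?_)
  rw [Finset.sum_add_distrib, Finset.sum_ite_eq' Finset.univ s]
  simp [Fintype.card_prod]
  ring

end Linearized

/-! ### Counterfeiting one note with a concealed seed -/

section Concealed

variable {n : ℕ}

/-- The oracle `O` together with a further serial number `s`, whose note is not produced by the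
generator, and whose primal and dual testers test membership in `S` and in `T^⊥`. -/
def Oracle.adjoin (O : Oracle n) (s : Bits (Fin (3 * n))) (S T : Submodule (ZMod 2) (Bits (Fin n))) :
    World n where
  generatorBit := O.generatorBit
  Valid t := O.Valid t ∨ t = s
  Primal t x := O.Primal t x ∨ (t = s ∧ x ∈ S)
  Dual t x := O.Dual t x ∨ (t = s ∧ ∀ a ∈ T, a ⬝ᵥ x = 0)

open scoped Classical in
/-- The state `|s⟩ψ|0…0⟩`. -/
noncomputable def noteState {Z : Type} (s : Bits (Fin (3 * n))) (ψ : State (Fin n)) :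
    State (Note n ⊕ Z) :=
  withZeros fun b => if b ∘ Sum.inl = s then ψ (b ∘ Sum.inr) else 0

theorem withZeros_banknote {Z : Type} (O : Oracle n) (r : Bits (Fin n)) :
    withZeros (Z := Z) (banknote O r) = noteState (O.serial r) (subspaceState (O.subspace r)) := rfl

theorem noteState_sum {Z ι : Type} (s : Bits (Fin (3 * n))) (ψ : ι → State (Fin n)) (I : Finset ι) :
    noteState (Z := Z) s (∑ i ∈ I, ψ i) = ∑ i ∈ I, noteState s (ψ i) := by
  funext b
  simp only [noteState, withZeros, Finset.sum_apply]
  split_ifs <;> simp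

theorem noteState_smul {Z : Type} (s : Bits (Fin (3 * n))) (a : ℂ) (ψ : State (Fin n)) :
    noteState (Z := Z) s (a • ψ) = a • noteState s ψ := by
  funext b
  simp only [noteState, withZeros, Pi.smul_apply, smul_eq_mul]
  split_ifs <;> simp

theorem nrm_noteState {Z : Type} [Fintype Z] [DecidableEq Z] (s : Bits (Fin (3 * n)))
    (ψ : State (Fin n)) : nrm (noteState (Z := Z) s ψ) = nrm ψ := by
  classical
  rw [← pow_left_inj₀ (nrm_nonneg _) (nrm_nonneg _) two_ne_zero, nrm_sq, nrm_sq]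
  let e : Bits (Note n ⊕ Z) ≃ (Bits (Fin (3 * n)) × Bits (Fin n)) × Bits Z :=
    (Equiv.sumArrowEquivProdArrow _ _ _).trans
      ((Equiv.sumArrowEquivProdArrow _ _ _).prodCongr (Equiv.refl _))
  have h : ∀ t x z, ‖noteState s ψ (e.symm ((t, x), z))‖ ^ 2 =
      if z = 0 then if t = s then ‖ψ x‖ ^ 2 else 0 else 0 := by
    intro t x z
    have : noteState s ψ (e.symm ((t, x), z)) = if z = 0 then if t = s then ψ x else 0 else 0 := by
      have e1 : e.symm ((t, x), z) ∘ Sum.inr = z := rfl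
      have e2 : (e.symm ((t, x), z) ∘ Sum.inl) ∘ Sum.inl = t := rfl
      have e3 : (e.symm ((t, x), z) ∘ Sum.inl) ∘ Sum.inr = x := rfl
      simp only [noteState, withZeros, e1, e2, e3]
    rw [this]
    split_ifs <;> simp
  rw [← e.symm.sum_comp, Fintype.sum_prod_type, Fintype.sum_prod_type, Finset.sum_comm]
  simp [h]

variable {K E E' : Type} [Field K] [AddCommGroup E] [AddCommGroup E'] [Algebra (ZMod 2) K]
  [Module (ZMod 2) E] [Module (ZMod 2) E'] [Fintype K] [DecidableEq K] [Fintype E] [DecidableEq E]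
  [Fintype E'] [DecidableEq E']

/-- The image of a subspace in coordinates. -/
abbrev image (θ : Coord K E E' ≃ₗ[ZMod 2] Bits (Fin n)) (A : Submodule (ZMod 2) (Coord K E E')) :
    Submodule (ZMod 2) (Bits (Fin n)) := A.map (θ : Coord K E E' →ₗ[ZMod 2] Bits (Fin n))

omit [Fintype K] [DecidableEq K] [Fintype E] [DecidableEq E] [Fintype E'] [DecidableEq E'] in
theorem image_trans (h : Coord K E E' ≃ₗ[ZMod 2] Coord K E E')
    (θ : Coord K E E' ≃ₗ[ZMod 2] Bits (Fin n)) (A : Submodule (ZMod 2) (Coord K E E')) :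
    image (h.trans θ) A =
      image θ (A.map (h : Coord K E E' →ₗ[ZMod 2] Coord K E E')) := by
  rw [image, image, ← Submodule.map_comp]
  rfl

omit [DecidableEq K] [DecidableEq E] [DecidableEq E'] in
theorem card_image_inf (θ : Coord K E E' ≃ₗ[ZMod 2] Bits (Fin n)) (f g : K →ₗ[ZMod 2] K) :
    Nat.card ↥(image θ (hiddenFlag E E' f) ⊓ image θ (hiddenFlag E E' g)) =
      Nat.card E * Nat.card K * Nat.card {p // f p = g p} := by
  rw [← card_hiddenFlag_inf (E' := E'), ← Submodule.map_inf _ θ.injective]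
  exact (Nat.card_congr (Submodule.equivMapOfInjective _ θ.injective _).toEquiv).symm

omit [DecidableEq K] [DecidableEq E] [DecidableEq E'] in
theorem card_image (θ : Coord K E E' ≃ₗ[ZMod 2] Bits (Fin n)) (f : K →ₗ[ZMod 2] K) :
    Nat.card ↥(image θ (hiddenFlag E E' f)) = Nat.card E * Nat.card K * Nat.card K := by
  have h := card_image_inf θ f f
  rw [inf_idem] at h
  rw [h]
  simp

/-- The uniform superposition over a coset of the lower subspace in coordinates. -/
noncomputable def cosetState (θ : Coord K E E' ≃ₗ[ZMod 2] Bits (Fin n)) (k : K × K) :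
    State (Fin n) := fun x =>
  if (θ.symm x).1.2.2 = k.1 ∧ (θ.symm x).2.1 = k.2 ∧ (θ.symm x).2.2 = 0 then
    ((√(Nat.card E * Nat.card K : ℝ) : ℝ) : ℂ)⁻¹ else 0

omit [DecidableEq E] in
theorem nrm_cosetState (θ : Coord K E E' ≃ₗ[ZMod 2] Bits (Fin n)) (k : K × K) :
    nrm (cosetState θ k) = 1 := by
  have hpos : (0 : ℝ) < Nat.card E * Nat.card K := by
    exact_mod_cast Nat.mul_pos Nat.card_pos Nat.card_pos
  have : nrm (cosetState θ k) ^ 2 = 1 := by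
    rw [nrm_sq, ← θ.toEquiv.sum_comp]
    have h : ∀ c : Coord K E E', ‖cosetState θ k (θ.toEquiv c)‖ ^ 2 =
        if c.1.2.2 = k.1 ∧ c.2.1 = k.2 ∧ c.2.2 = 0 then (Nat.card E * Nat.card K : ℝ)⁻¹ else 0 := by
      intro c
      simp only [cosetState, LinearEquiv.coe_toEquiv, LinearEquiv.symm_apply_apply]
      split_ifs
      · rw [norm_inv, Complex.norm_real, Real.norm_of_nonneg (Real.sqrt_nonneg _), inv_pow,
          Real.sq_sqrt hpos.le]
      · simp
    simp only [h]
    rw [← Finset.sum_filter, Finset.sum_const, ← Fintype.card_subtype]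
    have hc : Fintype.card {c : Coord K E E' // c.1.2.2 = k.1 ∧ c.2.1 = k.2 ∧ c.2.2 = 0} =
        Nat.card E * Nat.card K := by
      rw [← Nat.card_eq_fintype_card, ← Nat.card_prod]
      refine Nat.card_congr ⟨fun c => (c.1.1.1, c.1.1.2.1),
        fun d => ⟨((d.1, d.2, k.1), k.2, 0), rfl, rfl, rfl⟩, ?_, fun _ => rfl⟩
      rintro ⟨⟨⟨e, t, p⟩, q, u⟩, h1, h2, h3⟩
      obtain rfl : p = k.1 := h1
      obtain rfl : q = k.2 := h2
      obtain rfl : u = 0 := h3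
      rfl
    rw [hc, nsmul_eq_mul, Nat.cast_mul, mul_inv_cancel₀ hpos.ne']
  nlinarith [nrm_nonneg (cosetState θ k)]

/-- The graph of `f`. -/
def graph (f : K →ₗ[ZMod 2] K) : Finset (K × K) := Finset.univ.image fun p => (p, f p)

omit [DecidableEq E] in
theorem subspaceState_image (θ : Coord K E E' ≃ₗ[ZMod 2] Bits (Fin n)) (f : K →ₗ[ZMod 2] K) :
    subspaceState (image θ (hiddenFlag E E' f)) =
      ((√(Nat.card K : ℝ) : ℝ) : ℂ)⁻¹ • ∑ k ∈ graph f, cosetState θ k := by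
  classical
  funext x
  rw [graph, Finset.sum_image (fun p _ p' _ h => (Prod.ext_iff.1 h).1)]
  have hmem : x ∈ image θ (hiddenFlag E E' f) ↔
      (θ.symm x).2.1 = f (θ.symm x).1.2.2 ∧ (θ.symm x).2.2 = 0 := by
    rw [image, Submodule.mem_map_equiv]
    rfl
  simp only [subspaceState, Pi.smul_apply, Finset.sum_apply, cosetState, smul_eq_mul, card_image,
    hmem]
  rw [Finset.sum_eq_single (θ.symm x).1.2.2]
  · simp only [true_and]
    split_ifs
    · rw [← mul_inv, ← Complex.ofReal_mul, ← Real.sqrt_mul (by positivity)]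
      push_cast
      ring_nf
    · simp
  · intro p _ hp
    rw [if_neg fun h => hp h.1.symm]
  · simp

theorem card_graph_inter (f g : K →ₗ[ZMod 2] K) :
    (graph f ∩ graph g).card = Nat.card {p // f p = g p} := by
  have : graph f ∩ graph g = (Finset.univ.filter fun p => f p = g p).image fun p => (p, f p) := by
    ext ⟨p, q⟩
    simp only [graph, Finset.mem_inter, Finset.mem_image, Finset.mem_univ, true_and, Prod.mk.injEq,
      Finset.mem_filter]
    constructor
    · rintro ⟨⟨_, rfl, rfl⟩, ⟨_, rfl, h⟩⟩
      exact ⟨_, h.symm, rfl, rfl⟩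
    · rintro ⟨_, h, rfl, rfl⟩
      exact ⟨⟨_, rfl, rfl⟩, ⟨_, rfl, h.symm⟩⟩
  rw [this, Finset.card_image_of_injective _ fun p p' h => (Prod.ext_iff.1 h).1,
    ← Fintype.card_subtype, Nat.card_eq_fintype_card]

theorem squareSet_inter (A B : Submodule (ZMod 2) (Bits (Fin n))) :
    squareSet A ∩ squareSet B = squareSet (A ⊓ B) := by
  ext y
  simp only [Finset.mem_inter, mem_squareSet, Submodule.mem_inf, forall_and]

variable {W : Type} {m : ℕ}

omit [DecidableEq E] in
/-- If nothing but the note `|A⟩` itself depends on the inner shear, then the note cannot be cloned. -/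
theorem sum_overlap_innerShear_le (w : World n) (C : Circuit n (Note n ⊕ Fin m))
    (out : Fin 2 × Fin n ↪ Note n ⊕ Fin m) (s : Bits (Fin (3 * n)))
    (θ : Coord K E E' ≃ₗ[ZMod 2] Bits (Fin n)) :
    ∑ f : K × K × K, overlap (squareSet (image θ (hiddenFlag E E' (linearized f)))) out
      (C.runIn w (noteState s (subspaceState (image θ (hiddenFlag E E' (linearized f)))))) ≤
        65 * (Fintype.card K : ℝ) ^ 2 := by
  set N : ℝ := (Fintype.card K : ℝ) with hN
  set T : ℝ := (Nat.card E * Nat.card K : ℝ) with hT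
  have hNpos : 0 < N := by
    rw [hN]
    exact_mod_cast Fintype.card_pos
  have hTpos : 0 < T := by
    rw [hT]
    exact_mod_cast Nat.mul_pos Nat.card_pos Nat.card_pos
  have hK : (Nat.card K : ℝ) = N := by rw [Nat.card_eq_fintype_card]
  have h1 : ∀ f : K × K × K, C.runIn w (noteState s (subspaceState
      (image θ (hiddenFlag E E' (linearized f))))) = ((√(Nat.card K : ℝ) : ℝ) : ℂ)⁻¹ •
        ∑ k ∈ graph (linearized f), C.runIn w (noteState s (cosetState θ k)) := by
    intro f
    rw [subspaceState_image, noteState_smul, noteState_sum, map_smul, map_sum]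
  have h2 : ‖((√(Nat.card K : ℝ) : ℝ) : ℂ)⁻¹‖ ^ 2 = N⁻¹ := by
    rw [norm_inv, Complex.norm_real, Real.norm_of_nonneg (Real.sqrt_nonneg _), inv_pow,
      Real.sq_sqrt (Nat.cast_nonneg _), hK]
  simp only [h1, overlap_smul, h2, ← Finset.mul_sum]
  have h3 := sum_overlap_le (fun f : K × K × K => graph (linearized f))
    (fun f => squareSet (image θ (hiddenFlag E E' (linearized f)))) out
    (fun k => C.runIn w (noteState s (cosetState θ k))) ((T * N) ^ 2) (65 * N ^ 3 * T ^ 2)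
    (by positivity)
    (fun f => by
      rw [card_squareSet, card_image, hT, ← hK]
      push_cast
      rfl)
    (by positivity)
    (fun f => by
      have : ∀ g : K × K × K, ((graph (linearized f) ∩ graph (linearized g)).card : ℝ) *
          ((squareSet (image θ (hiddenFlag E E' (linearized f))) ∩
            squareSet (image θ (hiddenFlag E E' (linearized g)))).card : ℝ) =
          (Nat.card {x // linearized f x = linearized g x} : ℝ) ^ 3 * T ^ 2 := fun g => by
        rw [squareSet_inter, card_graph_inter, card_squareSet, card_image_inf, hT]
        push_cast
        ring
      simp only [this, ← Finset.sum_mul]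
      exact mul_le_mul_of_nonneg_right (sum_card_linearized_cube_le f) (by positivity))
  simp only [Circuit.nrm_runIn, nrm_noteState, nrm_cosetState, one_pow, Finset.sum_const,
    Finset.card_univ, Fintype.card_prod, nsmul_eq_mul, Nat.cast_mul, mul_one] at h3
  calc _ ≤ N⁻¹ * (((T * N) ^ 2)⁻¹ * (65 * N ^ 3 * T ^ 2 * (N * N))) :=
        mul_le_mul_of_nonneg_left h3 (by positivity)
    _ = 65 * N ^ 2 := by
        field_simp

omit [Fintype E] [DecidableEq E] [Fintype E'] [DecidableEq E'] in
/-- Enlarging the primal tester and the dual tester of the adjoined note at random goes mostly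
unnoticed. -/
theorem sum_nrm_outerShear_le (O : Oracle n) (C : Circuit n (Note n ⊕ Fin m))
    (s : Bits (Fin (3 * n))) (θ : Coord K E E' ≃ₗ[ZMod 2] Bits (Fin n))
    (ψ : State (Note n ⊕ Fin m)) :
    ∑ a : K, nrm (C.runIn (O.adjoin s (image θ (upperFlag E E' (LinearMap.mulLeft (ZMod 2) a)))
        (image θ (lowerFlag E E' (LinearMap.mulLeft (ZMod 2) a)))) ψ -
      C.runIn (O.adjoin s (image θ (hiddenFlag E E' 0)) (image θ (hiddenFlag E E' 0))) ψ) ^ 2 ≤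
        4 * (C.length : ℝ) ^ 2 * nrm ψ ^ 2 := by
  refine Circuit.sum_nrm_runIn_sub_runIn _ _ ?_ C ψ
  intro g b a a' h h'
  by_contra hne
  cases g with
  | unitary k w u => exact h Iff.rfl
  | generator c r yg ys => exact h Iff.rfl
  | serialChecker c t => exact h Iff.rfl
  | primalTester c t x =>
    have key : ∀ a, ¬ ((Gate.primalTester c t x).Flips (O.adjoin s (image θ (hiddenFlag E E' 0))
        (image θ (hiddenFlag E E' 0))) b ↔ (Gate.primalTester c t x).Flips (O.adjoin s
        (image θ (upperFlag E E' (LinearMap.mulLeft (ZMod 2) a)))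
        (image θ (lowerFlag E E' (LinearMap.mulLeft (ZMod 2) a)))) b) →
        θ.symm (b ∘ x) ∈ upperFlag E E' (LinearMap.mulLeft (ZMod 2) a) ∧
          θ.symm (b ∘ x) ∉ hiddenFlag E E' 0 := by
      intro a ha
      simp only [Gate.Flips, Oracle.adjoin, image, Submodule.mem_map_equiv] at ha
      have hle := hiddenFlag_le (E := E) (E' := E') (LinearMap.mulLeft (ZMod 2) a)
      have := @hle (θ.symm (b ∘ x))
      tauto
    exact (key a h).2 (mem_hiddenFlag_of_mem_upperFlag hne (key a h).1 (key a' h').1)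
  | dualTester c t x =>
    have key : ∀ a, ¬ ((Gate.dualTester c t x).Flips (O.adjoin s (image θ (hiddenFlag E E' 0))
        (image θ (hiddenFlag E E' 0))) b ↔ (Gate.dualTester c t x).Flips (O.adjoin s
        (image θ (upperFlag E E' (LinearMap.mulLeft (ZMod 2) a)))
        (image θ (lowerFlag E E' (LinearMap.mulLeft (ZMod 2) a)))) b) →
        (∀ y ∈ image θ (lowerFlag E E' (LinearMap.mulLeft (ZMod 2) a)), y ⬝ᵥ (b ∘ x) = 0) ∧
          ¬ ∀ y ∈ image θ (hiddenFlag E E' 0), y ⬝ᵥ (b ∘ x) = 0 := by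
      intro a ha
      have hle : image θ (lowerFlag E E' (LinearMap.mulLeft (ZMod 2) a)) ≤
        image θ (hiddenFlag E E' 0) := Submodule.map_mono (lowerFlag_le _)
      have h0 : (∀ y ∈ image θ (hiddenFlag E E' 0), y ⬝ᵥ (b ∘ x) = 0) →
        ∀ y ∈ image θ (lowerFlag E E' (LinearMap.mulLeft (ZMod 2) a)), y ⬝ᵥ (b ∘ x) = 0 :=
        fun h y hy => h y (hle hy)
      simp only [Gate.Flips, Oracle.adjoin] at ha
      tauto
    refine (key a h).2 fun y hy => ?_
    have hy' := Submodule.map_mono (f := (θ : Coord K E E' →ₗ[ZMod 2] Bits (Fin n)))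
      (hiddenFlag_le_sup hne) hy
    rw [Submodule.map_sup] at hy'
    obtain ⟨y₁, h1, y₂, h2, rfl⟩ := Submodule.mem_sup.1 hy'
    rw [add_dotProduct, (key a h).1 _ h1, (key a' h').1 _ h2, add_zero]

end Concealed

/-! ### Averaging over the hidden subspace -/

section Average

variable {n m : ℕ} {K E E' : Type} [Field K] [AddCommGroup E] [AddCommGroup E']
  [Algebra (ZMod 2) K] [Module (ZMod 2) E] [Module (ZMod 2) E'] [Fintype K] [DecidableEq K]
  [Fintype E] [DecidableEq E] [Fintype E'] [DecidableEq E']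

noncomputable instance fintypeLinearEquiv {M M' : Type} [AddCommGroup M] [AddCommGroup M']
    [Module (ZMod 2) M] [Module (ZMod 2) M'] [Finite M] [Finite M'] :
    Fintype (M ≃ₗ[ZMod 2] M') :=
  have : Finite (M ≃ₗ[ZMod 2] M') :=
    Finite.of_injective (fun θ => (θ : M → M')) DFunLike.coe_injective
  Fintype.ofFinite _

theorem sum_trans {M M' M'' : Type} [AddCommGroup M] [AddCommGroup M'] [AddCommGroup M'']
    [Module (ZMod 2) M] [Module (ZMod 2) M'] [Module (ZMod 2) M''] [Finite M] [Finite M']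
    [Finite M''] (h : M ≃ₗ[ZMod 2] M') (X : (M ≃ₗ[ZMod 2] M'') → ℝ) :
    ∑ θ : M' ≃ₗ[ZMod 2] M'', X (h.trans θ) = ∑ θ, X θ :=
  Fintype.sum_equiv ⟨fun θ => h.trans θ, fun θ => h.symm.trans θ, fun θ => by ext; simp,
    fun θ => by ext; simp⟩ _ _ fun _ => rfl

/-- The success probability of a counterfeiter who receives the note `|s⟩|A⟩`, when the serial number
`s` is not produced by the generator. -/
noncomputable def concealedProb (O : Oracle n) (C : Circuit n (Note n ⊕ Fin m))
    (out : Fin 2 × Fin n ↪ Note n ⊕ Fin m) (s : Bits (Fin (3 * n)))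
    (A : Submodule (ZMod 2) (Bits (Fin n))) : ℝ :=
  overlap (squareSet A) out (C.runIn (O.adjoin s A A) (noteState s (subspaceState A)))

theorem nrm_noteState_subspaceState {Z : Type} [Fintype Z] [DecidableEq Z]
    (s : Bits (Fin (3 * n))) (A : Submodule (ZMod 2) (Bits (Fin n))) :
    nrm (noteState (Z := Z) s (subspaceState A)) = 1 := by
  have h : nrm (noteState (Z := Z) s (subspaceState A)) ^ 2 = 1 := by
    rw [nrm_noteState, nrm_sq, sum_normSq_subspaceState]
  exact (pow_eq_one_iff_of_nonneg (nrm_nonneg _) two_ne_zero).1 h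

omit [DecidableEq E] in
/-- For a random hidden subspace, counterfeiting a note that the generator does not produce is
hopeless. First the testers are replaced by those of the outer subspaces of a flag, at a cost that is
averaged over the outer shears; then nothing but the note depends on the inner shears. -/
theorem sum_concealedProb_le (O : Oracle n) (C : Circuit n (Note n ⊕ Fin m))
    (out : Fin 2 × Fin n ↪ Note n ⊕ Fin m) (s : Bits (Fin (3 * n))) :
    ∑ θ : Coord K E E' ≃ₗ[ZMod 2] Bits (Fin n),
      concealedProb O C out s (image θ (hiddenFlag E E' 0)) ≤
        Fintype.card (Coord K E E' ≃ₗ[ZMod 2] Bits (Fin n)) *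
          ((130 + 8 * (C.length : ℝ) ^ 2) / Fintype.card K) := by
  set N : ℝ := (Fintype.card K : ℝ) with hN
  set Θ : ℝ := (Fintype.card (Coord K E E' ≃ₗ[ZMod 2] Bits (Fin n)) : ℝ) with hΘ
  have hNpos : 0 < N := by
    rw [hN]
    exact_mod_cast Fintype.card_pos
  let X : (Coord K E E' ≃ₗ[ZMod 2] Bits (Fin n)) → ℝ := fun θ =>
    overlap (squareSet (image θ (hiddenFlag E E' 0))) out
      (C.runIn (O.adjoin s (image θ (upperFlag E E' 0)) (image θ (lowerFlag E E' 0)))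
        (noteState s (subspaceState (image θ (hiddenFlag E E' 0)))))
  let Y : (Coord K E E' ≃ₗ[ZMod 2] Bits (Fin n)) → ℝ := fun θ =>
    nrm (C.runIn (O.adjoin s (image θ (upperFlag E E' 0)) (image θ (lowerFlag E E' 0)))
        (noteState s (subspaceState (image θ (hiddenFlag E E' 0)))) -
      C.runIn (O.adjoin s (image θ (hiddenFlag E E' 0)) (image θ (hiddenFlag E E' 0)))
        (noteState s (subspaceState (image θ (hiddenFlag E E' 0))))) ^ 2
  have hX : N ^ 3 * ∑ θ, X θ ≤ Θ * (65 * N ^ 2) := by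
    have h1 : N ^ 3 * ∑ θ, X θ =
        ∑ f : K × K × K, ∑ θ : Coord K E E' ≃ₗ[ZMod 2] Bits (Fin n),
          X ((innerShear E E' (linearized f)).trans θ) := by
      simp only [sum_trans, Finset.sum_const, Finset.card_univ, Fintype.card_prod, nsmul_eq_mul,
        Nat.cast_mul]
      ring
    rw [h1, Finset.sum_comm]
    refine (Finset.sum_le_card_nsmul _ _ (65 * N ^ 2) fun θ _ => ?_).trans (le_of_eq ?_)
    · simp only [X, image_trans, map_innerShear_hiddenFlag, map_innerShear_upperFlag,
        map_innerShear_lowerFlag]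
      exact sum_overlap_innerShear_le _ C out s θ
    · rw [nsmul_eq_mul, Finset.card_univ]
  have hY : N * ∑ θ, Y θ ≤ Θ * (4 * (C.length : ℝ) ^ 2) := by
    have h1 : N * ∑ θ, Y θ =
        ∑ a : K, ∑ θ : Coord K E E' ≃ₗ[ZMod 2] Bits (Fin n),
          Y ((outerShear E E' (LinearMap.mulLeft (ZMod 2) a)).trans θ) := by
      simp only [sum_trans, Finset.sum_const, Finset.card_univ, nsmul_eq_mul]
      rfl
    rw [h1, Finset.sum_comm]
    refine (Finset.sum_le_card_nsmul _ _ (4 * (C.length : ℝ) ^ 2) fun θ _ => ?_).trans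
      (le_of_eq ?_)
    · simp only [Y, image_trans, map_outerShear_hiddenFlag, map_outerShear_upperFlag,
        map_outerShear_lowerFlag]
      refine (sum_nrm_outerShear_le O C s θ _).trans (le_of_eq ?_)
      rw [nrm_noteState_subspaceState, one_pow, mul_one]
    · rw [nsmul_eq_mul, Finset.card_univ]
  have hXY : ∀ θ : Coord K E E' ≃ₗ[ZMod 2] Bits (Fin n),
      concealedProb O C out s (image θ (hiddenFlag E E' 0)) ≤ 2 * X θ + 2 * Y θ := by
    intro θ
    have h := overlap_le_of_sub (squareSet (image θ (hiddenFlag E E' 0))) out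
      (C.runIn (O.adjoin s (image θ (hiddenFlag E E' 0)) (image θ (hiddenFlag E E' 0)))
        (noteState s (subspaceState (image θ (hiddenFlag E E' 0)))))
      (C.runIn (O.adjoin s (image θ (upperFlag E E' 0)) (image θ (lowerFlag E E' 0)))
        (noteState s (subspaceState (image θ (hiddenFlag E E' 0)))))
    have hcomm : ∀ φ χ : State (Note n ⊕ Fin m), nrm (φ - χ) = nrm (χ - φ) := fun φ χ => by
      rw [nrm, nrm, WithLp.toLp_sub, WithLp.toLp_sub, norm_sub_rev]
    rw [hcomm] at h
    exact h
  have hX' : ∑ θ, X θ ≤ Θ * 65 / N := by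
    rw [le_div_iff₀ hNpos]
    have h2 : (0 : ℝ) < N ^ 2 := by positivity
    refine le_of_mul_le_mul_left ?_ h2
    linarith
  have hY' : ∑ θ, Y θ ≤ Θ * (4 * (C.length : ℝ) ^ 2) / N := by
    rw [le_div_iff₀ hNpos]
    linarith
  calc _ ≤ ∑ θ, (2 * X θ + 2 * Y θ) := Finset.sum_le_sum fun θ _ => hXY θ
    _ = 2 * ∑ θ, X θ + 2 * ∑ θ, Y θ := by
        rw [Finset.sum_add_distrib, Finset.mul_sum, Finset.mul_sum]
    _ ≤ 2 * (Θ * 65 / N) + 2 * (Θ * (4 * (C.length : ℝ) ^ 2) / N) := by linarith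
    _ = _ := by ring

end Average

/-! ### Concealing the seed -/

section Seeds

variable {n : ℕ}

/-- A banknote generator with one additional entry, that of `none`, which is not accessible through a
seed. -/
abbrev ExtOracle (n : ℕ) : Type :=
  {G : Option (Bits (Fin n)) → (Fin (n / 2) → Bits (Fin n)) × Bits (Fin (3 * n)) //
    (∀ o, LinearIndependent (ZMod 2) (G o).1) ∧ Function.Injective fun o => (G o).2}

noncomputable instance (n : ℕ) : Fintype (ExtOracle n) := Fintype.ofFinite _

namespace ExtOracle

/-- Forget the additional entry. -/
def restrict (G : ExtOracle n) : Oracle n :=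
  ⟨fun r => G.1 (some r), fun _ => G.2.1 _, fun _ _ h => Option.some_injective _ (G.2.2 h)⟩

/-- Exchange the additional entry with that of the seed `r`. -/
def exchange (r : Bits (Fin n)) (G : ExtOracle n) : ExtOracle n :=
  ⟨fun o => G.1 (Equiv.swap none (some r) o), fun _ => G.2.1 _,
    fun _ _ h => (Equiv.swap none (some r)).injective (G.2.2 h)⟩

theorem exchange_involutive (r : Bits (Fin n)) : Function.Involutive (exchange r) := fun G => by
  apply Subtype.ext
  funext o
  simp [exchange]

/-- The additional subspace. -/
def extraSubspace (G : ExtOracle n) : Submodule (ZMod 2) (Bits (Fin n)) :=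
  Submodule.span (ZMod 2) (Set.range (G.1 none).1)

/-- The additional serial number. -/
def extraSerial (G : ExtOracle n) : Bits (Fin (3 * n)) := (G.1 none).2

theorem exchange_serial (r : Bits (Fin n)) (G : ExtOracle n) :
    (exchange r G).restrict.serial r = G.extraSerial := by
  simp [exchange, restrict, Oracle.serial, extraSerial]

theorem exchange_subspace (r : Bits (Fin n)) (G : ExtOracle n) :
    (exchange r G).restrict.subspace r = G.extraSubspace := by
  simp [exchange, restrict, Oracle.subspace, Oracle.gens, extraSubspace]

theorem exchange_of_ne {r r' : Bits (Fin n)} (h : r' ≠ r) (G : ExtOracle n) :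
    (exchange r G).restrict.1 r' = G.restrict.1 r' := by
  simp only [exchange, restrict]
  rw [Equiv.swap_apply_of_ne_of_ne (by simp) (by simpa using h)]

/-- Unless the entry of `r` has the property `Q`, the exchange adds the additional entry to the
accessible ones as far as the existence of entries with the property `Q` is concerned. -/
theorem exists_exchange (r : Bits (Fin n)) (G : ExtOracle n)
    (Q : (Fin (n / 2) → Bits (Fin n)) × Bits (Fin (3 * n)) → Prop) (hQ : ¬ Q (G.restrict.1 r)) :
    (∃ r', Q ((exchange r G).restrict.1 r')) ↔ (∃ r', Q (G.restrict.1 r')) ∨ Q (G.1 none) := by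
  have hr : (exchange r G).restrict.1 r = G.1 none := by simp [exchange, restrict]
  constructor
  · rintro ⟨r', h⟩
    by_cases hrr : r' = r
    · rw [hrr, hr] at h
      exact .inr h
    · rw [exchange_of_ne hrr] at h
      exact .inl ⟨r', h⟩
  · rintro (⟨r', h⟩ | h)
    · refine ⟨r', ?_⟩
      rw [exchange_of_ne]
      · exact h
      · rintro rfl
        exact hQ h
    · exact ⟨r, by rwa [hr]⟩

variable {m : ℕ}

/-- A genuine note can hardly be distinguished from the additional one. -/
theorem sum_nrm_exchange_le (G : ExtOracle n) (C : Circuit n (Note n ⊕ Fin m))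
    (ψ : State (Note n ⊕ Fin m)) :
    ∑ r, nrm (C.runIn (exchange r G).restrict.world ψ -
      C.runIn (G.restrict.adjoin G.extraSerial G.extraSubspace G.extraSubspace) ψ) ^ 2 ≤
        4 * (C.length : ℝ) ^ 2 * nrm ψ ^ 2 := by
  refine Circuit.sum_nrm_runIn_sub_runIn _ _ ?_ C ψ
  intro g b r r' h h'
  have inj : ∀ t : Bits (Fin (3 * n)), G.restrict.serial r = t → G.restrict.serial r' = t → r = r' :=
    fun t h h' => G.restrict.2.2 (h.trans h'.symm)
  cases g with
  | unitary k w u => exact absurd Iff.rfl h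
  | generator c w yg ys =>
    have key : ∀ r, ¬ ((Gate.generator c w yg ys).Flips (G.restrict.adjoin G.extraSerial
        G.extraSubspace G.extraSubspace) b ↔
        (Gate.generator c w yg ys).Flips (exchange r G).restrict.world b) → b ∘ w = r := by
      intro r hr
      by_contra hne
      apply hr
      simp only [Gate.Flips, Oracle.adjoin, Oracle.world, Oracle.generatorBit, Oracle.gens,
        Oracle.serial, exchange_of_ne hne]
    exact (key r h).symm.trans (key r' h')
  | serialChecker c w =>
    have key : ∀ r, ¬ ((Gate.serialChecker c w).Flips (G.restrict.adjoin G.extraSerial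
        G.extraSubspace G.extraSubspace) b ↔
        (Gate.serialChecker c w).Flips (exchange r G).restrict.world b) →
        G.restrict.serial r = b ∘ w := by
      intro r hr
      by_contra hne
      apply hr
      have := exists_exchange r G (fun p => p.2 = b ∘ w) hne
      have e : (G.1 none).2 = b ∘ w ↔ b ∘ w = G.extraSerial := eq_comm
      simp only [Gate.Flips, Oracle.adjoin, Oracle.world, Oracle.Valid, Oracle.serial]
      rw [this, e]
    exact inj _ (key r h) (key r' h')
  | primalTester c w x =>
    have key : ∀ r, ¬ ((Gate.primalTester c w x).Flips (G.restrict.adjoin G.extraSerial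
        G.extraSubspace G.extraSubspace) b ↔
        (Gate.primalTester c w x).Flips (exchange r G).restrict.world b) →
        G.restrict.serial r = b ∘ w := by
      intro r hr
      by_contra hne
      apply hr
      have := exists_exchange r G (fun p => p.2 = b ∘ w ∧
        b ∘ x ∈ Submodule.span (ZMod 2) (Set.range p.1)) fun h => hne h.1
      have e : (G.1 none).2 = b ∘ w ↔ b ∘ w = G.extraSerial := eq_comm
      simp only [Gate.Flips, Oracle.adjoin, Oracle.world, Oracle.Primal, Oracle.serial,
        Oracle.subspace, Oracle.gens]
      rw [this, e]
      rfl
    exact inj _ (key r h) (key r' h')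
  | dualTester c w x =>
    have key : ∀ r, ¬ ((Gate.dualTester c w x).Flips (G.restrict.adjoin G.extraSerial
        G.extraSubspace G.extraSubspace) b ↔
        (Gate.dualTester c w x).Flips (exchange r G).restrict.world b) →
        G.restrict.serial r = b ∘ w := by
      intro r hr
      by_contra hne
      apply hr
      have := exists_exchange r G (fun p => p.2 = b ∘ w ∧
        ∀ a ∈ Submodule.span (ZMod 2) (Set.range p.1), a ⬝ᵥ (b ∘ x) = 0) fun h => hne h.1
      have e : (G.1 none).2 = b ∘ w ↔ b ∘ w = G.extraSerial := eq_comm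
      simp only [Gate.Flips, Oracle.adjoin, Oracle.world, Oracle.Dual, Oracle.serial,
        Oracle.subspace, Oracle.gens]
      rw [this, e]
      rfl
    exact inj _ (key r h) (key r' h')

/-- The counterfeiter's success on a random genuine note is bounded by that on the additional note. -/
theorem sum_successProbAt_exchange_le (G : ExtOracle n) (C : Counterfeiter n) :
    ∑ r, C.successProbAt (exchange r G).restrict r ≤
      2 * 2 ^ n * concealedProb G.restrict C.circuit C.out G.extraSerial G.extraSubspace +
        8 * (C.circuit.length : ℝ) ^ 2 := by
  have h := sum_nrm_exchange_le G C.circuit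
    (noteState G.extraSerial (subspaceState G.extraSubspace))
  rw [nrm_noteState_subspaceState, one_pow, mul_one] at h
  have h1 : ∀ r, C.successProbAt (exchange r G).restrict r ≤
      2 * concealedProb G.restrict C.circuit C.out G.extraSerial G.extraSubspace +
      2 * nrm (C.circuit.runIn (exchange r G).restrict.world
          (noteState G.extraSerial (subspaceState G.extraSubspace)) -
        C.circuit.runIn (G.restrict.adjoin G.extraSerial G.extraSubspace G.extraSubspace)
          (noteState G.extraSerial (subspaceState G.extraSubspace))) ^ 2 := by
    intro r
    rw [C.successProbAt_eq_overlap, withZeros_banknote, exchange_serial, exchange_subspace]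
    exact overlap_le_of_sub _ _ _ _
  refine (Finset.sum_le_sum fun r _ => h1 r).trans ?_
  rw [Finset.sum_add_distrib, Finset.sum_const, Finset.card_univ, ← Finset.mul_sum]
  simp only [nsmul_eq_mul, Fintype.card_fun, ZMod.card, Fintype.card_fin, Nat.cast_pow,
    Nat.cast_ofNat]
  linarith

/-- Apply a linear automorphism to the additional generators. -/
def transform (g : Bits (Fin n) ≃ₗ[ZMod 2] Bits (Fin n)) (G : ExtOracle n) : ExtOracle n :=
  ⟨fun o => o.elim (g ∘ (G.1 none).1, (G.1 none).2) (fun r => G.1 (some r)), by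
    rintro (_ | r)
    · exact (G.2.1 none).map' _ g.ker
    · exact G.2.1 (some r), by
    have : (fun o => (Option.elim o (g ∘ (G.1 none).1, (G.1 none).2) fun r => G.1 (some r)).2) =
        fun o => (G.1 o).2 := by
      funext o
      cases o <;> rfl
    rw [this]
    exact G.2.2⟩

theorem transform_symm (g : Bits (Fin n) ≃ₗ[ZMod 2] Bits (Fin n)) (G : ExtOracle n) :
    transform g.symm (transform g G) = G := by
  apply Subtype.ext
  funext o
  cases o with
  | none =>
    refine Prod.ext ?_ rfl
    funext i
    simp [transform]
  | some r => rfl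

theorem transform_extraSubspace (g : Bits (Fin n) ≃ₗ[ZMod 2] Bits (Fin n)) (G : ExtOracle n) :
    (transform g G).extraSubspace =
      G.extraSubspace.map (g : Bits (Fin n) →ₗ[ZMod 2] Bits (Fin n)) := by
  rw [extraSubspace, extraSubspace, Submodule.map_span, ← Set.range_comp]
  rfl

theorem sum_transform (g : Bits (Fin n) ≃ₗ[ZMod 2] Bits (Fin n)) (X : ExtOracle n → ℝ) :
    ∑ G, X (transform g G) = ∑ G, X G :=
  Fintype.sum_equiv ⟨transform g, transform g.symm, transform_symm g,
    fun G => by simpa using transform_symm g.symm G⟩ _ _ fun _ => rfl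

theorem sum_exchange (r : Bits (Fin n)) (X : ExtOracle n → ℝ) :
    ∑ G, X (exchange r G) = ∑ G, X G :=
  Fintype.sum_equiv (exchange_involutive r).toPerm _ _ fun _ => rfl

theorem finrank_extraSubspace (G : ExtOracle n) :
    Module.finrank (ZMod 2) G.extraSubspace = n / 2 := by
  rw [extraSubspace, finrank_span_eq_card (G.2.1 none), Fintype.card_fin]

/-- An extended oracle is an oracle with an independent additional entry. -/
noncomputable def sigmaEquiv (n : ℕ) : ExtOracle n ≃ Σ O : Oracle n,
    {v : Fin (n / 2) → Bits (Fin n) // LinearIndependent (ZMod 2) v} ×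
      {s : Bits (Fin (3 * n)) // ∀ r, O.serial r ≠ s} where
  toFun G := ⟨G.restrict, ⟨(G.1 none).1, G.2.1 none⟩, ⟨(G.1 none).2, fun r h => by
    simpa using G.2.2 h⟩⟩
  invFun p := ⟨fun o => o.elim (p.2.1.1, p.2.2.1) p.1.1, by
    rintro (_ | r)
    · exact p.2.1.2
    · exact p.1.2.1 r, by
    rintro (_ | r) (_ | r') h
    · rfl
    · exact absurd h.symm (p.2.2.2 r')
    · exact absurd h (p.2.2.2 r)
    · exact congrArg some (p.1.2.2 h)⟩
  left_inv G := by
    apply Subtype.ext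
    funext o
    cases o <;> rfl
  right_inv p := rfl

open scoped Classical in
/-- All oracles have equally many extensions. -/
theorem exists_sum_restrict (hn : 0 < n) : ∃ κ : ℝ, 0 < κ ∧ ∀ X : Oracle n → ℝ,
    ∑ G : ExtOracle n, X G.restrict = κ * ∑ O, X O := by
  have hcard : ∀ O : Oracle n, Fintype.card {s : Bits (Fin (3 * n)) // ∀ r, O.serial r ≠ s} =
      2 ^ (3 * n) - 2 ^ n := by
    intro O
    rw [Fintype.card_subtype]
    have : Finset.univ.filter (fun s => ∀ r, O.serial r ≠ s) =
        Finset.univ \ Finset.univ.image O.serial := by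
      ext s
      simp
    rw [this, Finset.card_univ_sdiff, 
      Finset.card_image_of_injective _ (show Function.Injective O.serial from O.2.2)]
    simp [ZMod.card]
  have hlt : 2 ^ n < 2 ^ (3 * n) := Nat.pow_lt_pow_right (by norm_num) (by omega)
  have hne : Nonempty {v : Fin (n / 2) → Bits (Fin n) // LinearIndependent (ZMod 2) v} :=
    ⟨⟨_, (Classical.arbitrary (Oracle n)).2.1 0⟩⟩
  refine ⟨(Fintype.card {v : Fin (n / 2) → Bits (Fin n) // LinearIndependent (ZMod 2) v} *
    (2 ^ (3 * n) - 2 ^ n) : ℕ), ?_, fun X => ?_⟩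
  · exact_mod_cast Nat.mul_pos Fintype.card_pos (Nat.sub_pos_of_lt hlt)
  · rw [← (sigmaEquiv n).symm.sum_comp, Fintype.sum_sigma, Finset.mul_sum]
    refine Finset.sum_congr rfl fun O _ => ?_
    have : ∀ p, X ((sigmaEquiv n).symm ⟨O, p⟩).restrict = X O := fun p => rfl
    simp only [this, Finset.sum_const, Finset.card_univ, nsmul_eq_mul, Fintype.card_prod, hcard]

end ExtOracle

/-! ### The soundness error -/

theorem nonempty_linearEquiv_of_finrank {M M' : Type} [AddCommGroup M] [AddCommGroup M']
    [Module (ZMod 2) M] [Module (ZMod 2) M'] [Module.Finite (ZMod 2) M]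
    [Module.Finite (ZMod 2) M']
    (h : Module.finrank (ZMod 2) M = Module.finrank (ZMod 2) M') :
    Nonempty (M ≃ₗ[ZMod 2] M') := ⟨LinearEquiv.ofFinrankEq M M' h⟩

/-- Every subspace of dimension `⌊n/2⌋` is the hidden subspace of some coordinates. -/
theorem exists_image_hiddenFlag_eq {K : Type} [Field K] [Algebra (ZMod 2) K] [Finite K]
    (hK : Module.finrank (ZMod 2) K = n / 4) (A : Submodule (ZMod 2) (Bits (Fin n)))
    (hA : Module.finrank (ZMod 2) A = n / 2) :
    ∃ θ : Coord K (Bits (Fin (n / 2 - 2 * (n / 4)))) (Bits (Fin (n - n / 2 - 2 * (n / 4))))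
      ≃ₗ[ZMod 2] Bits (Fin n), image θ (hiddenFlag _ _ 0) = A := by
  obtain ⟨A', hA'⟩ := A.exists_isCompl
  have hfin : Module.finrank (ZMod 2) A' = n - n / 2 := by
    have := Submodule.finrank_add_eq_of_isCompl hA'
    rw [hA, Module.finrank_fintype_fun_eq_card, Fintype.card_fin] at this
    omega
  have : Module.Finite (ZMod 2) K := Module.Finite.of_finite
  obtain ⟨e⟩ : Nonempty ((Bits (Fin (n / 2 - 2 * (n / 4))) × K × K) ≃ₗ[ZMod 2] A) :=
    nonempty_linearEquiv_of_finrank (by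
      rw [Module.finrank_prod, Module.finrank_prod, hK, hA, Module.finrank_fintype_fun_eq_card,
        Fintype.card_fin]
      omega)
  obtain ⟨e'⟩ : Nonempty ((K × K × Bits (Fin (n - n / 2 - 2 * (n / 4)))) ≃ₗ[ZMod 2] A') :=
    nonempty_linearEquiv_of_finrank (by
      rw [Module.finrank_prod, Module.finrank_prod, hK, hfin, Module.finrank_fintype_fun_eq_card,
        Fintype.card_fin]
      omega)
  refine ⟨(e.prodCongr e').trans (Submodule.prodEquivOfIsCompl A A' hA'), ?_⟩
  ext x
  rw [image, Submodule.mem_map_equiv]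
  have h1 : ∀ c : Coord K (Bits (Fin (n / 2 - 2 * (n / 4))))
      (Bits (Fin (n - n / 2 - 2 * (n / 4)))), c ∈ hiddenFlag _ _ 0 ↔ c.2 = 0 := fun c => by
    constructor
    · rintro ⟨h, h'⟩
      exact Prod.ext h h'
    · intro h
      exact ⟨by rw [h]; rfl, by rw [h]; rfl⟩
  rw [h1, ← Submodule.prodEquivOfIsCompl_symm_apply_snd_eq_zero A A' hA']
  exact e'.symm.map_eq_zero_iff

/-- The additional note cannot be counterfeited, on average over all extended oracles: the additional
subspace may be moved by a random linear automorphism. -/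
theorem sum_concealedProb_extOracle_le {K : Type} [Field K] [Algebra (ZMod 2) K] [Fintype K]
    [DecidableEq K] (hK : Module.finrank (ZMod 2) K = n / 4) {m : ℕ}
    (C : Circuit n (Note n ⊕ Fin m)) (out : Fin 2 × Fin n ↪ Note n ⊕ Fin m) :
    ∑ G : ExtOracle n, concealedProb G.restrict C out G.extraSerial G.extraSubspace ≤
      Fintype.card (ExtOracle n) * ((130 + 8 * (C.length : ℝ) ^ 2) / Fintype.card K) := by
  set Γ := Bits (Fin n) ≃ₗ[ZMod 2] Bits (Fin n)
  have hΓ : (0 : ℝ) < Fintype.card Γ := by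
    have : Nonempty Γ := ⟨LinearEquiv.refl _ _⟩
    exact_mod_cast Fintype.card_pos
  refine le_of_mul_le_mul_left ?_ hΓ
  have h1 : (Fintype.card Γ : ℝ) *
      ∑ G : ExtOracle n, concealedProb G.restrict C out G.extraSerial G.extraSubspace =
      ∑ g : Γ, ∑ G : ExtOracle n, concealedProb (G.transform g).restrict C out
        (G.transform g).extraSerial (G.transform g).extraSubspace := by
    have h := fun g : Γ => ExtOracle.sum_transform g fun G =>
      concealedProb G.restrict C out G.extraSerial G.extraSubspace
    simp only [h, Finset.sum_const, Finset.card_univ, nsmul_eq_mul]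
  rw [h1, Finset.sum_comm, mul_left_comm, ← nsmul_eq_mul, ← Finset.card_univ]
  refine Finset.sum_le_card_nsmul _ _ _ fun G _ => ?_
  obtain ⟨θ₀, hθ₀⟩ := exists_image_hiddenFlag_eq hK G.extraSubspace G.finrank_extraSubspace
  have h2 : ∀ g : Γ, concealedProb (G.transform g).restrict C out
        (G.transform g).extraSerial (G.transform g).extraSubspace =
      concealedProb G.restrict C out G.extraSerial
        (image (θ₀.trans g) (hiddenFlag _ _ 0)) := fun g => by
    rw [ExtOracle.transform_extraSubspace, ← hθ₀, image, image, ← Submodule.map_comp]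
    rfl
  have hcard : Fintype.card Γ = Fintype.card (Coord K (Bits (Fin (n / 2 - 2 * (n / 4))))
      (Bits (Fin (n - n / 2 - 2 * (n / 4)))) ≃ₗ[ZMod 2] Bits (Fin n)) :=
    Fintype.card_congr ⟨fun g => θ₀.trans g, fun θ => θ₀.symm.trans θ,
      fun g => by ext; simp, fun θ => by ext; simp⟩
  simp only [h2]
  rw [sum_trans θ₀ fun θ => concealedProb G.restrict C out G.extraSerial
    (image θ (hiddenFlag _ _ 0)), hcard]
  exact sum_concealedProb_le _ _ _ _

/-- The explicit bound on the success probability; the field of the shears is `𝔽_{2^⌊n/4⌋}`. -/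
theorem successProb_le (hn : 4 ≤ n) (C : Counterfeiter n) :
    C.successProb ≤ (260 + 24 * (C.circuit.length : ℝ) ^ 2) / 2 ^ (n / 4) := by
  obtain ⟨κ, hκ, hsum⟩ := ExtOracle.exists_sum_restrict (n := n) (by omega)
  have hn4 : n / 4 ≠ 0 := by omega
  have : Fact (Nat.Prime 2) := ⟨Nat.prime_two⟩
  let K := GaloisField 2 (n / 4)
  have : Fintype K := Fintype.ofFinite K
  have : DecidableEq K := Classical.decEq K
  have hK : Module.finrank (ZMod 2) K = n / 4 := GaloisField.finrank 2 hn4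
  have hcK : (Fintype.card K : ℝ) = 2 ^ (n / 4) := by
    rw [← Nat.card_eq_fintype_card, GaloisField.card 2 _ hn4]
    norm_cast
  set t : ℝ := (C.circuit.length : ℝ)
  set M : ℝ := (Fintype.card (ExtOracle n) : ℝ)
  have hM : M = κ * Fintype.card (Oracle n) := by
    have := hsum fun _ => 1
    simpa using this
  have h1 : ∑ G : ExtOracle n, ∑ r, C.successProbAt G.restrict r =
      ∑ G : ExtOracle n, ∑ r, C.successProbAt (G.exchange r).restrict r := by
    rw [Finset.sum_comm, Finset.sum_comm (s := (Finset.univ : Finset (ExtOracle n)))]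
    refine Finset.sum_congr rfl fun r _ => ?_
    exact (ExtOracle.sum_exchange r fun G => C.successProbAt G.restrict r).symm
  have h2 := hsum fun O => ∑ r, C.successProbAt O r
  have h3 : ∑ G : ExtOracle n, ∑ r, C.successProbAt (G.exchange r).restrict r ≤
      2 * 2 ^ n * (M * ((130 + 8 * t ^ 2) / 2 ^ (n / 4))) + M * (8 * t ^ 2) := by
    refine (Finset.sum_le_sum fun G _ => G.sum_successProbAt_exchange_le C).trans ?_
    rw [Finset.sum_add_distrib, ← Finset.mul_sum, Finset.sum_const, nsmul_eq_mul, Finset.card_univ]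
    have := sum_concealedProb_extOracle_le hK C.circuit C.out
    rw [hcK] at this
    gcongr
  have hO : (0 : ℝ) < Fintype.card (Oracle n) := by exact_mod_cast Fintype.card_pos
  have h2n : (0 : ℝ) < 2 ^ n := by positivity
  have h2n4 : (0 : ℝ) < 2 ^ (n / 4) := by positivity
  have hle : (2 : ℝ) ^ (n / 4) ≤ 2 ^ n := pow_le_pow_right₀ (by norm_num) (by omega)
  rw [Counterfeiter.successProb, div_le_iff₀ (by positivity)]
  refine le_of_mul_le_mul_left ?_ hκ
  rw [← h2, h1]
  refine h3.trans ?_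
  rw [hM]
  have h4 : 8 * t ^ 2 ≤ 8 * t ^ 2 / 2 ^ (n / 4) * 2 ^ n := by
    rw [div_mul_eq_mul_div, le_div_iff₀ h2n4]
    gcongr
  calc _ ≤ 2 * 2 ^ n * (κ * Fintype.card (Oracle n) * ((130 + 8 * t ^ 2) / 2 ^ (n / 4))) +
        κ * Fintype.card (Oracle n) * (8 * t ^ 2 / 2 ^ (n / 4) * 2 ^ n) := by gcongr
    _ = _ := by ring

open Filter Topology Polynomial in
theorem tendsto_polynomial_mul_pow (q : ℝ[X]) {ρ : ℝ} (h0 : 0 ≤ ρ) (h1 : ρ < 1) :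
    Tendsto (fun n : ℕ => q.eval (n : ℝ) * ρ ^ n) atTop (𝓝 0) := by
  induction q using Polynomial.induction_on' with
  | add p q hp hq => simpa [add_mul] using hp.add hq
  | monomial k a =>
    have h := (tendsto_pow_const_mul_const_pow_of_abs_lt_one k
      (by rwa [abs_of_nonneg h0] : |ρ| < 1)).const_mul a
    simpa [mul_assoc] using h

open Filter Topology in
/-- The soundness error is at most `2^(-n/8)`: of the bound `q(n) / 2^⌊n/4⌋`, with a polynomial `q`, half
of the exponent absorbs `q`. -/
theorem hasSoundnessError :
    HasSoundnessError fun n => (2 : ℝ) ^ (-((1 / 8 : ℝ) * (n : ℝ))) := by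
  intro p
  have hρ1 : (2 : ℝ) ^ (-(1 / 8 : ℝ)) < 1 :=
    Real.rpow_lt_one_of_one_lt_of_neg (by norm_num) (by norm_num)
  have hlim := tendsto_polynomial_mul_pow (520 + 48 * (p.map (Nat.castRingHom ℝ)) ^ 2)
    (Real.rpow_nonneg (by norm_num) _) hρ1
  filter_upwards [hlim.eventually_le_const one_pos, eventually_ge_atTop 4] with n h1 hn C hC
  have hp : (C.circuit.length : ℝ) ≤ (p.eval n : ℕ) := by exact_mod_cast hC
  have hev : (p.map (Nat.castRingHom ℝ)).eval (n : ℝ) = (p.eval n : ℕ) := by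
    rw [Polynomial.eval_natCast_map]
    rfl
  simp only [Polynomial.eval_add, Polynomial.eval_mul, Polynomial.eval_pow, hev,
    Polynomial.eval_ofNat] at h1
  rw [← Real.rpow_natCast (2 ^ (-(1 / 8 : ℝ))) n, ← Real.rpow_mul (by norm_num)] at h1
  set t : ℝ := ((p.eval n : ℕ) : ℝ)
  set x : ℝ := (2 : ℝ) ^ (-((1 / 8 : ℝ) * (n : ℝ)))
  have hx : (2 : ℝ) ^ (-(1 / 8) * (n : ℝ)) = x := by
    congr 1
    ring
  rw [hx] at h1
  have hx0 : 0 < x := Real.rpow_pos_of_pos (by norm_num) _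
  -- `2 ^ ⌊n/4⌋ ≥ 2 ^ (n/4 - 1)`
  have hfloor : (1 : ℝ) / 2 ^ (n / 4) ≤ 2 * (x * x) := by
    have h2 : (n : ℝ) / 4 - 1 ≤ ((n / 4 : ℕ) : ℝ) := by
      have : n ≤ 4 * (n / 4) + 4 := by omega
      have : (n : ℝ) ≤ 4 * ((n / 4 : ℕ) : ℝ) + 4 := by exact_mod_cast this
      linarith
    have h3 : x * x = (2 : ℝ) ^ (-(n : ℝ) / 4) := by
      rw [← Real.rpow_add (by norm_num)]
      congr 1
      ring
    have h4 : (2 : ℝ) * (2 : ℝ) ^ (-(n : ℝ) / 4) = (2 : ℝ) ^ (1 + -(n : ℝ) / 4) := by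
      rw [Real.rpow_add (by norm_num), Real.rpow_one]
    rw [h3, h4, one_div, ← Real.rpow_natCast, ← Real.rpow_neg (by norm_num)]
    exact Real.rpow_le_rpow_of_exponent_le (by norm_num) (by linarith)
  calc C.successProb ≤ (260 + 24 * (C.circuit.length : ℝ) ^ 2) / 2 ^ (n / 4) := successProb_le hn C
    _ ≤ (260 + 24 * t ^ 2) * (1 / 2 ^ (n / 4)) := by
        rw [mul_one_div]
        gcongr
    _ ≤ (260 + 24 * t ^ 2) * (2 * (x * x)) := by gcongr
    _ = (520 + 48 * t ^ 2) * x * x := by ring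
    _ ≤ 1 * x := by gcongr
    _ = x := one_mul x

end Seeds

/-! ### Reversible classical computation -/

section Classical

variable {n : ℕ} {W : Type} [DecidableEq W]

open scoped Classical in
/-- The basis state `|b⟩`. -/
noncomputable def ket (b : Bits W) : State W := fun b' => if b' = b then 1 else 0

/-- The permutation of basis states by an involution, as a unitary matrix. -/
noncomputable def involutionMatrix {k : ℕ} (f : Bits (Fin k) → Bits (Fin k))
    (hf : Function.Involutive f) : Matrix.unitaryGroup (Bits (Fin k)) ℂ :=
  ⟨Matrix.of fun x y => if y = f x then 1 else 0, by
    rw [Matrix.mem_unitaryGroup_iff]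
    ext x y
    rw [Matrix.mul_apply, Finset.sum_eq_single (f x)]
    · by_cases h : x = y
      · subst h; simp [Matrix.star_apply]
      · have : f x ≠ f y := fun h' => h (hf.injective h')
        simp [h, Matrix.star_apply, this]
    · intro z _ hz
      simp [hz]
    · simp⟩

theorem extend_update_comp {J : Type} [DecidableEq J] {w : J → W} (hw : w.Injective) (i : J)
    (v : ZMod 2) (b : Bits W) :
    Function.extend w (Function.update (b ∘ w) i v) b = Function.update b (w i) v := by
  refine extend_eq hw (fun j => ?_) fun x hx => ?_
  · by_cases h : j = i
    · subst h; simp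
    · rw [Function.update_of_ne h, Function.update_of_ne (fun h' => h (hw h'))]
      rfl
  · rw [Function.update_of_ne (hx i).symm]

omit [DecidableEq W] in
theorem act_involutionMatrix (wd : World n) {k : ℕ} (w : Fin k ↪ W)
    (f : Bits (Fin k) → Bits (Fin k)) (hf : Function.Involutive f) (ψ : State W) (b : Bits W) :
    (Gate.unitary k w (involutionMatrix f hf)).act wd ψ b = ψ (Function.extend w (f (b ∘ w)) b) := by
  rw [Gate.act_unitary, Finset.sum_eq_single (f (b ∘ w))]
  · simp [involutionMatrix]
  · intro c _ hc
    simp [involutionMatrix, hc]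
  · simp

/-- A single wire. -/
def singleWire (i : W) : Fin 1 ↪ W := ⟨fun _ => i, fun _ _ _ => Subsingleton.elim _ _⟩

theorem involutive_not :
    Function.Involutive fun x : Bits (Fin 1) => Function.update x 0 (x 0 + 1) := fun x => by
  simp [add_assoc, bit_one_add_one]

theorem involutive_toffoli :
    Function.Involutive fun x : Bits (Fin 3) => Function.update x 2 (x 2 + x 0 * x 1) := fun x => by
  have : ∀ a : ZMod 2, a + a = 0 := by decide
  simp [add_assoc, this]

/-- The NOT gate. -/
noncomputable def notGate (i : W) : Gate n W :=
  .unitary 1 (singleWire i) (involutionMatrix _ involutive_not)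

theorem act_notGate (wd : World n) (i : W) (b : Bits W) :
    (notGate i : Gate n W).act wd (ket b) = ket (Function.update b i (b i + 1)) := by
  funext b'
  rw [notGate, act_involutionMatrix, extend_update_comp (Function.Embedding.injective _)]
  have e0 : (b' ∘ singleWire i) 0 = b' i := rfl
  have e1 : singleWire i 0 = i := rfl
  rw [e0, e1]
  simp only [ket]
  congr 1
  apply propext
  constructor
  · rintro rfl
    simp [add_assoc, bit_one_add_one]
  · rintro rfl
    simp [add_assoc, bit_one_add_one]

/-- An instruction `(x, y, z)` adds the product of the bits `x` and `y` to the bit `z`. -/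
def step (b : Bits W) (t : W × W × W) : Bits W :=
  Function.update b t.2.2 (b t.2.2 + b t.1 * b t.2.1)

/-- The effect of a list of instructions on bits. -/
def exec (l : List (W × W × W)) (b : Bits W) : Bits W := l.foldl step b

/-- The wires of an instruction are distinct. -/
def Proper (t : W × W × W) : Prop := t.1 ≠ t.2.1 ∧ t.2.1 ≠ t.2.2 ∧ t.1 ≠ t.2.2

/-- The wires of a proper instruction. -/
def tripleWires (t : W × W × W) (h : Proper t) : Fin 3 ↪ W where
  toFun := ![t.1, t.2.1, t.2.2]
  inj' := by
    obtain ⟨h1, h2, h3⟩ := h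
    intro i j hij
    fin_cases i <;> fin_cases j <;> simp_all [eq_comm]

open scoped Classical in
/-- The Toffoli gate of an instruction; improper instructions are skipped. -/
noncomputable def toffoli (t : W × W × W) : Circuit n W :=
  if h : Proper t then [.unitary 3 (tripleWires t h) (involutionMatrix _ involutive_toffoli)] else []

theorem runIn_toffoli (wd : World n) (t : W × W × W) (h : Proper t) (b : Bits W) :
    Circuit.runIn wd (toffoli t) (ket b) = ket (step b t) := by
  have h2 : ∀ a : ZMod 2, a + a = 0 := by decide
  obtain ⟨hp1, hp2, hp3⟩ := id h
  funext b'
  rw [toffoli, dif_pos h, Circuit.runIn_cons, Circuit.runIn_nil, act_involutionMatrix,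
    extend_update_comp (Function.Embedding.injective _)]
  have e0 : (b' ∘ tripleWires t h) 0 = b' t.1 := rfl
  have e1 : (b' ∘ tripleWires t h) 1 = b' t.2.1 := rfl
  have e2 : (b' ∘ tripleWires t h) 2 = b' t.2.2 := rfl
  have e3 : tripleWires t h 2 = t.2.2 := rfl
  rw [e0, e1, e2, e3]
  simp only [ket, step]
  congr 1
  apply propext
  constructor
  · rintro rfl
    simp [Function.update_of_ne hp2, Function.update_of_ne hp3, add_assoc, h2]
  · rintro rfl
    simp [Function.update_of_ne hp2, Function.update_of_ne hp3, add_assoc, h2]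

theorem runIn_flatMap_toffoli (wd : World n) (l : List (W × W × W)) (hl : ∀ t ∈ l, Proper t)
    (b : Bits W) : Circuit.runIn wd (l.flatMap toffoli) (ket b) = ket (exec l b) := by
  induction l generalizing b with
  | nil => rfl
  | cons t l ih =>
    rw [List.flatMap_cons, Circuit.runIn_append, runIn_toffoli wd t (hl t (by simp)),
      ih (fun t ht => hl t (by simp [ht]))]
    rfl

theorem runIn_map_notGate (wd : World n) (l : List W) (hl : l.Nodup) (b : Bits W) :
    Circuit.runIn wd (l.map notGate) (ket b) =
      ket fun c => if c ∈ l then b c + 1 else b c := by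
  induction l generalizing b with
  | nil => simp
  | cons i l ih =>
    obtain ⟨hi, hl⟩ := List.nodup_cons.1 hl
    rw [List.map_cons, Circuit.runIn_cons, act_notGate, ih hl]
    congr 1
    funext c
    by_cases hc : c = i
    · subst hc
      simp [hi]
    · simp [hc]

omit [DecidableEq W] in
theorem isElementary_involution {k : ℕ} (hk : k ≤ 3) (w : Fin k ↪ W)
    (f : Bits (Fin k) → Bits (Fin k)) (hf : Function.Involutive f) :
    (Gate.unitary (n := n) k w (involutionMatrix f hf)).IsElementary := by
  refine ⟨hk, fun x y => ?_⟩
  simp only [involutionMatrix, Matrix.of_apply]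
  split_ifs <;> simp

omit [DecidableEq W] in
theorem length_toffoli_le (t : W × W × W) : (toffoli (n := n) t).length ≤ 1 := by
  unfold toffoli
  split_ifs <;> simp

omit [DecidableEq W] in
theorem isElementary_toffoli (t : W × W × W) : ∀ g ∈ toffoli (n := n) t, g.IsElementary := by
  intro g hg
  unfold toffoli at hg
  split_ifs at hg
  · rw [List.mem_singleton.1 hg]
    exact isElementary_involution le_rfl _ _ _
  · simp at hg

omit [DecidableEq W] in
theorem length_flatMap_toffoli_le (l : List (W × W × W)) :
    (l.flatMap (toffoli (n := n))).length ≤ l.length := by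
  induction l with
  | nil => simp
  | cons t l ih =>
    rw [List.flatMap_cons, List.length_append, List.length_cons]
    have := length_toffoli_le (n := n) t
    omega

theorem exec_append (l l' : List (W × W × W)) (b : Bits W) :
    exec (l ++ l') b = exec l' (exec l b) := List.foldl_append ..

theorem exec_of_forall_ne (l : List (W × W × W)) (b : Bits W) (c : W)
    (h : ∀ t ∈ l, t.2.2 ≠ c) : exec l b c = b c := by
  induction l generalizing b with
  | nil => rfl
  | cons t l ih =>
    have h1 : exec (t :: l) b = exec l (step b t) := rfl
    rw [h1, ih _ fun t' ht => h t' (by simp [ht]), step,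
      Function.update_of_ne (h t (by simp)).symm]

/-- Bits outside `U` do not depend on bits in `U` if no instruction carries over any. -/
theorem exec_congr (U : W → Prop) (l : List (W × W × W))
    (h : ∀ t ∈ l, ¬ U t.2.2 → ¬ U t.1 ∧ ¬ U t.2.1) (b b' : Bits W)
    (hb : ∀ c, ¬ U c → b c = b' c) (c : W) (hc : ¬ U c) : exec l b c = exec l b' c := by
  induction l generalizing b b' with
  | nil => exact hb c hc
  | cons t l ih =>
    refine ih (fun t' ht => h t' (by simp [ht])) _ _ fun c hc => ?_
    by_cases hct : c = t.2.2
    · subst hct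
      obtain ⟨h1, h2⟩ := h t (by simp) hc
      simp [step, hb _ hc, hb _ h1, hb _ h2]
    · simp [step, Function.update_of_ne hct, hb c hc]

/-- Instructions that may be executed in any order add up. -/
theorem exec_parallel (l : List (W × W × W))
    (h : ∀ t ∈ l, ∀ t' ∈ l, t.2.2 ≠ t'.1 ∧ t.2.2 ≠ t'.2.1) (b : Bits W) (c : W) :
    exec l b c = b c + (l.map fun t => if t.2.2 = c then b t.1 * b t.2.1 else 0).sum := by
  induction l generalizing b with
  | nil => simp [exec]
  | cons t l ih =>
    have h1 : exec (t :: l) b = exec l (step b t) := rfl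
    rw [h1, ih fun t' ht t'' ht' => h t' (by simp [ht]) t'' (by simp [ht'])]
    have h2 : (l.map fun t' => if t'.2.2 = c then step b t t'.1 * step b t t'.2.1 else 0) =
        l.map fun t' => if t'.2.2 = c then b t'.1 * b t'.2.1 else 0 := by
      refine List.map_congr_left fun t' ht' => ?_
      obtain ⟨h3, h4⟩ := h t (by simp) t' (by simp [ht'])
      rw [step, Function.update_of_ne h3.symm, Function.update_of_ne h4.symm]
    rw [h2, List.map_cons, List.sum_cons, ← add_assoc]
    congr 1
    by_cases hc : t.2.2 = c
    · subst hc; simp [step]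
    · rw [if_neg hc, step, Function.update_of_ne (Ne.symm hc), add_zero]

variable {κ ι : Type} [Fintype κ] [Fintype ι]

/-- The instructions that add the inner product of the bits `x k` and `y k` to the bit `z k`,
for all `k`. -/
noncomputable def phase (x y : κ → ι → W) (z : κ → W) : List (W × W × W) :=
  (Finset.univ : Finset (κ × ι)).toList.map fun p => (x p.1 p.2, y p.1 p.2, z p.1)

omit [DecidableEq W] in
theorem mem_phase {x y : κ → ι → W} {z : κ → W} {t : W × W × W} :
    t ∈ phase x y z ↔ ∃ k i, (x k i, y k i, z k) = t := by
  simp [phase]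

theorem exec_phase {x y : κ → ι → W} {z : κ → W} (hz : z.Injective) (hx : ∀ k k' i, z k ≠ x k' i)
    (hy : ∀ k k' i, z k ≠ y k' i) (b : Bits W) (k : κ) :
    exec (phase x y z) b (z k) = b (z k) + ∑ i, b (x k i) * b (y k i) := by
  classical
  rw [exec_parallel]
  · congr 1
    rw [phase, List.map_map, Finset.sum_map_toList, Fintype.sum_prod_type, Finset.sum_eq_single k]
    · simp
    · intro k' _ hk
      simp [hz.ne hk]
    · simp
  · intro t ht t' ht'
    obtain ⟨k, i, rfl⟩ := mem_phase.1 ht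
    obtain ⟨k', i', rfl⟩ := mem_phase.1 ht'
    exact ⟨hx _ _ _, hy _ _ _⟩

theorem exec_phase_of_ne {x y : κ → ι → W} {z : κ → W} (b : Bits W) (c : W) (hc : ∀ k, z k ≠ c) :
    exec (phase x y z) b c = b c := by
  refine exec_of_forall_ne _ _ _ fun t ht => ?_
  obtain ⟨k, i, rfl⟩ := mem_phase.1 ht
  exact hc k

/-! ### Preparing uniform superpositions and evaluating the generator -/

variable {J : Type} [Fintype J] [DecidableEq J]

omit [DecidableEq W] in
theorem runIn_hadamard_ket (wd : World n) (e : J ↪ W) (l : List J) (hl : l.Nodup)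
    (hl' : ∀ j, j ∈ l) (b : Bits W) (hb : b ∘ e = 0) (b' : Bits W) :
    Circuit.runIn wd (l.map fun j => (hadamard (e j) : Gate n W)) (ket b) b' =
      (((√2 : ℝ) : ℂ)⁻¹) ^ Fintype.card J * ket b (Function.extend e 0 b') := by
  rw [runIn_map_hadamard _ _ _ hl hl', Finset.sum_eq_single 0]
  · simp
  · intro y _ hy
    have : Function.extend e y b' ≠ b := fun h => by
      apply hy
      rw [← hb, ← h, extend_comp' e.injective]
    simp [ket, this]
  · simp

omit [DecidableEq W] in
/-- Hadamard gates turn zeros into a uniform superposition. -/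
theorem runIn_hadamard_ket_eq_sum (wd : World n) (e : J ↪ W) (l : List J) (hl : l.Nodup)
    (hl' : ∀ j, j ∈ l) (b : Bits W) (hb : b ∘ e = 0) :
    Circuit.runIn wd (l.map fun j => (hadamard (e j) : Gate n W)) (ket b) =
      (((√2 : ℝ) : ℂ)⁻¹) ^ Fintype.card J • ∑ y, ket (Function.extend e y b) := by
  funext b'
  rw [runIn_hadamard_ket wd e l hl hl' b hb, Pi.smul_apply, smul_eq_mul, Finset.sum_apply]
  congr 1
  rw [Finset.sum_eq_single (b' ∘ e)]
  · simp only [ket]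
    congr 1
    apply propext
    constructor
    · rintro rfl
      rw [extend_extend e.injective, extend_comp_self e.injective]
    · intro h
      rw [h, extend_extend e.injective, ← hb, extend_comp_self e.injective]
  · intro y _ hy
    have : b' ≠ Function.extend e y b := fun h => by
      apply hy
      rw [h, extend_comp' e.injective]
    simp [ket, this]
  · simp

omit [DecidableEq W] in
/-- A phase query between Hadamard transforms evaluates the queried function. -/
theorem runIn_hadamard_phase_hadamard (wd : World n) (e : J ↪ W) (l : List J) (hl : l.Nodup)
    (hl' : ∀ j, j ∈ l) (g : Gate n W) (b : Bits W) (hb : b ∘ e = 0) (v : Bits J)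
    (hg : ∀ ψ y, g.act wd ψ (Function.extend e y b) = sgn (y ⬝ᵥ v) * ψ (Function.extend e y b))
    (hg' : ∀ ψ b', ψ b' = 0 → g.act wd ψ b' = 0) :
    Circuit.runIn wd ((l.map fun j => (hadamard (e j) : Gate n W)) ++ [g] ++
      l.map fun j => (hadamard (e j) : Gate n W)) (ket b) = ket (Function.extend e v b) := by
  classical
  funext b'
  rw [Circuit.runIn_append, Circuit.runIn_append, Circuit.runIn_cons, Circuit.runIn_nil,
    runIn_map_hadamard _ _ _ hl hl']
  set φ := Circuit.runIn wd (l.map fun j => (hadamard (e j) : Gate n W)) (ket b)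
  have hφ : ∀ b', φ b' = (((√2 : ℝ) : ℂ)⁻¹) ^ Fintype.card J * ket b (Function.extend e 0 b') :=
    runIn_hadamard_ket wd e l hl hl' b hb
  have hiff : b' = Function.extend e v b ↔ Function.extend e 0 b' = b ∧ b' ∘ e + v = 0 := by
    have h2 : b' ∘ e + v = 0 ↔ b' ∘ e = v := by
      rw [add_eq_zero_iff_eq_neg, show -v = v from funext fun i => CharTwo.neg_eq (v i)]
    rw [h2]
    constructor
    · rintro rfl
      rw [extend_extend e.injective, extend_comp' e.injective, ← hb, extend_comp_self e.injective]
      exact ⟨rfl, rfl⟩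
    · rintro ⟨h, rfl⟩
      rw [← h, extend_extend e.injective, extend_comp_self e.injective]
  by_cases h : Function.extend e 0 b' = b
  · have h1 : ∀ y, Function.extend e y b' = Function.extend e y b := fun y => by
      rw [← h, extend_extend e.injective]
    have h3 : ∀ y, sgn ((b' ∘ e) ⬝ᵥ y) * g.act wd φ (Function.extend e y b') =
        (((√2 : ℝ) : ℂ)⁻¹) ^ Fintype.card J * sgn (y ⬝ᵥ (b' ∘ e + v)) := fun y => by
      rw [h1, hg, hφ, extend_extend e.injective, ← h1, h, dotProduct_add, sgn_add,
        dotProduct_comm y (b' ∘ e)]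
      simp only [ket, if_true]
      ring
    simp only [h3, ← Finset.mul_sum, sum_sgn, ket, hiff, h, true_and]
    rw [← mul_assoc, ← mul_pow, inv_sqrt_two_mul_self]
    split_ifs
    · rw [← mul_pow]
      norm_num
    · simp
  · rw [Finset.sum_eq_zero]
    · simp [ket, hiff, h]
    · intro y _
      rw [hg', mul_zero]
      rw [hφ, extend_extend e.injective]
      simp [ket, h]

end Classical

/-! ### Preparing the money state -/

/-- The work qubits of the bank. -/
inductive Scratch (n : ℕ) : Type
  /-- the constant `1` -/
  | one
  /-- the seed -/
  | seed (j : Fin n)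
  /-- the generators of the hidden subspace -/
  | gen (i : Fin (n / 2)) (j : Fin n)
  /-- a matrix whose kernel is spanned by the generators treated so far -/
  | mat (a b : Fin n)
  /-- the image of the `i`-th generator under the matrix -/
  | img (i : Fin (n / 2)) (a : Fin n)
  /-- whether the first `a` entries of the image are zero -/
  | free (i : Fin (n / 2)) (a : Fin (n + 1))
  /-- the position of the first nonzero entry of the image, in unary -/
  | pivot (i : Fin (n / 2)) (a : Fin n)
  /-- a functional that is `1` on the `i`-th generator and `0` on the previous ones -/
  | dual (i : Fin (n / 2)) (a : Fin n)
  /-- the coefficients of a vector of the hidden subspace -/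
  | coeff (i : Fin (n / 2))
  deriving DecidableEq

/-- The qubits of the bank: a banknote and the work qubits. -/
abbrev BankWires (n : ℕ) : Type := Note n ⊕ Scratch n

namespace Bank

open Scratch

variable {n : ℕ}

/-- The qubits of the money state. -/
abbrev money (j : Fin n) : BankWires n := .inl (.inr j)

/-- Compute the image of the `i`-th generator under the matrix. -/
noncomputable def imagePhase (i : Fin (n / 2)) : List (BankWires n × BankWires n × BankWires n) :=
  phase (fun a b => .inr (mat a b)) (fun _ b => .inr (gen i b)) fun a => .inr (img i a)

/-- One step of the search for the first nonzero entry of the image. -/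
def pivotStep (i : Fin (n / 2)) (j : Fin n) : List (BankWires n × BankWires n × BankWires n) :=
  [(.inr (free i j.castSucc), .inr one, .inr (free i j.succ)),
    (.inr (free i j.castSucc), .inr (img i j), .inr (free i j.succ)),
    (.inr (free i j.castSucc), .inr (img i j), .inr (pivot i j))]

/-- Search for the first nonzero entry of the image. -/
def pivotPhase (i : Fin (n / 2)) : List (BankWires n × BankWires n × BankWires n) :=
  (List.finRange n).flatMap (pivotStep i)

/-- Copy the row of the matrix at the pivot. -/
noncomputable def dualPhase (i : Fin (n / 2)) : List (BankWires n × BankWires n × BankWires n) :=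
  phase (fun _ a => .inr (pivot i a)) (fun b a => .inr (mat a b)) fun b => .inr (dual i b)

/-- Add the `i`-th generator to the kernel of the matrix. -/
noncomputable def matPhase (i : Fin (n / 2)) : List (BankWires n × BankWires n × BankWires n) :=
  phase (κ := Fin n × Fin n) (ι := Unit) (fun p _ => .inr (img i p.1))
    (fun p _ => .inr (dual i p.2)) fun p => .inr (mat p.1 p.2)

/-- Add the `i`-th generator, multiplied by the `i`-th coefficient, to the money state. -/
noncomputable def moneyPhase (i : Fin (n / 2)) : List (BankWires n × BankWires n × BankWires n) :=
  phase (ι := Unit) (fun _ _ => .inr (coeff i)) (fun j _ => .inr (gen i j)) money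

/-- Erase the `i`-th coefficient. -/
noncomputable def coeffPhase (i : Fin (n / 2)) : List (BankWires n × BankWires n × BankWires n) :=
  phase (κ := Unit) (fun _ j => .inr (dual i j)) (fun _ j => money j) fun _ => .inr (coeff i)

/-- Add the `i`-th generator to the superposition of the money state. -/
noncomputable def iteration (i : Fin (n / 2)) : List (BankWires n × BankWires n × BankWires n) :=
  imagePhase i ++ pivotPhase i ++ dualPhase i ++ matPhase i ++ moneyPhase i ++ coeffPhase i

/-- Turn a superposition of coefficients into one of the vectors of the hidden subspace. -/
noncomputable def program (n : ℕ) : List (BankWires n × BankWires n × BankWires n) :=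
  (List.finRange (n / 2)).flatMap iteration

/-- A description of all instructions of the program. -/
theorem mem_program {t : BankWires n × BankWires n × BankWires n} (ht : t ∈ program n) :
    (∃ i a b, t = (.inr (mat a b), .inr (gen i b), .inr (img i a))) ∨
    (∃ i j, t ∈ pivotStep i j) ∨
    (∃ i a b, t = (.inr (pivot i a), .inr (mat a b), .inr (dual i b))) ∨
    (∃ i a b, t = (.inr (img i a), .inr (dual i b), .inr (mat a b))) ∨
    (∃ i j, t = (.inr (coeff i), .inr (gen i j), money j)) ∨
    (∃ i j, t = (.inr (dual i j), money j, .inr (coeff i))) := by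
  simp only [program, List.mem_flatMap, List.mem_finRange, true_and, iteration, List.mem_append,
    imagePhase, pivotPhase, dualPhase, matPhase, moneyPhase, coeffPhase, mem_phase] at ht
  obtain ⟨i, (((((⟨a, b, h⟩ | ⟨j, h⟩) | ⟨b, a, h⟩) | ⟨⟨a, b⟩, _, h⟩) | ⟨j, _, h⟩) | ⟨_, j, h⟩)⟩ := ht
  · exact .inl ⟨i, a, b, h.symm⟩
  · exact .inr (.inl ⟨i, j, h⟩)
  · exact .inr (.inr (.inl ⟨i, a, b, h.symm⟩))
  · exact .inr (.inr (.inr (.inl ⟨i, a, b, h.symm⟩)))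
  · exact .inr (.inr (.inr (.inr (.inl ⟨i, j, h.symm⟩))))
  · exact .inr (.inr (.inr (.inr (.inr ⟨i, j, h.symm⟩))))

theorem castSucc_ne_succ (j : Fin n) : j.castSucc ≠ j.succ := by
  simp [Fin.ext_iff]

theorem proper_of_mem_program {t : BankWires n × BankWires n × BankWires n} (ht : t ∈ program n) :
    Proper t := by
  rcases mem_program ht with ⟨i, a, b, rfl⟩ | ⟨i, j, h⟩ | ⟨i, a, b, rfl⟩ | ⟨i, a, b, rfl⟩ |
    ⟨i, j, rfl⟩ | ⟨i, j, rfl⟩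
  · simp [Proper]
  · simp only [pivotStep, List.mem_cons, List.not_mem_nil, or_false] at h
    rcases h with rfl | rfl | rfl <;> simp [Proper, castSucc_ne_succ]
  all_goals simp [Proper]

/-- The qubits that depend on the coefficients. -/
def IsData : BankWires n → Prop
  | .inl (.inr _) => True
  | .inr (coeff _) => True
  | _ => False

theorem isData_of_mem_program {t : BankWires n × BankWires n × BankWires n} (ht : t ∈ program n)
    (h0 : ¬ IsData t.2.2) : ¬ IsData t.1 ∧ ¬ IsData t.2.1 := by
  rcases mem_program ht with ⟨i, a, b, rfl⟩ | ⟨i, j, h⟩ | ⟨i, a, b, rfl⟩ | ⟨i, a, b, rfl⟩ |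
    ⟨i, j, rfl⟩ | ⟨i, j, rfl⟩
  · simp [IsData]
  · simp only [pivotStep, List.mem_cons, List.not_mem_nil, or_false] at h
    rcases h with rfl | rfl | rfl <;> simp [IsData]
  · simp [IsData]
  · simp [IsData]
  · simp [IsData] at h0
  · simp [IsData] at h0

theorem exec_program_serial (b : Bits (BankWires n)) (l : Fin (3 * n)) :
    exec (program n) b (.inl (.inl l)) = b (.inl (.inl l)) := by
  refine exec_of_forall_ne _ _ _ fun t ht => ?_
  rcases mem_program ht with ⟨i, a, b, rfl⟩ | ⟨i, j, h⟩ | ⟨i, a, b, rfl⟩ | ⟨i, a, b, rfl⟩ |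
    ⟨i, j, rfl⟩ | ⟨i, j, rfl⟩
  · simp
  · simp only [pivotStep, List.mem_cons, List.not_mem_nil, or_false] at h
    rcases h with rfl | rfl | rfl <;> simp
  all_goals simp

theorem exec_program_seed (b : Bits (BankWires n)) (j : Fin n) :
    exec (program n) b (.inr (seed j)) = b (.inr (seed j)) := by
  refine exec_of_forall_ne _ _ _ fun t ht => ?_
  rcases mem_program ht with ⟨i, a, b, rfl⟩ | ⟨i, j, h⟩ | ⟨i, a, b, rfl⟩ | ⟨i, a, b, rfl⟩ |
    ⟨i, j, rfl⟩ | ⟨i, j, rfl⟩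
  · simp
  · simp only [pivotStep, List.mem_cons, List.not_mem_nil, or_false] at h
    rcases h with rfl | rfl | rfl <;> simp
  all_goals simp

theorem exec_flatMap {W κ : Type} [DecidableEq W] (l : List κ) (f : κ → List (W × W × W))
    (b : Bits W) : exec (l.flatMap f) b = l.foldl (fun b k => exec (f k) b) b := by
  induction l generalizing b with
  | nil => rfl
  | cons k l ih => rw [List.flatMap_cons, exec_append, ih, List.foldl_cons]

/-- A loop invariant that holds initially and is preserved holds at the end. -/
theorem foldl_finRange {α : Type} (m : ℕ) (f : α → Fin m → α) (P : ℕ → α → Prop) (s : α) (h0 : P 0 s)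
    (h : ∀ (i : Fin m) s, P i s → P (i + 1) (f s i)) : P m ((List.finRange m).foldl f s) := by
  induction m generalizing P s with
  | zero => simpa using h0
  | succ m ih =>
    rw [List.finRange_succ, List.foldl_cons, List.foldl_map]
    exact ih (fun s i => f s i.succ) (fun j => P (j + 1)) _ (h 0 s h0) fun i s hs => h i.succ s hs

/-- After the search, the pivot is the position of a nonzero entry of the image, if there is one. -/
theorem exec_pivotPhase (i : Fin (n / 2)) (b : Bits (BankWires n)) (h1 : b (.inr one) = 1)
    (hf0 : b (.inr (free i 0)) = 1) (hf : ∀ j : Fin n, b (.inr (free i j.succ)) = 0)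
    (hp : ∀ j, b (.inr (pivot i j)) = 0) (hw : ∃ j, b (.inr (img i j)) ≠ 0) :
    (∑ j, exec (pivotPhase i) b (.inr (pivot i j)) * b (.inr (img i j)) = 1) ∧
    ∀ c, (∀ j : Fin n, c ≠ .inr (free i j.succ)) → (∀ j, c ≠ .inr (pivot i j)) →
      exec (pivotPhase i) b c = b c := by
  let P : ℕ → Bits (BankWires n) → Prop := fun m b' =>
    (∀ c, (∀ j : Fin n, c ≠ .inr (free i j.succ)) → (∀ j, c ≠ .inr (pivot i j)) → b' c = b c) ∧
    (∀ j : Fin n, (j : ℕ) < m → b' (.inr (free i j.succ)) = b' (.inr (free i j.castSucc)) +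
        b' (.inr (free i j.castSucc)) * b (.inr (img i j)) ∧
      b' (.inr (pivot i j)) = b' (.inr (free i j.castSucc)) * b (.inr (img i j))) ∧
    (∀ j : Fin n, m ≤ j → b' (.inr (free i j.succ)) = 0 ∧ b' (.inr (pivot i j)) = 0)
  have hP : P n (exec (pivotPhase i) b) := by
    rw [pivotPhase, exec_flatMap]
    refine foldl_finRange n _ P b ⟨fun c _ _ => rfl, fun j hj => by omega, fun j _ => ⟨hf j, hp j⟩⟩ ?_
    intro j s ⟨hs1, hs2, hs3⟩
    have hone : s (.inr one) = 1 := by rw [hs1 _ (by simp) (by simp), h1]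
    have him : ∀ j, s (.inr (img i j)) = b (.inr (img i j)) := fun j =>
      hs1 _ (by simp) (by simp)
    have hval : ∀ c, exec (pivotStep i j) s c =
        if c = .inr (free i j.succ) then s (.inr (free i j.castSucc)) +
          s (.inr (free i j.castSucc)) * b (.inr (img i j))
        else if c = .inr (pivot i j) then s (.inr (free i j.castSucc)) * b (.inr (img i j))
        else s c := by
      intro c
      obtain ⟨h3, h4⟩ := hs3 j le_rfl
      simp only [pivotStep, exec, List.foldl_cons, List.foldl_nil, step]
      by_cases hc1 : c = .inr (free i j.succ)
      · subst hc1
        simp [castSucc_ne_succ, h3, hone, him]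
      · by_cases hc2 : c = .inr (pivot i j)
        · subst hc2
          simp [castSucc_ne_succ, h4, him]
        · simp [hc1, hc2]
    refine ⟨fun c hc hc' => ?_, fun l hl => ?_, fun l hl => ?_⟩
    · rw [hval, if_neg (hc j), if_neg (hc' j), hs1 c hc hc']
    · have hcs : exec (pivotStep i j) s (.inr (free i l.castSucc)) =
          s (.inr (free i l.castSucc)) := by
        rw [hval, if_neg, if_neg (by simp)]
        simp only [Sum.inr.injEq, free.injEq, true_and, Fin.ext_iff, Fin.val_castSucc, Fin.val_succ]
        omega
      rw [hcs]
      by_cases hlj : l = j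
      · subst hlj
        constructor
        · rw [hval, if_pos rfl]
        · rw [hval, if_neg (by simp), if_pos rfl]
      · have hlt : (l : ℕ) < j := by
          have : (l : ℕ) ≠ j := fun h => hlj (Fin.ext h)
          omega
        obtain ⟨h3, h4⟩ := hs2 l hlt
        constructor
        · rw [hval, if_neg (by simpa using hlj), if_neg (by simp), h3]
        · rw [hval, if_neg (by simp), if_neg (by simpa using hlj), h4]
    · have hlj : l ≠ j := fun h => by rw [h] at hl; omega
      obtain ⟨h3, h4⟩ := hs3 l (by omega)
      constructor
      · rw [hval, if_neg (by simpa using hlj), if_neg (by simp), h3]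
      · rw [hval, if_neg (by simp), if_neg (by simpa using hlj), h4]
  obtain ⟨hP1, hP2, -⟩ := hP
  refine ⟨?_, hP1⟩
  set f : Fin (n + 1) → ZMod 2 := fun j => exec (pivotPhase i) b (.inr (free i j)) with hfdef
  set w : Fin n → ZMod 2 := fun j => b (.inr (img i j))
  have hsucc : ∀ j : Fin n, f j.succ = f j.castSucc + f j.castSucc * w j := fun j => (hP2 j j.2).1
  have hzero : f 0 = 1 := by
    change exec (pivotPhase i) b (.inr (free i 0)) = 1
    rw [hP1 _ (fun j => by simp [(Fin.succ_ne_zero j).symm]) (by simp), hf0]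
  obtain ⟨j₀, hj₀⟩ := hw
  have hw1 : w j₀ = 1 := (bit_cases _).resolve_left hj₀
  have hlast : ∀ m (hm : m < n + 1), (j₀ : ℕ) < m → f ⟨m, hm⟩ = 0 := by
    intro m
    induction m with
    | zero => intro _ h; omega
    | succ m ih =>
      intro hm hjm
      have h := hsucc ⟨m, by omega⟩
      have e1 : (⟨m, by omega⟩ : Fin n).succ = ⟨m + 1, hm⟩ := rfl
      have e2 : (⟨m, by omega⟩ : Fin n).castSucc = ⟨m, by omega⟩ := rfl
      rw [e1, e2] at h
      rw [h]
      by_cases hmj : (j₀ : ℕ) = m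
      · have : (⟨m, by omega⟩ : Fin n) = j₀ := Fin.ext hmj.symm
        rw [this, hw1, mul_one, CharTwo.add_self_eq_zero]
      · rw [ih (by omega) (by omega)]
        simp
  have hsq : ∀ a : ZMod 2, a * a = a := by decide
  have hterm : ∀ j : Fin n, exec (pivotPhase i) b (.inr (pivot i j)) * w j =
      f j.succ - f j.castSucc := fun j => by
    rw [(hP2 j j.2).2, hsucc, add_sub_cancel_left, mul_assoc]
    change _ * (w j * w j) = _
    rw [hsq]
  have htel : ∑ j : Fin n, (f j.succ - f j.castSucc) = f (Fin.last n) - f 0 := by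
    have h1 := Fin.sum_univ_succ f
    have h2 := Fin.sum_univ_castSucc f
    rw [Finset.sum_sub_distrib]
    linear_combination h2 - h1
  have hfin : f (Fin.last n) = 0 := hlast n (by omega) j₀.2
  rw [Finset.sum_congr rfl fun j _ => hterm j, htel, hzero, hfin]
  decide

/-! ### The loop invariant of the program -/

section LoopInvariant

open Matrix

/-- A rank one update of a matrix adds a vector to its kernel. -/
theorem mulVec_update_eq_zero_iff (M : Matrix (Fin n) (Fin n) (ZMod 2)) (S : Set (Bits (Fin n)))
    (hM : ∀ x, M *ᵥ x = 0 ↔ x ∈ Submodule.span (ZMod 2) S) (e a : Bits (Fin n))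
    (he : e ⬝ᵥ M *ᵥ a = 1) (x : Bits (Fin n)) :
    (M + vecMulVec (M *ᵥ a) (e ᵥ* M)) *ᵥ x = 0 ↔ x ∈ Submodule.span (ZMod 2) (insert a S) := by
  have h2 : ∀ y : Bits (Fin n), y + y = 0 := fun y => funext fun i => CharTwo.add_self_eq_zero _
  have h1 : (M + vecMulVec (M *ᵥ a) (e ᵥ* M)) *ᵥ x = M *ᵥ x + (e ⬝ᵥ M *ᵥ x) • (M *ᵥ a) := by
    rw [add_mulVec, vecMulVec_mulVec, ← dotProduct_mulVec, op_smul_eq_smul]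
  rw [h1, Submodule.mem_span_insert]
  constructor
  · intro h
    refine ⟨e ⬝ᵥ M *ᵥ x, x + (e ⬝ᵥ M *ᵥ x) • a, (hM _).1 ?_, ?_⟩
    · rw [mulVec_add, mulVec_smul, h]
    · rw [add_left_comm, h2, add_zero]
  · rintro ⟨c, z, hz, rfl⟩
    rw [mulVec_add, mulVec_smul, (hM z).2 hz, add_zero, dotProduct_smul, he, smul_eq_mul, mul_one, h2]

/-- The matrix stored in the work qubits. -/
def matrix (b : Bits (BankWires n)) : Matrix (Fin n) (Fin n) (ZMod 2) :=
  Matrix.of fun j k => b (.inr (mat j k))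

/-- The state of the qubits after `m` iterations of the program, for the generators `a` and the initial
coefficients `t`. -/
structure Invariant (a : Fin (n / 2) → Bits (Fin n)) (t : Bits (Fin (n / 2))) (m : ℕ)
    (b : Bits (BankWires n)) : Prop where
  one : b (.inr one) = 1
  gen : ∀ i j, b (.inr (gen i j)) = a i j
  img : ∀ (i : Fin (n / 2)) j, m ≤ (i : ℕ) → b (.inr (img i j)) = 0
  free_zero : ∀ (i : Fin (n / 2)), m ≤ (i : ℕ) → b (.inr (free i 0)) = 1
  free_succ : ∀ (i : Fin (n / 2)) (j : Fin n), m ≤ (i : ℕ) → b (.inr (free i j.succ)) = 0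
  pivot : ∀ (i : Fin (n / 2)) j, m ≤ (i : ℕ) → b (.inr (pivot i j)) = 0
  dual : ∀ (i : Fin (n / 2)) j, m ≤ (i : ℕ) → b (.inr (dual i j)) = 0
  ker : ∀ x, matrix b *ᵥ x = 0 ↔ x ∈ Submodule.span (ZMod 2) (a '' {i | (i : ℕ) < m})
  money : ∀ j, b (money j) = ∑ i : Fin (n / 2), if (i : ℕ) < m then t i * a i j else 0
  coeff : ∀ i, b (.inr (coeff i)) = if (i : ℕ) < m then 0 else t i

/-- An iteration preserves the invariant: as the generators are linearly independent, the matrix does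
not annihilate the next one, and the functional found in the search recovers its coefficient from
the money state. -/
theorem Invariant.succ {a : Fin (n / 2) → Bits (Fin n)} (ha : LinearIndependent (ZMod 2) a)
    {t : Bits (Fin (n / 2))} (i : Fin (n / 2)) {b : Bits (BankWires n)} (h : Invariant a t i b) :
    Invariant a t (i + 1) (exec (iteration i) b) := by
  set b₁ := exec (imagePhase i) b with hb₁
  set b₂ := exec (pivotPhase i) b₁ with hb₂
  set b₃ := exec (dualPhase i) b₂ with hb₃
  set b₄ := exec (matPhase i) b₃ with hb₄
  set b₅ := exec (moneyPhase i) b₄ with hb₅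
  set b₆ := exec (coeffPhase i) b₅ with hb₆
  have hb : exec (iteration i) b = b₆ := by
    simp only [iteration, exec_append, hb₁, hb₂, hb₃, hb₄, hb₅, hb₆]
  set M := matrix b with hM
  set w := M *ᵥ a i with hw
  -- the image of the generator is not zero
  have hw0 : ∃ j, w j ≠ 0 := by
    by_contra! hcon
    refine ha.notMem_span_image (s := {l | (l : ℕ) < i}) (x := i) (by simp) ((h.ker _).1 ?_)
    exact funext hcon
  have n₁ : ∀ c, (∀ j, .inr (Scratch.img i j) ≠ c) → b₁ c = b c := fun c hc =>
    exec_phase_of_ne _ _ hc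
  have v₁ : ∀ j, b₁ (.inr (Scratch.img i j)) = w j := fun j => by
    rw [hb₁, imagePhase, exec_phase (fun _ _ h => by simpa using h) (by simp) (by simp),
      h.img i j le_rfl, zero_add, hw, mulVec, dotProduct]
    exact Finset.sum_congr rfl fun k _ => by rw [h.gen]; rfl
  obtain ⟨v₂, n₂⟩ := exec_pivotPhase i b₁ (by rw [n₁ _ (by simp), h.one])
    (by rw [n₁ _ (by simp), h.free_zero i le_rfl])
    (fun j => by rw [n₁ _ (by simp), h.free_succ i j le_rfl])
    (fun j => by rw [n₁ _ (by simp), h.pivot i j le_rfl]) (by simpa only [v₁] using hw0)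
  rw [← hb₂] at v₂ n₂
  set e : Bits (Fin n) := fun j => b₂ (.inr (Scratch.pivot i j)) with he
  have hew : e ⬝ᵥ w = 1 := by
    simp only [v₁] at v₂
    exact v₂
  set v := e ᵥ* M with hv
  have n₃ : ∀ c, (∀ j, .inr (Scratch.dual i j) ≠ c) → b₃ c = b₂ c := fun c hc =>
    exec_phase_of_ne _ _ hc
  have v₃ : ∀ k, b₃ (.inr (Scratch.dual i k)) = v k := fun k => by
    rw [hb₃, dualPhase, exec_phase (fun _ _ h => by simpa using h) (by simp) (by simp),
      n₂ _ (by simp) (by simp), n₁ _ (by simp), h.dual i k le_rfl, zero_add, hv, vecMul, dotProduct]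
    exact Finset.sum_congr rfl fun j _ => by
      rw [n₂ (.inr (mat j k)) (by simp) (by simp), n₁ _ (by simp)]; rfl
  have n₄ : ∀ c, (∀ j k, .inr (mat j k) ≠ c) → b₄ c = b₃ c := fun c hc =>
    exec_phase_of_ne _ _ fun p => hc p.1 p.2
  have v₄ : ∀ j k, b₄ (.inr (mat j k)) = M j k + w j * v k := fun j k => by
    have := exec_phase (κ := Fin n × Fin n) (ι := Unit)
      (x := fun p _ => (.inr (Scratch.img i p.1) : BankWires n))
      (y := fun p _ => .inr (Scratch.dual i p.2)) (z := fun p => .inr (mat p.1 p.2))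
      (fun p q h => by simpa [Prod.ext_iff] using h) (by simp) (by simp) b₃ (j, k)
    rw [hb₄, matPhase, this, n₃ _ (by simp), n₂ _ (by simp) (by simp), n₁ _ (by simp)]
    simp only [Finset.univ_unique, Finset.sum_singleton]
    rw [n₃ _ (by simp), n₂ _ (by simp) (by simp), v₁, v₃]
    rfl
  have n₅ : ∀ c, (∀ j, Bank.money j ≠ c) → b₅ c = b₄ c := fun c hc =>
    exec_phase_of_ne _ _ hc
  have v₅ : ∀ j, b₅ (Bank.money j) =
      ∑ l : Fin (n / 2), if (l : ℕ) < i + 1 then t l * a l j else 0 := fun j => by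
    rw [hb₅, moneyPhase, exec_phase (fun _ _ h => by simpa using h) (by simp) (by simp)]
    simp only [Finset.univ_unique, Finset.sum_singleton]
    have hsplit : ∀ l : Fin (n / 2), (if (l : ℕ) < i + 1 then t l * a l j else 0) =
        (if (l : ℕ) < i then t l * a l j else 0) + if l = i then t l * a l j else 0 := fun l => by
      rcases lt_trichotomy (l : ℕ) i with hl | hl | hl
      · rw [if_pos (by omega), if_pos hl, if_neg (by rintro rfl; omega), add_zero]
      · obtain rfl := Fin.ext hl
        simp
      · rw [if_neg (by omega), if_neg (by omega), if_neg (by rintro rfl; omega), add_zero]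
    rw [n₄ _ (by simp), n₃ _ (by simp), n₂ _ (by simp) (by simp), n₁ _ (by simp), h.money,
      n₄ _ (by simp), n₃ _ (by simp), n₂ _ (by simp) (by simp), n₁ _ (by simp), h.coeff,
      n₄ _ (by simp), n₃ _ (by simp), n₂ _ (by simp) (by simp), n₁ _ (by simp), h.gen,
      if_neg (lt_irrefl _), Finset.sum_congr rfl fun l _ => hsplit l, Finset.sum_add_distrib]
    simp
  have n₆ : ∀ c, .inr (Scratch.coeff i) ≠ c → b₆ c = b₅ c := fun c hc =>
    exec_phase_of_ne _ _ fun _ => hc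
  have v₆ : b₆ (.inr (Scratch.coeff i)) = 0 := by
    have := exec_phase (κ := Unit) (ι := Fin n) (x := fun _ j => (.inr (Scratch.dual i j) : BankWires n))
      (y := fun _ j => Bank.money j) (z := fun _ => .inr (Scratch.coeff i))
      (fun _ _ _ => Subsingleton.elim _ _) (by simp) (by simp) b₅ ()
    rw [hb₆, coeffPhase, this, n₅ _ (by simp), n₄ _ (by simp), n₃ _ (by simp),
      n₂ _ (by simp) (by simp), n₁ _ (by simp), h.coeff, if_neg (lt_irrefl _)]
    have hd : ∀ j, b₅ (.inr (Scratch.dual i j)) = v j := fun j => by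
      rw [n₅ _ (by simp), n₄ _ (by simp), v₃]
    have hva : ∀ l : Fin (n / 2), (l : ℕ) < i + 1 → v ⬝ᵥ a l = if l = i then 1 else 0 := by
      intro l hl
      rw [hv, ← dotProduct_mulVec]
      by_cases hli : l = i
      · rw [if_pos hli, hli, hew]
      · have hlt : (l : ℕ) < i := by
          have : (l : ℕ) ≠ i := fun h => hli (Fin.ext h)
          omega
        rw [if_neg hli, (h.ker (a l)).2 (Submodule.subset_span ⟨l, hlt, rfl⟩), dotProduct_zero]
    have hsum : ∑ j, v j * (∑ l : Fin (n / 2), if (l : ℕ) < i + 1 then t l * a l j else 0) = t i := by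
      have h1 : ∀ l : Fin (n / 2), ∑ j, v j * (if (l : ℕ) < i + 1 then t l * a l j else 0) =
          if l = i then t i else 0 := fun l => by
        by_cases hl : (l : ℕ) < i + 1
        · have h2 : ∀ j, v j * (t l * a l j) = t l * (v j * a l j) := fun j => by ring
          have h3 := hva l hl
          simp only [dotProduct] at h3
          simp only [if_pos hl, h2, ← Finset.mul_sum, h3]
          by_cases hli : l = i
          · subst hli; simp
          · simp [hli]
        · rw [if_neg (by rintro rfl; omega)]
          simp [hl]
      simp only [Finset.mul_sum]
      rw [Finset.sum_comm, Finset.sum_congr rfl fun l _ => h1 l]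
      simp
    simp only [hd, v₅]
    rw [hsum, CharTwo.add_self_eq_zero]
  rw [hb]
  have ne_of_le : ∀ {l : Fin (n / 2)}, (i : ℕ) + 1 ≤ l → i ≠ l := by
    rintro l hl rfl
    omega
  refine ⟨?_, fun l j => ?_, fun l j hl => ?_, fun l hl => ?_, fun l j hl => ?_, fun l j hl => ?_,
    fun l j hl => ?_, fun x => ?_, fun j => ?_, fun l => ?_⟩
  · rw [n₆ _ (by simp), n₅ _ (by simp), n₄ _ (by simp), n₃ _ (by simp), n₂ _ (by simp) (by simp),
      n₁ _ (by simp), h.one]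
  · rw [n₆ _ (by simp), n₅ _ (by simp), n₄ _ (by simp), n₃ _ (by simp), n₂ _ (by simp) (by simp),
      n₁ _ (by simp), h.gen]
  · rw [n₆ _ (by simp), n₅ _ (by simp), n₄ _ (by simp), n₃ _ (by simp), n₂ _ (by simp) (by simp),
      n₁ _ (by simp [ne_of_le hl]), h.img _ _ (by omega)]
  · rw [n₆ _ (by simp), n₅ _ (by simp), n₄ _ (by simp), n₃ _ (by simp),
      n₂ _ (by simp [(ne_of_le hl).symm]) (by simp), n₁ _ (by simp), h.free_zero _ (by omega)]
  · rw [n₆ _ (by simp), n₅ _ (by simp), n₄ _ (by simp), n₃ _ (by simp),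
      n₂ _ (by simp [(ne_of_le hl).symm]) (by simp), n₁ _ (by simp), h.free_succ _ _ (by omega)]
  · rw [n₆ _ (by simp), n₅ _ (by simp), n₄ _ (by simp), n₃ _ (by simp),
      n₂ _ (by simp) (by simp [(ne_of_le hl).symm]), n₁ _ (by simp), h.pivot _ _ (by omega)]
  · rw [n₆ _ (by simp), n₅ _ (by simp), n₄ _ (by simp), n₃ _ (by simp [ne_of_le hl]),
      n₂ _ (by simp) (by simp), n₁ _ (by simp), h.dual _ _ (by omega)]
  · have hmat : matrix b₆ = M + vecMulVec w v := by
      ext j k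
      rw [matrix, of_apply, n₆ _ (by simp), n₅ _ (by simp), v₄, Matrix.add_apply, vecMulVec_apply]
    have hset : {l : Fin (n / 2) | (l : ℕ) < i + 1} =
        insert i {l : Fin (n / 2) | (l : ℕ) < i} := by
      ext l
      simp only [Set.mem_ofPred_eq, Set.mem_insert_iff, Fin.ext_iff]
      omega
    rw [hmat, hset, Set.image_insert_eq]
    exact mulVec_update_eq_zero_iff M _ h.ker e (a i) hew x
  · rw [n₆ _ (by simp), v₅]
  · by_cases hli : i = l
    · subst hli
      rw [v₆, if_pos (by omega)]
    · rw [n₆ _ (by simpa using hli), n₅ _ (by simp), n₄ _ (by simp), n₃ _ (by simp),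
        n₂ _ (by simp) (by simp), n₁ _ (by simp), h.coeff]
      have : (l : ℕ) ≠ i := fun h => hli (Fin.ext h.symm)
      by_cases hlt : (l : ℕ) < i
      · rw [if_pos hlt, if_pos (by omega)]
      · rw [if_neg hlt, if_neg (by omega)]

/-- The program turns coefficients `t` into the linear combination of the generators, and erases
them. -/
theorem exec_program {a : Fin (n / 2) → Bits (Fin n)} (ha : LinearIndependent (ZMod 2) a)
    {t : Bits (Fin (n / 2))} {b : Bits (BankWires n)} (h : Invariant a t 0 b) :
    (∀ j, exec (program n) b (money j) = ∑ i, t i * a i j) ∧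
    ∀ i, exec (program n) b (.inr (coeff i)) = 0 := by
  have hP : Invariant a t (n / 2) (exec (program n) b) := by
    rw [program, exec_flatMap]
    exact foldl_finRange _ _ (Invariant a t) b h fun i s hs => hs.succ ha i
  exact ⟨fun j => by simp [hP.money], fun i => by simp [hP.coeff]⟩

end LoopInvariant

/-! ### The circuit of the bank -/

/-- The qubits of the seed and of the coefficients. -/
def seedWires : Fin n ⊕ Fin (n / 2) ↪ BankWires n where
  toFun := Sum.elim (fun j => .inr (seed j)) fun i => .inr (coeff i)
  inj' := by rintro (a | a) (b | b) h <;> simp_all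

/-- The qubits that receive the answer of the generator. -/
def answerWires : Fin (n / 2) × Fin n ⊕ Fin (3 * n) ↪ BankWires n where
  toFun := Sum.elim (fun p => .inr (gen p.1 p.2)) fun l => .inl (.inl l)
  inj' := by rintro (a | a) (b | b) h <;> simp_all [Prod.ext_iff]

/-- The qubits that are `1` initially. -/
def ones (n : ℕ) : List (BankWires n) :=
  .inr one :: ((List.finRange n).map (fun a => .inr (mat a a)) ++
    (List.finRange (n / 2)).map fun i => .inr (free i 0))

/-- Generate a banknote. -/
noncomputable def circuit (n : ℕ) : Circuit n (BankWires n) :=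
  (ones n).map notGate ++
  (Finset.univ.toList.map (fun j => hadamard (seedWires j)) ++
  ((Finset.univ.toList.map (fun j => hadamard (answerWires j)) ++
    [.generator (.inr one) (fun j => .inr (seed j)) (fun i j => .inr (gen i j))
      (fun l => .inl (.inl l))] ++
    Finset.univ.toList.map (fun j => hadamard (answerWires j))) ++
  (program n).flatMap toffoli))

/-- The bits before the program, for a seed and coefficients `z` and an answer `v` of the
generator. -/
def bits (z : Bits (Fin n ⊕ Fin (n / 2))) (v : Bits (Fin (n / 2) × Fin n ⊕ Fin (3 * n))) :
    Bits (BankWires n)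
  | .inl (.inl l) => v (.inr l)
  | .inr one => 1
  | .inr (seed j) => z (.inl j)
  | .inr (coeff i) => z (.inr i)
  | .inr (gen i j) => v (.inl (i, j))
  | .inr (mat a b) => if a = b then 1 else 0
  | .inr (free _ a) => if a = 0 then 1 else 0
  | _ => 0

theorem nodup_ones : (ones n).Nodup := by
  refine List.nodup_cons.2 ⟨by simp, List.Nodup.append ?_ ?_ ?_⟩
  · exact (List.nodup_finRange n).map fun a b h => by simpa using h
  · exact (List.nodup_finRange _).map fun a b h => by simpa using h
  · intro c hc hc'
    obtain ⟨a, -, rfl⟩ := List.mem_map.1 hc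
    simp at hc'

theorem runIn_ones (wd : World n) :
    Circuit.runIn wd ((ones n).map notGate) (ket 0) = ket (bits 0 0) := by
  rw [runIn_map_notGate wd _ nodup_ones]
  congr 1
  funext c
  rcases c with (l | j) | c
  · simp [ones, bits]
  · simp [ones, bits]
  · cases c <;> simp [ones, bits, eq_comm]

theorem extend_seedWires (z : Bits (Fin n ⊕ Fin (n / 2)))
    (v : Bits (Fin (n / 2) × Fin n ⊕ Fin (3 * n))) :
    Function.extend seedWires z (bits 0 v) = bits z v := by
  refine extend_eq (Function.Embedding.injective _) ?_ ?_
  · rintro (j | i) <;> rfl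
  · rintro ((l | j) | c) h
    · rfl
    · rfl
    · cases c with
      | seed j => exact absurd rfl (h (.inl j))
      | coeff i => exact absurd rfl (h (.inr i))
      | _ => rfl

theorem extend_answerWires (z : Bits (Fin n ⊕ Fin (n / 2)))
    (v : Bits (Fin (n / 2) × Fin n ⊕ Fin (3 * n))) :
    Function.extend answerWires v (bits z 0) = bits z v := by
  refine extend_eq (Function.Embedding.injective _) ?_ ?_
  · rintro (j | i) <;> rfl
  · rintro ((l | j) | c) h
    · exact absurd rfl (h (.inr l))
    · rfl
    · cases c with
      | gen i j => exact absurd rfl (h (.inl (i, j)))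
      | _ => rfl

/-- The answer of the generator. -/
def answer (O : Oracle n) (r : Bits (Fin n)) : Bits (Fin (n / 2) × Fin n ⊕ Fin (3 * n)) :=
  Sum.elim (fun p => O.gens r p.1 p.2) (O.serial r)

/-- The final bits of the circuit for a seed and coefficients `z`. -/
noncomputable def finalBits (O : Oracle n) (z : Bits (Fin n ⊕ Fin (n / 2))) : Bits (BankWires n) :=
  exec (program n) (bits z (answer O (z ∘ .inl)))

/-- The circuit prepares a uniform superposition over all seeds and coefficients, and computes. -/
theorem run_circuit (O : Oracle n) :
    (circuit n).run O (ket 0) =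
      (((√2 : ℝ) : ℂ)⁻¹) ^ (n + n / 2) • ∑ z, ket (finalBits O z) := by
  rw [Circuit.run_eq_runIn, circuit, Circuit.runIn_append, Circuit.runIn_append,
    Circuit.runIn_append, runIn_ones, runIn_hadamard_ket_eq_sum O.world seedWires _
      (Finset.nodup_toList _) (fun j => Finset.mem_toList.2 (Finset.mem_univ j)) _
      (by funext j; rcases j with j | j <;> rfl)]
  simp only [map_smul, map_sum, Fintype.card_sum, Fintype.card_fin]
  congr 1
  refine Finset.sum_congr rfl fun z _ => ?_
  rw [extend_seedWires, runIn_hadamard_phase_hadamard O.world answerWires _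
    (Finset.nodup_toList _) (fun j => Finset.mem_toList.2 (Finset.mem_univ j)) _ _
    (by funext j; rcases j with j | j <;> rfl) (answer O (z ∘ .inl)), extend_answerWires,
    runIn_flatMap_toffoli _ _ fun t ht => proper_of_mem_program ht]
  · rfl
  · intro ψ y
    rw [extend_answerWires]
    have h : O.world.generatorBit (bits z y ∘ fun j => .inr (seed j))
        (fun i => bits z y ∘ fun j => .inr (gen i j)) (bits z y ∘ fun l => .inl (.inl l)) =
        y ⬝ᵥ answer O (z ∘ .inl) := by
      change O.generatorBit _ _ _ = _
      simp only [Oracle.generatorBit, dotProduct, Fintype.sum_sum_type, Fintype.sum_prod_type]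
      rfl
    simp only [Gate.act, Gate.Flips, Gate.unitaryPart, h, sgn]
    simp [bits]
  · intro ψ b' h
    simp [Gate.act, Gate.unitaryPart, h]

/-! ### The output of the circuit -/

theorem invariant_bits (O : Oracle n) (z : Bits (Fin n ⊕ Fin (n / 2))) :
    Invariant (O.gens (z ∘ .inl)) (z ∘ .inr) 0 (bits z (answer O (z ∘ .inl))) where
  one := rfl
  gen _ _ := rfl
  img _ _ _ := rfl
  free_zero _ _ := rfl
  free_succ _ _ _ := by simp [bits]
  pivot _ _ _ := rfl
  dual _ _ _ := rfl
  ker x := by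
    have : matrix (bits z (answer O (z ∘ .inl))) = 1 := by
      ext a b
      simp [matrix, bits, Matrix.one_apply]
    simp [this]
  money _ := by simp [bits]
  coeff _ := by simp [bits]

/-- The work qubits at the end. They depend on the seed only, see `finalBits_elim`; the coefficients are
set to `0` here. -/
noncomputable def garbage (O : Oracle n) (r : Bits (Fin n)) : Bits (Scratch n) :=
  finalBits O (Sum.elim r 0) ∘ .inr

theorem injective_garbage (O : Oracle n) : (garbage O).Injective := by
  intro r r' h
  funext j
  have := congrFun h (seed j)
  simpa [garbage, finalBits, exec_program_seed, bits] using this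

theorem linearIndependent_gens (O : Oracle n) (r : Bits (Fin n)) :
    LinearIndependent (ZMod 2) (O.gens r) := O.2.1 r

/-- The final bits: the serial number, the linear combination of the generators, and the garbage. The
coefficients have been erased, so they leave no trace but the money state. -/
theorem finalBits_elim (O : Oracle n) (r : Bits (Fin n)) (t : Bits (Fin (n / 2))) :
    finalBits O (Sum.elim r t) =
      Sum.elim (Sum.elim (O.serial r) (∑ i, t i • O.gens r i)) (garbage O r) := by
  have ht := exec_program (linearIndependent_gens O r) (invariant_bits O (Sum.elim r t))
  have h0 := exec_program (linearIndependent_gens O r) (invariant_bits O (Sum.elim r 0))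
  funext c
  rcases c with (l | j) | c
  · rw [finalBits, exec_program_serial]
    rfl
  · rw [finalBits, ht.1]
    simp
  · by_cases hc : IsData (.inr c : BankWires n)
    · cases c with
      | coeff i => exact (ht.2 i).trans (h0.2 i).symm
      | _ => exact hc.elim
    · refine exec_congr IsData _ (fun t ht => isData_of_mem_program ht) _ _ (fun c' hc' => ?_) _ hc
      rcases c' with (l | j) | c'
      · rfl
      · rfl
      · cases c' with
        | coeff i => exact absurd trivial hc'
        | _ => rfl

theorem card_subspace (O : Oracle n) (r : Bits (Fin n)) :
    Nat.card (O.subspace r) = 2 ^ (n / 2) := by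
  rw [Module.natCard_eq_pow_finrank (K := ZMod 2), Oracle.subspace,
    finrank_span_eq_card (linearIndependent_gens O r), Nat.card_zmod, Fintype.card_fin]

/-- The linear combinations of the generators are the vectors of the hidden subspace. -/
theorem sum_ket_eq_banknote (O : Oracle n) (r : Bits (Fin n)) (x : Bits (Note n)) :
    ∑ t : Bits (Fin (n / 2)), ket (Sum.elim (O.serial r) (∑ i, t i • O.gens r i)) x =
      ((√2 : ℝ) : ℂ) ^ (n / 2) * banknote O r x := by
  have hinj := (linearIndependent_gens O r).fintypeLinearCombination_injective
  have hone : ((√2 : ℝ) : ℂ) ^ (n / 2) * ((√(Nat.card (O.subspace r) : ℝ) : ℝ) : ℂ)⁻¹ = 1 := by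
    rw [card_subspace, Nat.cast_pow, Nat.cast_ofNat, Real.sqrt_eq_rpow, Real.sqrt_eq_rpow,
      ← Real.rpow_natCast, ← Real.rpow_mul (by norm_num), mul_comm ((n / 2 : ℕ) : ℝ),
      Real.rpow_mul (by norm_num), Real.rpow_natCast, Complex.ofReal_pow]
    refine mul_inv_cancel₀ (pow_ne_zero _ ?_)
    rw [← Real.sqrt_eq_rpow]
    simp
  by_cases h : x ∘ Sum.inl = O.serial r ∧ x ∘ Sum.inr ∈ O.subspace r
  · obtain ⟨h1, h2⟩ := h
    rw [Oracle.subspace, ← Fintype.range_linearCombination] at h2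
    obtain ⟨t, ht⟩ := h2
    have h2 : x ∘ Sum.inr ∈ O.subspace r := by
      rw [Oracle.subspace, ← Fintype.range_linearCombination]
      exact ⟨t, ht⟩
    rw [Finset.sum_eq_single t]
    · simp only [banknote, subspaceState, if_pos h1, if_pos h2, hone, ket]
      rw [if_pos]
      rw [← Sum.elim_comp_inl_inr x, h1, ← ht]
      rfl
    · intro t' _ htt
      rw [ket, if_neg]
      rintro rfl
      apply htt
      apply hinj
      rw [ht]
      rfl
    · simp
  · rw [Finset.sum_eq_zero]
    · rw [banknote]
      split_ifs with h1
      · rw [subspaceState, if_neg fun h2 => h ⟨h1, h2⟩, mul_zero]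
      · rw [mul_zero]
    · intro t _
      rw [ket, if_neg]
      rintro rfl
      refine h ⟨rfl, ?_⟩
      rw [Oracle.subspace, ← Fintype.range_linearCombination]
      exact ⟨t, rfl⟩

/-- The final state is `2^(-n/2) ∑_r |s_r⟩|A_r⟩|garbage r⟩`. -/
theorem run_circuit_apply [DecidableEq (Bits (Scratch n))] (O : Oracle n) (x : Bits (Note n))
    (s : Bits (Scratch n)) :
    (circuit n).run O (ket 0) (Sum.elim x s) =
      (((√2 : ℝ) : ℂ)⁻¹) ^ n * ∑ r, if s = garbage O r then banknote O r x else 0 := by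
  have hket : ∀ (r : Bits (Fin n)) (t : Bits (Fin (n / 2))),
      ket (finalBits O (Sum.elim r t)) (Sum.elim x s) =
        if s = garbage O r then
          ket (Sum.elim (O.serial r) (∑ i, t i • O.gens r i)) x else 0 := fun r t => by
    rw [finalBits_elim]
    simp only [ket]
    have : (Sum.elim x s = Sum.elim (Sum.elim (O.serial r) (∑ i, t i • O.gens r i)) (garbage O r)) ↔
        x = Sum.elim (O.serial r) (∑ i, t i • O.gens r i) ∧ s = garbage O r := by
      rw [Sum.elim_eq_iff]
    simp only [this]
    by_cases hs : s = garbage O r <;> simp [hs]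
  rw [run_circuit, Pi.smul_apply, Finset.sum_apply, smul_eq_mul,
    ← (Equiv.sumArrowEquivProdArrow (Fin n) (Fin (n / 2)) (ZMod 2)).symm.sum_comp,
    Fintype.sum_prod_type]
  have h1 : ∀ r : Bits (Fin n), ∑ t : Bits (Fin (n / 2)),
      ket (finalBits O ((Equiv.sumArrowEquivProdArrow (Fin n) (Fin (n / 2)) (ZMod 2)).symm (r, t)))
        (Sum.elim x s) =
      ((√2 : ℝ) : ℂ) ^ (n / 2) * if s = garbage O r then banknote O r x else 0 := fun r => by
    refine (Finset.sum_congr rfl fun t _ => hket r t).trans ?_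
    split_ifs
    · exact sum_ket_eq_banknote O r x
    · simp
  rw [Finset.sum_congr rfl fun r _ => h1 r, ← Finset.mul_sum, ← mul_assoc, pow_add,
    mul_assoc _ _ (_ ^ (n / 2)), ← mul_pow, inv_mul_cancel₀ (by simp), one_pow, mul_one]

/-! ### The size of the circuit -/

/-- An injective labelling of the work qubits, which bounds their number. -/
def label (n : ℕ) : Scratch n → Fin 9 × Fin (n + 1) × Fin (n + 1)
  | one => (0, 0, 0)
  | seed j => (1, j.castSucc, 0)
  | gen i j => (2, i.castLE (by omega), j.castSucc)
  | mat a b => (3, a.castSucc, b.castSucc)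
  | img i a => (4, i.castLE (by omega), a.castSucc)
  | free i a => (5, i.castLE (by omega), a)
  | pivot i a => (6, i.castLE (by omega), a.castSucc)
  | dual i a => (7, i.castLE (by omega), a.castSucc)
  | coeff i => (8, i.castLE (by omega), 0)

theorem injective_label : (label n).Injective := by
  intro a b h
  cases a <;> cases b <;> simp_all [label, Prod.ext_iff]

noncomputable instance : Fintype (Scratch n) := Fintype.ofInjective _ injective_label

theorem card_scratch_le : Fintype.card (Scratch n) ≤ 9 * (n + 1) ^ 2 := by
  refine (Fintype.card_le_of_injective _ injective_label).trans ?_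
  simp only [Fintype.card_prod, Fintype.card_fin]
  exact le_of_eq (by ring)

theorem isElementary_circuit : ∀ g ∈ circuit n, g.IsElementary := by
  intro g hg
  simp only [circuit, List.mem_append, List.mem_map, List.mem_flatMap, List.mem_singleton] at hg
  rcases hg with ⟨c, -, rfl⟩ | ⟨j, -, rfl⟩ | ((⟨j, -, rfl⟩ | rfl) | ⟨j, -, rfl⟩) | ⟨t, -, hg⟩
  · exact isElementary_involution (by norm_num) _ _ _
  · exact isElementary_hadamard _
  · exact isElementary_hadamard _
  · trivial
  · exact isElementary_hadamard _
  · exact isElementary_toffoli t g hg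

theorem length_program : (program n).length = n / 2 * (3 * n ^ 2 + 5 * n) := by
  have h : ∀ i : Fin (n / 2), (iteration i).length = 3 * n ^ 2 + 5 * n := fun i => by
    simp [iteration, imagePhase, pivotPhase, pivotStep, dualPhase, matPhase, moneyPhase, coeffPhase,
      phase, List.length_flatMap]
    ring
  simp [program, List.length_flatMap, h]

theorem length_circuit_le : (circuit n).length ≤ 20 * (n + 1) ^ 3 := by
  have h1 := length_flatMap_toffoli_le (n := n) (program n)
  have h2 : n / 2 ≤ n := Nat.div_le_self n 2
  have h3 : n / 2 * (3 * n ^ 2 + 5 * n) ≤ n * (3 * n ^ 2 + 5 * n) := Nat.mul_le_mul_right _ h2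
  have h4 : n / 2 * n ≤ n * n := Nat.mul_le_mul_right _ h2
  rw [length_program] at h1
  simp only [circuit, ones, List.length_append, List.length_map, Finset.length_toList,
    Finset.card_univ, Fintype.card_sum, Fintype.card_prod, Fintype.card_fin, List.length_cons,
    List.length_finRange, List.length_nil]
  nlinarith [sq_nonneg n]

/-! ### The bank -/

/-- The garbage, which determines the seed, removes the coherence between different seeds. -/
theorem sum_run_circuit (O : Oracle n) (x y : Bits (Note n)) :
    ∑ s, (circuit n).run O (ket 0) (Sum.elim x s) *
      (starRingEnd ℂ) ((circuit n).run O (ket 0) (Sum.elim y s)) = bankOutput O x y := by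
  have hrow : ∀ (f : Bits (Fin n) → ℂ) (s : Bits (Scratch n)) (r : Bits (Fin n)),
      s = garbage O r → (∑ r', if s = garbage O r' then f r' else 0) = f r := by
    rintro f s r rfl
    rw [Finset.sum_eq_single r]
    · simp
    · intro r' _ h
      rw [if_neg fun h' => h (injective_garbage O h').symm]
    · simp
  have hc : (((√2 : ℝ) : ℂ)⁻¹) ^ n * (starRingEnd ℂ) ((((√2 : ℝ) : ℂ)⁻¹) ^ n) = ((2 : ℂ) ^ n)⁻¹ := by
    rw [map_pow, map_inv₀, Complex.conj_ofReal, ← mul_pow, inv_sqrt_two_mul_self, one_div, inv_pow]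
  have h : ∀ s, (circuit n).run O (ket 0) (Sum.elim x s) *
      (starRingEnd ℂ) ((circuit n).run O (ket 0) (Sum.elim y s)) =
      ((2 : ℂ) ^ n)⁻¹ * ∑ r, if s = garbage O r then
        banknote O r x * (starRingEnd ℂ) (banknote O r y) else 0 := by
    intro s
    rw [run_circuit_apply, run_circuit_apply, map_mul, mul_mul_mul_comm, hc]
    congr 1
    by_cases hs : ∃ r, s = garbage O r
    · obtain ⟨r, hs⟩ := hs
      rw [hrow _ s r hs, hrow _ s r hs, hrow _ s r hs]
    · have hs' : ∀ r, s ≠ garbage O r := fun r h => hs ⟨r, h⟩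
      simp [hs']
  rw [Finset.sum_congr rfl fun s _ => h s, ← Finset.mul_sum, Finset.sum_comm, bankOutput,
    Matrix.of_apply]
  simp

end Bank

open Bank in
/-- Circuits of polynomial size generate banknotes. -/
theorem bankPolynomialSize : BankPolynomialSize := by
  classical
  refine ⟨20 * (Polynomial.X + 1) ^ 3, fun n => ?_⟩
  have heval : (20 * (Polynomial.X + 1) ^ 3 : Polynomial ℕ).eval n = 20 * (n + 1) ^ 3 := by simp
  let e : BankWires n ≃ Note n ⊕ Fin (Fintype.card (Scratch n)) :=
    Equiv.sumCongr (Equiv.refl _) (Fintype.equivFin _)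
  refine ⟨Fintype.card (Scratch n), ?_, (circuit n).map (Gate.map e.toEmbedding), ?_, ?_, ?_⟩
  · rw [heval]
    refine card_scratch_le.trans ?_
    nlinarith [Nat.zero_le n, sq_nonneg n]
  · rw [heval, List.length_map]
    exact length_circuit_le
  · intro g hg
    obtain ⟨g', hg', rfl⟩ := List.mem_map.1 hg
    have := isElementary_circuit g' hg'
    cases g' <;> exact this
  · intro O x y
    have hrun : ∀ (x : Bits (Note n)) (z : Bits (Fin (Fintype.card (Scratch n)))),
        Circuit.run O ((circuit n).map (Gate.map e.toEmbedding)) (Pi.single 0 1) (Sum.elim x z) =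
          (circuit n).run O (ket 0) (Sum.elim x (z ∘ Fintype.equivFin _)) := by
      intro x z
      rw [Circuit.run_eq_runIn, Circuit.run_eq_runIn, Circuit.runIn_map]
      have h1 : (fun a => (Pi.single 0 1 : State (Note n ⊕ Fin (Fintype.card (Scratch n))))
          (Function.extend e.toEmbedding a (Sum.elim x z))) = ket 0 := by
        funext a
        have : Function.extend e.toEmbedding a (Sum.elim x z) = 0 ↔ a = 0 := by
          constructor
          · intro h
            rw [← extend_comp' e.injective a (Sum.elim x z)]
            exact congrArg (· ∘ e) h
          · rintro rfl
            funext w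
            obtain ⟨v, rfl⟩ := e.surjective w
            exact e.injective.extend_apply _ _ _
        by_cases ha : a = 0
        · rw [this.2 ha, ha]; simp [ket]
        · rw [Pi.single_eq_of_ne fun h => ha (this.1 h), ket, if_neg ha]
      rw [h1]
      refine congrArg _ (funext fun w => ?_)
      rcases w with w | w <;> rfl
    simp only [hrun]
    rw [← sum_run_circuit O x y]
    exact Fintype.sum_equiv ((Fintype.equivFin (Scratch n)).arrowCongr (Equiv.refl _)).symm _ _
      fun z => rfl

end HiddenSubspace

theorem theorem5p5 :
    HiddenSubspace.BankPolynomialSize ∧ HiddenSubspace.VerifierPolynomialSize ∧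
    HiddenSubspace.PerfectCompleteness ∧
    ∃ c : ℝ, 0 < c ∧ HiddenSubspace.HasSoundnessError fun n => (2 : ℝ) ^ (-(c * (n : ℝ))) :=
  ⟨HiddenSubspace.bankPolynomialSize, HiddenSubspace.verifierPolynomialSize,
    HiddenSubspace.perfectCompleteness, 1 / 8, by norm_num, HiddenSubspace.hasSoundnessError⟩
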